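/- For an open set $\Omega\subset\mathbb R^2$ with compact closure, let $T(\Omega)=\int_\Omega u\,dx\,dy$ be its torsional rigidity, where $u$ is the torsion function of $\Omega$, i.e. the function that is $C^2$ in $\Omega$, continuous on $\overline\Omega$, and satisfies $\Delta u=-1$ in $\Omega$ and $u=0$ on $\partial\Omega$. Two such sets are called Dirichlet isospectral if, for every real $\lambda$, the spaces of solutions ($C^2$ inside, continuous up to the boundary) of $\Delta u+\lambda u=0$ in the set, $u=0$ on the boundary, have the same dimension for both sets; that is, they have the same Dirichlet eigenvalues with the same multiplicities. A bounded open planar set is called piecewise smoothly bounded if it is the interior of its closure and its boundary is a finite disjoint union of simple closed piecewise smooth curves. There are piecewise smoothly bounded open planar sets $C_1$ and $C_2$ that are Dirichlet isospectral but for which $T(C_1)\neq T(C_2)$. More precisely, let $$C_1=\big((0,1)\times(0,1)\big)\cup\{(x,y): x>3,\ y>0,\ (x-3)+y<2\},$$ the disjoint union of a unit square and a right isosceles triangle with legs of length $2$, and let $$C_2=\big((0,2)\times(0,1)\big)\cup\{(x,y): x>3,\ y>0,\ (x-3)+y<\sqrt2\},$$ the disjoint union of a $2\times1$ rectangle and a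 right isosceles triangle with legs of length $\sqrt2$. Then $C_1$ and $C_2$ are piecewise smoothly bounded and Dirichlet isospectral, each has exactly one torsion function, and $T(C_1)<T(C_2)$. -/

import Mathlib

open MeasureTheory
open scoped ContDiff Laplacian

noncomputable section

/-- The Euclidean plane. -/
abbrev Plane : Type := EuclideanSpace ℝ (Fin 2)

/-- `Γ` is a simple closed piecewise smooth curve: it is parametrized by `γ` on `[0, n]`, where
`γ` is continuous, closes up, is otherwise injective, and is smooth with nonvanishing velocity on
each of the `n` intervals `[i, i + 1]` (one-sided derivatives at the end points). -/
def IsPiecewiseSmoothClosedCurve (Γ : Set Plane) : Prop :=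
  ∃ (n : ℕ) (γ : ℝ → Plane), 0 < n ∧
    ContinuousOn γ (Set.Icc 0 (n : ℝ)) ∧ γ 0 = γ n ∧ Set.InjOn γ (Set.Ico 0 (n : ℝ)) ∧
    (∀ i : ℕ, i < n → ContDiffOn ℝ ∞ γ (Set.Icc (i : ℝ) (i + 1)) ∧
      ∀ s ∈ Set.Icc (i : ℝ) (i + 1), derivWithin γ (Set.Icc (i : ℝ) (i + 1)) s ≠ 0) ∧
    Γ = γ '' Set.Icc 0 (n : ℝ)

/-- `Ω` is a piecewise smoothly bounded open planar set: it is open, has compact closure, coincides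
with the interior of its closure (no slits or punctures), and its boundary is the union of finitely
many pairwise disjoint simple closed piecewise smooth curves. -/
structure IsPiecewiseSmoothlyBounded (Ω : Set Plane) : Prop where
  isOpen : IsOpen Ω
  isCompact_closure : IsCompact (closure Ω)
  interior_closure : interior (closure Ω) = Ω
  boundary : ∃ (m : ℕ) (Γ : Fin m → Set Plane),
    (∀ i, IsPiecewiseSmoothClosedCurve (Γ i)) ∧
    (∀ i j, i ≠ j → Disjoint (Γ i) (Γ j)) ∧
    frontier Ω = ⋃ i, Γ i

/-- `u` is a classical function on `Ω` with zero Dirichlet data: twice continuously differentiable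
in `Ω`, continuous up to the boundary, and zero on the boundary. So that `u` is determined by its
values in `Ω`, it is extended by zero to the whole plane. -/
structure IsDirichletFunction (Ω : Set Plane) (u : Plane → ℝ) : Prop where
  contDiffOn : ContDiffOn ℝ 2 u Ω
  continuousOn : ContinuousOn u (closure Ω)
  eq_zero : ∀ x ∉ Ω, u x = 0

/-- The space of solutions of `Δ u + μ u = 0` in the open set `Ω`, `u = 0` on the boundary. -/
def dirichletEigenspace (Ω : TopologicalSpace.Opens Plane) (μ : ℝ) :
    Submodule ℝ (Plane → ℝ) where
  carrier := {u | IsDirichletFunction Ω u ∧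
    ∀ x ∈ Ω, Δ u x + μ * u x = 0}
  zero_mem' := by
    refine ⟨⟨contDiffOn_const, continuousOn_const, fun _ _ => rfl⟩, fun x _ => ?_⟩
    have h : Δ (0 : Plane → ℝ) x = 0 := by
      have := InnerProductSpace.laplacian_smul (𝕜 := ℝ) (v := (0 : ℝ))
        (f := (0 : Plane → ℝ)) (x := x) contDiffAt_const
      simpa using this
    rw [h]
    simp
  add_mem' := by
    rintro u v ⟨hu, hu'⟩ ⟨hv, hv'⟩
    refine ⟨⟨hu.contDiffOn.add hv.contDiffOn, hu.continuousOn.add hv.continuousOn,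
      fun x hx => by simp [hu.eq_zero x hx, hv.eq_zero x hx]⟩, fun x hx => ?_⟩
    have hn := Ω.isOpen.mem_nhds hx
    rw [(hu.contDiffOn.contDiffAt hn).laplacian_add (hv.contDiffOn.contDiffAt hn)]
    have h1 := hu' x hx
    have h2 := hv' x hx
    simp only [Pi.add_apply]
    linarith
  smul_mem' := by
    rintro c u ⟨hu, hu'⟩
    refine ⟨⟨hu.contDiffOn.const_smul c, hu.continuousOn.const_smul c,
      fun x hx => by simp [hu.eq_zero x hx]⟩, fun x hx => ?_⟩
    have hn := Ω.isOpen.mem_nhds hx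
    rw [InnerProductSpace.laplacian_smul c (hu.contDiffOn.contDiffAt hn)]
    have h1 := hu' x hx
    simp only [Pi.smul_apply, smul_eq_mul]
    linear_combination c * h1

/-- Same Dirichlet eigenvalues with the same multiplicities: for every real `μ` the two solution
spaces have equal dimension (dimension zero means that `μ` is not an eigenvalue). -/
def DirichletIsospectral (Ω₁ Ω₂ : TopologicalSpace.Opens Plane) : Prop :=
  ∀ μ : ℝ, Module.rank ℝ (dirichletEigenspace Ω₁ μ) = Module.rank ℝ (dirichletEigenspace Ω₂ μ)

/-- `u` solves `Δ u = -1` in `Ω`, `u = 0` on the boundary. -/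
def IsTorsionFunction (Ω : Set Plane) (u : Plane → ℝ) : Prop :=
  IsDirichletFunction Ω u ∧ ∀ x ∈ Ω, Δ u x = -1

open Classical in
/-- The torsional rigidity `T(Ω) = ∫_Ω u`, with `u` the torsion function of `Ω` (junk value `0` if
there is none). -/
def torsionalRigidity (Ω : Set Plane) : ℝ :=
  if h : ∃ u, IsTorsionFunction Ω u then ∫ x in Ω, h.choose x else 0

/-- The open rectangle of length `L` and height `H` with lower left corner `a`. -/
def openRectangle (a : Plane) (L H : ℝ) : Set Plane :=
  {x | a 0 < x 0 ∧ x 0 < a 0 + L ∧ a 1 < x 1 ∧ x 1 < a 1 + H}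

/-- The open right isosceles triangle with right angle at `a` and two legs of length `L`. -/
def openRightIsoscelesTriangle (a : Plane) (L : ℝ) : Set Plane :=
  {x | a 0 < x 0 ∧ a 1 < x 1 ∧ (x 0 - a 0) + (x 1 - a 1) < L}

theorem isOpen_openRectangle (a : Plane) (L H : ℝ) : IsOpen (openRectangle a L H) := by
  have h (i : Fin 2) : Continuous fun x : Plane => x i := by fun_prop
  exact (isOpen_lt continuous_const (h 0)).and ((isOpen_lt (h 0) continuous_const).and
    ((isOpen_lt continuous_const (h 1)).and (isOpen_lt (h 1) continuous_const)))

theorem isOpen_openRightIsoscelesTriangle (a : Plane) (L : ℝ) :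
    IsOpen (openRightIsoscelesTriangle a L) := by
  have h (i : Fin 2) : Continuous fun x : Plane => x i := by fun_prop
  exact (isOpen_lt continuous_const (h 0)).and ((isOpen_lt continuous_const (h 1)).and
    (isOpen_lt (((h 0).sub continuous_const).add ((h 1).sub continuous_const)) continuous_const))

/-- A unit square and, disjoint from it, a right isosceles triangle of side `2`. -/
def chapman₁ : TopologicalSpace.Opens Plane :=
  ⟨openRectangle !₂[0, 0] 1 1 ∪ openRightIsoscelesTriangle !₂[3, 0] 2,
    (isOpen_openRectangle _ _ _).union (isOpen_openRightIsoscelesTriangle _ _)⟩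

/-- A `2 × 1` rectangle and, disjoint from it, a right isosceles triangle of side `√2`. -/
def chapman₂ : TopologicalSpace.Opens Plane :=
  ⟨openRectangle !₂[0, 0] 2 1 ∪ openRightIsoscelesTriangle !₂[3, 0] (Real.sqrt 2),
    (isOpen_openRectangle _ _ _).union (isOpen_openRightIsoscelesTriangle _ _)⟩

end

/-! Both spectra are explicit. In units of (π/2)², the unit square has the eigenvalues (2m)² + (2n)²
and the 2 × 1 rectangle m² + (2n)² with m, n ≥ 1; the triangle with legs 2 has m² + n² and the one
with legs √2 has 2(m² + n²), with m > n ≥ 1. The square accounts for the rectangle modes with even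
first index. A mode (m, n) of the large triangle goes to ((m + n)/2, (m - n)/2) on the small
triangle if m and n have equal parity, and to a rectangle mode with odd first index otherwise
(`chapmanIndexEquiv`).

Multiplicities are read off from complete orthogonal systems (`IsDirichletSystem.rank_eigenspace`).
An eigenfunction u is only continuous up to the boundary, so Green's identity does not apply to it
directly. On a convex domain u is replaced by its contraction u(c + s(p - c)), which is C² across
the boundary and tends to zero there uniformly as s → 1 (`integral_mul_eq_zero_of_eigenvalue_ne`).
Completeness follows from the Weierstrass theorem on an interval, by slicing on a rectangle, and by
odd reflection in the hypotenuse on a triangle.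

Zero is not an eigenvalue, so torsion functions are unique. Each is a parabola in one linear
coordinate minus an explicit harmonic series. With r_n = (1 - (-1)^n)/n⁵, termwise integration gives
the rigidity WD³/12 - (8D⁴/π⁵) Σ r_n tanh(nπW/(2D)) for a W × D rectangle and L⁴/48 - (2L⁴/π⁵) Σ r_n
coth(nπ/2) for a triangle. Hence T(C₂) - T(C₁) is 8/π⁵ times Σ r_n (tanh(nπ/2) - tanh(nπ) + 3
coth(nπ/2)) - π⁵/48, and the terms n = 1 and n = 3 alone make this positive (`integral_torsion_lt`).
-/

open Filter Topology

/-! ### The Laplacian through derivatives along lines -/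

/-- The coordinate vectors of the plane. -/
noncomputable abbrev coordVec (i : Fin 2) : Plane := EuclideanSpace.single i 1

theorem laplacian_eq_sum_fderiv_fderiv (u : Plane → ℝ) (p : Plane) :
    Δ u p = ∑ i, fderiv ℝ (fderiv ℝ u) p (coordVec i) (coordVec i) := by
  rw [InnerProductSpace.laplacian_eq_iteratedFDeriv_orthonormalBasis u
    (EuclideanSpace.basisFun (Fin 2) ℝ)]
  simp [iteratedFDeriv_two_apply]

theorem hasDerivAt_line {E : Type*} [NormedAddCommGroup E] [NormedSpace ℝ E] (q e : E) (t : ℝ) :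
    HasDerivAt (fun t : ℝ => q + t • e) e t := by
  simpa using ((hasDerivAt_id t).smul_const e).const_add q

theorem hasDerivAt_comp_line {u : Plane → ℝ} {q e : Plane} {t : ℝ}
    (h : DifferentiableAt ℝ u (q + t • e)) :
    HasDerivAt (fun t : ℝ => u (q + t • e)) (fderiv ℝ u (q + t • e) e) t :=
  h.hasFDerivAt.comp_hasDerivAt t (hasDerivAt_line q e t)

theorem hasDerivAt_fderiv_comp_line {u : Plane → ℝ} {q e : Plane} {t : ℝ}
    (h : ContDiffAt ℝ 2 u (q + t • e)) :
    HasDerivAt (fun t : ℝ => fderiv ℝ u (q + t • e) e)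
      (fderiv ℝ (fderiv ℝ u) (q + t • e) e e) t := by
  have h1 : DifferentiableAt ℝ (fderiv ℝ u) (q + t • e) :=
    (h.fderiv_right (m := 1) (by norm_num)).differentiableAt (by norm_num)
  have h2 := h1.hasFDerivAt.comp_hasDerivAt t (hasDerivAt_line q e t)
  simpa using h2.clm_apply (hasDerivAt_const t e)

/-- Reduces every Laplacian below to two one-variable computations. C² regularity identifies `f'`
near 0 with the directional derivative, so differentiating `f'` once more at 0 gives the pure second
derivative. -/
theorem laplacian_eq_of_hasDerivAt {u : Plane → ℝ} {p : Plane} (hu : ContDiffAt ℝ 2 u p)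
    {f' : Fin 2 → ℝ → ℝ} {c : Fin 2 → ℝ}
    (h : ∀ i, ∀ᶠ t in 𝓝 (0 : ℝ), HasDerivAt (fun t => u (p + t • coordVec i)) (f' i t) t)
    (h' : ∀ i, HasDerivAt (f' i) (c i) 0) : Δ u p = c 0 + c 1 := by
  rw [laplacian_eq_sum_fderiv_fderiv, Fin.sum_univ_two]
  have key (i : Fin 2) : fderiv ℝ (fderiv ℝ u) p (coordVec i) (coordVec i) = c i := by
    have h1 : ∀ᶠ q in 𝓝 p, ContDiffAt ℝ 2 u q := hu.eventually (by simp)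
    have hc : Tendsto (fun t : ℝ => p + t • coordVec i) (𝓝 0) (𝓝 p) := by
      have := (hasDerivAt_line p (coordVec i) 0).continuousAt.tendsto
      simpa using this
    have h2 : (fun t : ℝ => fderiv ℝ u (p + t • coordVec i) (coordVec i)) =ᶠ[𝓝 0] f' i := by
      filter_upwards [h i, hc.eventually h1] with t ht1 ht2
      exact (hasDerivAt_comp_line (ht2.differentiableAt (by norm_num))).unique ht1
    have h3 := hasDerivAt_fderiv_comp_line (u := u) (q := p) (e := coordVec i) (t := 0)
      (by simpa using hu)
    have h4 := h3.unique ((h' i).congr_of_eventuallyEq h2)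
    simpa using h4
  rw [key, key]

theorem continuousOn_fderiv_fderiv {u : Plane → ℝ} {W : Set Plane} (hW : IsOpen W)
    (hu : ContDiffOn ℝ 2 u W) (e : Plane) :
    ContinuousOn (fun p => fderiv ℝ (fderiv ℝ u) p e e) W := by
  intro p hp
  have h := hu.contDiffAt (hW.mem_nhds hp)
  have h1 : ContDiffAt ℝ 0 (fderiv ℝ (fderiv ℝ u)) p :=
    (h.fderiv_right (m := 1) (by norm_num)).fderiv_right (m := 0) (by norm_num)
  exact ((h1.continuousAt.clm_apply continuousAt_const).clm_apply
    continuousAt_const).continuousWithinAt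

/-- Laplacian of a function precomposed with a homothety. -/
theorem laplacian_comp_homothety {u : Plane → ℝ} {b p : Plane} {s : ℝ}
    (hu : ContDiffAt ℝ 2 u (b + s • p)) :
    Δ (fun p => u (b + s • p)) p = s ^ 2 * Δ u (b + s • p) := by
  have hc : ContDiffAt ℝ 2 (fun p => u (b + s • p)) p := by
    refine ContDiffAt.comp p (g := u) hu ?_
    fun_prop
  have hlin (i : Fin 2) (t : ℝ) :
      b + s • (p + t • coordVec i) = (b + s • p) + t • (s • coordVec i) := by module
  have ht (i : Fin 2) : Tendsto (fun t : ℝ => (b + s • p) + t • (s • coordVec i)) (𝓝 0)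
      (𝓝 (b + s • p)) := by
    simpa using (hasDerivAt_line (b + s • p) (s • coordVec i) 0).continuousAt.tendsto
  rw [laplacian_eq_of_hasDerivAt hc
    (f' := fun i t => fderiv ℝ u ((b + s • p) + t • (s • coordVec i)) (s • coordVec i))
    (c := fun i => fderiv ℝ (fderiv ℝ u) (b + s • p) (s • coordVec i) (s • coordVec i))]
  · rw [laplacian_eq_sum_fderiv_fderiv, Fin.sum_univ_two]
    simp only [map_smul, smul_apply, smul_eq_mul]
    ring
  · intro i
    filter_upwards [(ht i).eventually (hu.eventually (by simp))] with t h
    simp only [hlin]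
    exact hasDerivAt_comp_line (h.differentiableAt (by norm_num))
  · intro i
    have := hasDerivAt_fderiv_comp_line (u := u) (q := b + s • p) (e := s • coordVec i) (t := 0)
      (by simpa using hu)
    simpa using this

/-! ### Integration over the plane -/

theorem measurePreserving_plane :
    MeasurePreserving (fun z : ℝ × ℝ => (!₂[z.1, z.2] : Plane)) volume volume :=
  (PiLp.volume_preserving_toLp (Fin 2)).comp (volume_preserving_finTwoArrow ℝ).symm

theorem measurableEmbedding_plane :
    MeasurableEmbedding (fun z : ℝ × ℝ => (!₂[z.1, z.2] : Plane)) :=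
  (MeasurableEquiv.toLp 2 (Fin 2 → ℝ)).measurableEmbedding.comp
    (MeasurableEquiv.finTwoArrow (α := ℝ)).symm.measurableEmbedding

theorem integral_plane_eq_integral_prod (f : Plane → ℝ) :
    ∫ p, f p = ∫ z : ℝ × ℝ, f !₂[z.1, z.2] :=
  (measurePreserving_plane.integral_comp measurableEmbedding_plane f).symm

theorem integrable_comp_plane {f : Plane → ℝ} :
    Integrable (fun z : ℝ × ℝ => f !₂[z.1, z.2]) ↔ Integrable f :=
  measurePreserving_plane.integrable_comp_emb measurableEmbedding_plane

theorem integral_plane {f : Plane → ℝ} (hf : Integrable f) :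
    ∫ p, f p = ∫ x, ∫ y, f !₂[x, y] := by
  rw [integral_plane_eq_integral_prod]
  exact integral_prod _ (integrable_comp_plane.2 hf)

theorem integral_plane_symm {f : Plane → ℝ} (hf : Integrable f) :
    ∫ p, f p = ∫ y, ∫ x, f !₂[x, y] := by
  rw [integral_plane_eq_integral_prod]
  exact integral_prod_symm _ (integrable_comp_plane.2 hf)

theorem vec_eq_add_smul (x y : ℝ) :
    (!₂[x, y] : Plane) = x • coordVec 0 + y • coordVec 1 := by
  ext i; fin_cases i <;> simp

/-- Fubini in the plane, with either order of the coordinates. -/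
theorem integral_plane_coordVec {f : Plane → ℝ} (hf : Integrable f) {i j : Fin 2} (hij : i ≠ j) :
    ∫ p, f p = ∫ s : ℝ, ∫ t : ℝ, f (s • coordVec j + t • coordVec i) := by
  fin_cases i <;> fin_cases j <;> first | exact absurd rfl hij | skip
  · rw [integral_plane_symm hf]
    simp only [vec_eq_add_smul]
    simp [add_comm]
  · rw [integral_plane hf]
    simp only [vec_eq_add_smul]
    simp

/-- Meant for slice integrals as functions of the transversal coordinate, whose measurability then
needs no check. -/
theorem abs_integral_le_of_abs_le_of_support {f : ℝ → ℝ} {R K : ℝ} (hR : 0 ≤ R)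
    (h : ∀ s, |f s| ≤ K) (h0 : ∀ s, R < |s| → f s = 0) : |∫ s, f s| ≤ K * (2 * R) := by
  have h1 : ∫ s, f s = ∫ s in Set.Icc (-R) R, f s := by
    rw [setIntegral_eq_integral_of_forall_compl_eq_zero]
    intro s hs
    apply h0
    by_contra hlt
    exact hs (abs_le.1 (not_lt.1 hlt))
  rw [h1]
  have := norm_setIntegral_le_of_norm_le_const (μ := volume) (s := Set.Icc (-R) R) (f := f)
    (C := K) (by simp) (fun s _ => h s)
  rw [Real.norm_eq_abs] at this
  refine this.trans (le_of_eq ?_)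
  rw [Real.volume_real_Icc_of_le (by linarith)]
  ring

/-! ### Green's formula -/

/-- Green's second identity on a bounded open interval. -/
theorem abs_setIntegral_green_le {S : Set ℝ} (hS : IsOpen S) (hc : S.OrdConnected)
    (hb : Bornology.IsBounded S) {g g' g'' h h' h'' : ℝ → ℝ}
    (hg : ∀ t ∈ closure S, HasDerivAt g (g' t) t) (hg' : ∀ t ∈ closure S, HasDerivAt g' (g'' t) t)
    (hg'' : ContinuousOn g'' (closure S))
    (hh : ∀ t ∈ closure S, HasDerivAt h (h' t) t) (hh' : ∀ t ∈ closure S, HasDerivAt h' (h'' t) t)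
    (hh'' : ContinuousOn h'' (closure S))
    {ε M : ℝ} (hM : 0 ≤ M) (hε : 0 ≤ ε) (h0 : ∀ t ∈ frontier S, h t = 0)
    (hgε : ∀ t ∈ frontier S, |g t| ≤ ε) (hhM : ∀ t ∈ frontier S, |h' t| ≤ M) :
    |∫ t in S, (g t * h'' t - h t * g'' t)| ≤ 2 * (ε * M) := by
  rcases S.eq_empty_or_nonempty with rfl | hne
  · simpa using by positivity
  -- The set arises as a slice of a convex domain, so it has to be recognised as an interval between
  -- its infimum and supremum, which openness excludes from it.
  obtain ⟨a, b, hab, rfl⟩ : ∃ a b, a < b ∧ S = Set.Ioo a b := by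
    have hbb := hb.bddBelow
    have hba := hb.bddAbove
    have e1 : sInf S ∉ S := fun hm => by
      obtain ⟨l, hl, hl'⟩ := (mem_nhds_iff_exists_Ioo_subset.1 (hS.mem_nhds hm))
      obtain ⟨y, hy⟩ := exists_between hl'.1.1
      have : y ∈ S := hl'.2 ⟨hy.1, hy.2.trans hl'.1.2⟩
      exact absurd (csInf_le hbb this) (not_le.2 hy.2)
    have e2 : sSup S ∉ S := fun hm => by
      obtain ⟨l, r, hl'⟩ := (mem_nhds_iff_exists_Ioo_subset.1 (hS.mem_nhds hm))
      obtain ⟨y, hy⟩ := exists_between hl'.1.2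
      have : y ∈ S := hl'.2 ⟨hl'.1.1.trans hy.1, hy.2⟩
      exact absurd (le_csSup hba this) (not_le.2 hy.1)
    have hsub : S ⊆ Set.Ioo (sInf S) (sSup S) := fun x hx =>
      ⟨lt_of_le_of_ne (csInf_le hbb hx) (fun h => e1 (h ▸ hx)),
       lt_of_le_of_ne (le_csSup hba hx) (fun h => e2 (h ▸ hx))⟩
    refine ⟨sInf S, sSup S, ?_, ?_⟩
    · obtain ⟨x, hx⟩ := hne
      exact (hsub hx).1.trans (hsub hx).2
    · refine hsub.antisymm fun x hx => ?_
      obtain ⟨y, hy, hyx⟩ := exists_lt_of_csInf_lt hne hx.1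
      obtain ⟨z, hz, hxz⟩ := exists_lt_of_lt_csSup hne hx.2
      exact hc.out hy hz ⟨hyx.le, hxz.le⟩
  rw [closure_Ioo hab.ne] at *
  rw [frontier_Ioo hab] at *
  have hu : Set.uIcc a b = Set.Icc a b := Set.uIcc_of_le hab.le
  have hcg : ContinuousOn g (Set.Icc a b) := fun t ht => (hg t ht).continuousAt.continuousWithinAt
  have hch : ContinuousOn h (Set.Icc a b) := fun t ht => (hh t ht).continuousAt.continuousWithinAt
  -- The integrand is the derivative of g h' - h g'. As h vanishes at the end points only g h'
  -- survives there, so no bound on g' is needed.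
  rw [← integral_Ioc_eq_integral_Ioo, ← intervalIntegral.integral_of_le hab.le,
    intervalIntegral.integral_eq_sub_of_hasDerivAt (f := fun t => g t * h' t - h t * g' t)]
  · have ha := h0 a (by simp)
    have hb' := h0 b (by simp)
    simp only [ha, hb', zero_mul, sub_zero]
    have i1 := hgε a (by simp)
    have i2 := hgε b (by simp)
    have i3 := hhM a (by simp)
    have i4 := hhM b (by simp)
    calc |g b * h' b - g a * h' a| ≤ |g b * h' b| + |g a * h' a| := abs_sub _ _
      _ = |g b| * |h' b| + |g a| * |h' a| := by rw [abs_mul, abs_mul]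
      _ ≤ ε * M + ε * M := by gcongr
      _ = _ := by ring
  · intro t ht
    rw [hu] at ht
    refine (((hg t ht).mul (hh' t ht)).sub ((hh t ht).mul (hg' t ht))).congr_deriv ?_
    ring
  · apply ContinuousOn.intervalIntegrable
    rw [hu]
    exact (hcg.mul hh'').sub (hch.mul hg'')

theorem abs_coord_le_norm (p : Plane) (i : Fin 2) : |p i| ≤ ‖p‖ := by
  simpa using PiLp.norm_apply_le p i

/-- Green's second identity in one coordinate direction on a convex domain: only the values of `v`
on the boundary enter if `φ` vanishes there. -/
theorem exists_green_direction_bound {Ω : Set Plane} (hΩ : IsOpen Ω) (hconv : Convex ℝ Ω)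
    (hbdd : Bornology.IsBounded Ω) {φ : Plane → ℝ} (hφ : ContDiff ℝ 2 φ)
    (hφ0 : ∀ p ∈ frontier Ω, φ p = 0) (i : Fin 2) :
    ∃ C, ∀ (v : Plane → ℝ) (W : Set Plane) (ε : ℝ), IsOpen W → closure Ω ⊆ W →
      ContDiffOn ℝ 2 v W → 0 ≤ ε → (∀ p ∈ frontier Ω, |v p| ≤ ε) →
      |∫ p in Ω, (v p * fderiv ℝ (fderiv ℝ φ) p (coordVec i) (coordVec i)
        - φ p * fderiv ℝ (fderiv ℝ v) p (coordVec i) (coordVec i))| ≤ C * ε := by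
  obtain ⟨j, hij⟩ : ∃ j : Fin 2, i ≠ j := ⟨1 - i, by fin_cases i <;> decide⟩
  have hcomp : IsCompact (closure Ω) := hbdd.isCompact_closure
  obtain ⟨R, hR0, hR⟩ := hbdd.exists_pos_norm_le
  have hdφ : Continuous fun p => fderiv ℝ φ p (coordVec i) :=
    (hφ.continuous_fderiv (by norm_num)).clm_apply continuous_const
  obtain ⟨M, hM⟩ := hcomp.exists_bound_of_continuousOn hdφ.continuousOn
  have hφ2 : Continuous fun p => fderiv ℝ (fderiv ℝ φ) p (coordVec i) (coordVec i) :=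
    continuousOn_univ.1 (continuousOn_fderiv_fderiv isOpen_univ hφ.contDiffOn _)
  -- Each slice contributes at most 2εM and the slices that meet the domain have parameters in an
  -- interval of length 2R. The maximum with 0 covers an empty domain, where `M` may be negative.
  refine ⟨2 * max M 0 * (2 * R), fun v W ε hW hΩW hv hε hvε => ?_⟩
  set F : Plane → ℝ := fun p => v p * fderiv ℝ (fderiv ℝ φ) p (coordVec i) (coordVec i)
        - φ p * fderiv ℝ (fderiv ℝ v) p (coordVec i) (coordVec i) with hF
  have hv2 := continuousOn_fderiv_fderiv hW hv (coordVec i)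
  have hFc : ContinuousOn F (closure Ω) :=
    ((hv.continuousOn.mono hΩW).mul hφ2.continuousOn).sub
      (hφ.continuous.continuousOn.mul (hv2.mono hΩW))
  have hFi : Integrable (Ω.indicator F) :=
    (integrable_indicator_iff hΩ.measurableSet).2
      ((hFc.integrableOn_compact hcomp).mono_set subset_closure)
  rw [← integral_indicator hΩ.measurableSet, integral_plane_coordVec hFi hij]
  have hbound := abs_integral_le_of_abs_le_of_support hR0.le (K := 2 * (ε * max M 0))
    (f := fun s => ∫ t : ℝ, Ω.indicator F (s • coordVec j + t • coordVec i)) ?_ ?_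
  · refine hbound.trans (le_of_eq (by ring))
  · intro s
    set σ : ℝ → Plane := fun t => s • coordVec j + t • coordVec i with hσ
    have hσc : Continuous σ := by fun_prop
    have e1 : (fun t : ℝ => Ω.indicator F (s • coordVec j + t • coordVec i))
        = (σ ⁻¹' Ω).indicator (F ∘ σ) := by
      ext t; rfl
    have hSo : IsOpen (σ ⁻¹' Ω) := hΩ.preimage hσc
    have hSb : Bornology.IsBounded (σ ⁻¹' Ω) := by
      refine isBounded_iff_forall_norm_le.2 ⟨R, fun t ht => ?_⟩
      have h1 := (abs_coord_le_norm (σ t) i).trans (hR _ ht)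
      simpa [hσ, hij] using h1
    have hSc : (σ ⁻¹' Ω).OrdConnected := by
      have hcv : Convex ℝ (σ ⁻¹' Ω) := by
        intro a ha b hb x y hx hy hxy
        have := hconv ha hb hx hy hxy
        have e : σ (x • a + y • b) = x • σ a + y • σ b := by
          obtain rfl : y = 1 - x := by linarith
          simp only [hσ, smul_eq_mul]
          module
        rwa [Set.mem_preimage, e]
      exact hcv.ordConnected
    have hcl : ∀ t ∈ closure (σ ⁻¹' Ω), σ t ∈ closure Ω := fun t ht =>
      hσc.closure_preimage_subset _ ht
    have hfr : ∀ t ∈ frontier (σ ⁻¹' Ω), σ t ∈ frontier Ω := fun t ht =>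
      hσc.frontier_preimage_subset _ ht
    have hvat : ∀ t ∈ closure (σ ⁻¹' Ω), ContDiffAt ℝ 2 v (σ t) := fun t ht =>
      hv.contDiffAt (hW.mem_nhds (hΩW (hcl t ht)))
    rw [e1, integral_indicator hSo.measurableSet]
    refine abs_setIntegral_green_le hSo hSc hSb (g := v ∘ σ)
      (g' := fun t => fderiv ℝ v (σ t) (coordVec i))
      (g'' := fun t => fderiv ℝ (fderiv ℝ v) (σ t) (coordVec i) (coordVec i))
      (h := φ ∘ σ)
      (h' := fun t => fderiv ℝ φ (σ t) (coordVec i))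
      (h'' := fun t => fderiv ℝ (fderiv ℝ φ) (σ t) (coordVec i) (coordVec i))
      ?_ ?_ ?_ ?_ ?_ ?_ (le_max_right _ _) hε ?_ ?_ ?_
    · exact fun t ht => hasDerivAt_comp_line ((hvat t ht).differentiableAt (by norm_num))
    · exact fun t ht => hasDerivAt_fderiv_comp_line (hvat t ht)
    · exact hv2.comp hσc.continuousOn fun t ht => hΩW (hcl t ht)
    · exact fun t ht => hasDerivAt_comp_line (hφ.contDiffAt.differentiableAt (by norm_num))
    · exact fun t ht => hasDerivAt_fderiv_comp_line hφ.contDiffAt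
    · exact (hφ2.comp hσc).continuousOn
    · exact fun t ht => hφ0 _ (hfr t ht)
    · exact fun t ht => hvε _ (hfr t ht)
    · exact fun t ht => (hM _ (frontier_subset_closure (hfr t ht))).trans (le_max_left _ _)
  · intro s hs
    have : ∀ t : ℝ, Ω.indicator F (s • coordVec j + t • coordVec i) = 0 := by
      intro t
      refine Set.indicator_of_notMem (fun hm => ?_) _
      have h1 := (abs_coord_le_norm _ j).trans (hR _ hm)
      have h2 : |s| ≤ R := by simpa [hij.symm] using h1
      exact absurd hs (not_lt.2 h2)
    simp [this]

/-- The constant depends on Ω and φ alone and no gradient of v enters, so the estimate can be used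
uniformly for a family of functions v whose derivatives blow up at the boundary. -/
theorem exists_green_bound {Ω : Set Plane} (hΩ : IsOpen Ω) (hconv : Convex ℝ Ω)
    (hbdd : Bornology.IsBounded Ω) {φ : Plane → ℝ} (hφ : ContDiff ℝ 2 φ)
    (hφ0 : ∀ p ∈ frontier Ω, φ p = 0) :
    ∃ C, ∀ (v : Plane → ℝ) (W : Set Plane) (ε : ℝ), IsOpen W → closure Ω ⊆ W →
      ContDiffOn ℝ 2 v W → 0 ≤ ε → (∀ p ∈ frontier Ω, |v p| ≤ ε) →
      |∫ p in Ω, (v p * Δ φ p - φ p * Δ v p)| ≤ C * ε := by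
  choose C hC using exists_green_direction_bound hΩ hconv hbdd hφ hφ0
  have hcomp : IsCompact (closure Ω) := hbdd.isCompact_closure
  refine ⟨C 0 + C 1, fun v W ε hW hΩW hv hε hvε => ?_⟩
  have hInt (i : Fin 2) : IntegrableOn (fun p =>
      v p * fderiv ℝ (fderiv ℝ φ) p (coordVec i) (coordVec i)
        - φ p * fderiv ℝ (fderiv ℝ v) p (coordVec i) (coordVec i)) Ω := by
    refine ContinuousOn.integrableOn_compact (K := closure Ω) hcomp ?_ |>.mono_set subset_closure
    exact ((hv.continuousOn.mono hΩW).mul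
      ((continuousOn_fderiv_fderiv isOpen_univ hφ.contDiffOn _).mono (Set.subset_univ _))).sub
      (hφ.continuous.continuousOn.mul ((continuousOn_fderiv_fderiv hW hv _).mono hΩW))
  have e : ∀ p, v p * Δ φ p - φ p * Δ v p = ∑ i : Fin 2,
      (v p * fderiv ℝ (fderiv ℝ φ) p (coordVec i) (coordVec i)
        - φ p * fderiv ℝ (fderiv ℝ v) p (coordVec i) (coordVec i)) := by
    intro p
    rw [laplacian_eq_sum_fderiv_fderiv, laplacian_eq_sum_fderiv_fderiv,
      Finset.sum_sub_distrib, Finset.mul_sum, Finset.mul_sum]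
  simp only [e]
  rw [integral_finsetSum _ fun i _ => hInt i, Fin.sum_univ_two]
  refine (abs_add_le _ _).trans ?_
  rw [add_mul]
  exact add_le_add (hC 0 v W ε hW hΩW hv hε hvε) (hC 1 v W ε hW hΩW hv hε hvε)

/-! ### Orthogonality without boundary regularity -/

/-- A Dirichlet function, extended by zero, is continuous on the whole plane. -/
theorem IsDirichletFunction.continuous {Ω : Set Plane} {u : Plane → ℝ}
    (hu : IsDirichletFunction Ω u) (hΩ : IsOpen Ω) : Continuous u := by
  rw [← continuousOn_univ]
  have h2 : ContinuousOn u Ωᶜ :=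
    continuousOn_const.congr (f := fun _ => (0 : ℝ)) fun x hx => hu.eq_zero x hx
  have h3 := hu.continuousOn.union_of_isClosed h2 isClosed_closure hΩ.isClosed_compl
  refine h3.mono fun x _ => ?_
  by_cases hx : x ∈ Ω
  · exact Or.inl (subset_closure hx)
  · exact Or.inr hx

theorem IsDirichletFunction.hasCompactSupport {Ω : Set Plane} {u : Plane → ℝ}
    (hu : IsDirichletFunction Ω u) (hb : Bornology.IsBounded Ω) : HasCompactSupport u :=
  HasCompactSupport.intro hb.isCompact_closure fun x hx =>
    hu.eq_zero x fun h => hx (subset_closure h)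

theorem IsDirichletFunction.integrable_mul {Ω : Set Plane} {u φ : Plane → ℝ}
    (hu : IsDirichletFunction Ω u) (hΩ : IsOpen Ω) (hb : Bornology.IsBounded Ω)
    (hφ : Continuous φ) : Integrable fun p => u p * φ p :=
  ((hu.continuous hΩ).mul hφ).integrable_of_hasCompactSupport (hu.hasCompactSupport hb).mul_right

/-- Eigenfunctions that are merely continuous up to the boundary are orthogonal to every smooth
eigenfunction with a different eigenvalue. -/
theorem integral_mul_eq_zero_of_eigenvalue_ne {Ω : Set Plane} (hΩ : IsOpen Ω)
    (hconv : Convex ℝ Ω) (hbdd : Bornology.IsBounded Ω) {φ : Plane → ℝ} (hφ : ContDiff ℝ 2 φ)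
    (hφ0 : ∀ p ∈ frontier Ω, φ p = 0) {lam μ : ℝ} (hlam : ∀ p ∈ Ω, Δ φ p + lam * φ p = 0)
    {u : Plane → ℝ} (hu : IsDirichletFunction Ω u) (hμ : ∀ p ∈ Ω, Δ u p + μ * u p = 0)
    (hne : lam ≠ μ) : ∫ p, u p * φ p = 0 := by
  rcases Ω.eq_empty_or_nonempty with rfl | ⟨c, hc⟩
  · simp [hu.eq_zero]
  obtain ⟨C, hC⟩ := exists_green_bound hΩ hconv hbdd hφ hφ0
  have huc := hu.continuous hΩ
  have hcomp : IsCompact (closure Ω) := hbdd.isCompact_closure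
  obtain ⟨B, hB⟩ := huc.bounded_above_of_compact_support (hu.hasCompactSupport hbdd)
  -- the homotheties with centre `c`
  set τ : ℝ → Plane → Plane := fun s p => (1 - s) • c + s • p with hτ
  -- Contracting a convex set towards an interior point moves its closure into the interior. Hence u
  -- ∘ τ s is C² on a neighbourhood of the closure, as Green's identity requires.
  have hτm : ∀ s ∈ Set.Ioo (0 : ℝ) 1, ∀ p ∈ closure Ω, τ s p ∈ Ω := by
    intro s hs p hp
    have := hconv.combo_interior_closure_mem_interior (x := c) (y := p) (a := 1 - s) (b := s)
      (by rwa [hΩ.interior_eq]) hp (by linarith [hs.2]) hs.1.le (by ring)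
    rwa [hΩ.interior_eq] at this
  have hτc (s : ℝ) : Continuous (τ s) := by fun_prop
  -- The contracted function has eigenvalue μ s², so the Green integrand is a multiple of u(τ s p)
  -- φ(p).
  have key : ∀ s ∈ Set.Ioo (0 : ℝ) 1, ∀ ε, 0 ≤ ε → (∀ p ∈ frontier Ω, |u (τ s p)| ≤ ε) →
      |(μ * s ^ 2 - lam) * ∫ p in Ω, u (τ s p) * φ p| ≤ C * ε := by
    intro s hs ε hε hfr
    have h1 := hC (fun p => u (τ s p)) (τ s ⁻¹' Ω) ε (hΩ.preimage (hτc s)) (hτm s hs)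
      (hu.contDiffOn.comp (by fun_prop) (fun p hp => hp)) hε hfr
    have h2 : ∫ p in Ω, (u (τ s p) * Δ φ p - φ p * Δ (fun p => u (τ s p)) p)
        = (μ * s ^ 2 - lam) * ∫ p in Ω, u (τ s p) * φ p := by
      rw [← integral_const_mul]
      refine setIntegral_congr_fun hΩ.measurableSet fun p hp => ?_
      have hm := hτm s hs p (subset_closure hp)
      have e1 : Δ (fun p => u (τ s p)) p = s ^ 2 * Δ u (τ s p) :=
        laplacian_comp_homothety (hu.contDiffOn.contDiffAt (hΩ.mem_nhds hm))
      have e2 := hμ _ hm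
      have e3 := hlam _ hp
      simp only [e1]
      linear_combination u (τ s p) * e3 - φ p * s ^ 2 * e2
    rwa [h2] at h1
  -- pass to the limit
  have hlim : Tendsto (fun s => ∫ p in Ω, u (τ s p) * φ p) (𝓝[<] 1) (𝓝 (∫ p in Ω, u p * φ p)) := by
    refine tendsto_integral_filter_of_dominated_convergence (fun p => B * |φ p|) ?_ ?_ ?_ ?_
    · exact Eventually.of_forall fun s =>
        ((huc.comp (hτc s)).mul hφ.continuous).aestronglyMeasurable
    · refine Eventually.of_forall fun s => Eventually.of_forall fun p => ?_
      rw [norm_mul]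
      exact mul_le_mul_of_nonneg_right (hB _) (norm_nonneg _)
    · exact ((continuous_const.mul hφ.continuous.abs).continuousOn.integrableOn_compact
        hcomp).mono_set subset_closure
    · refine Eventually.of_forall fun p => ?_
      have hcs : Continuous fun s => u (τ s p) * φ p := by
        have : Continuous fun s => τ s p := by fun_prop
        exact (huc.comp this).mul continuous_const
      have := hcs.tendsto 1
      simp only [hτ, sub_self, zero_smul, zero_add, one_smul] at this
      exact this.mono_left nhdsWithin_le_nhds
  -- At s = 1 the boundary values are zero; joint continuity and compactness of the boundary make
  -- them uniformly small for s near 1.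
  have hunif : ∀ ε > 0, ∀ᶠ s in 𝓝[<] (1 : ℝ), ∀ p ∈ frontier Ω, |u (τ s p)| ≤ ε := by
    intro ε hε
    have hK : IsCompact (frontier Ω) := hcomp.of_isClosed_subset isClosed_frontier
      frontier_subset_closure
    have hτ2 : Continuous fun q : ℝ × Plane => u (τ q.1 q.2) := by
      refine huc.comp ?_
      fun_prop
    have : ∀ p ∈ frontier Ω, ∀ᶠ q : ℝ × Plane in 𝓝 1 ×ˢ 𝓝 p, |u (τ q.1 q.2)| < ε := by
      intro p hp
      rw [← nhds_prod_eq]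
      have hz : u (τ 1 p) = 0 := by
        simp only [hτ, sub_self, zero_smul, zero_add, one_smul]
        exact hu.eq_zero p fun h => (hΩ.frontier_eq ▸ hp).2 h
      have := (hτ2.abs.tendsto (1, p))
      simp only [hz, abs_zero] at this
      exact this.eventually (gt_mem_nhds hε)
    have h2 := hK.eventually_forall_of_forall_eventually (x₀ := (1 : ℝ))
      (P := fun s p => |u (τ s p)| < ε) (fun p hp => by simpa [nhds_prod_eq] using this p hp)
    filter_upwards [h2.filter_mono nhdsWithin_le_nhds] with s hs p hp
    exact (hs p hp).le
  have hzero : (μ - lam) * ∫ p in Ω, u p * φ p = 0 := by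
    have hl2 : Tendsto (fun s : ℝ => |(μ * s ^ 2 - lam) * ∫ p in Ω, u (τ s p) * φ p|) (𝓝[<] 1)
        (𝓝 |(μ * 1 ^ 2 - lam) * ∫ p in Ω, u p * φ p|) := by
      refine (Tendsto.mul ?_ hlim).abs
      have : Continuous fun s : ℝ => μ * s ^ 2 - lam := by fun_prop
      exact (this.tendsto 1).mono_left nhdsWithin_le_nhds
    have hle : ∀ ε > 0, |(μ * 1 ^ 2 - lam) * ∫ p in Ω, u p * φ p| ≤ C * ε := by
      intro ε hε
      refine le_of_tendsto hl2 ?_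
      have hio : ∀ᶠ s in 𝓝[<] (1 : ℝ), s ∈ Set.Ioo (0 : ℝ) 1 := Ioo_mem_nhdsLT (by norm_num)
      filter_upwards [hunif ε hε, hio] with s h1 h2
      exact key s h2 ε hε.le h1
    have hle0 : |(μ * 1 ^ 2 - lam) * ∫ p in Ω, u p * φ p| ≤ 0 := by
      have hcont : Tendsto (fun ε : ℝ => C * ε) (𝓝[>] 0) (𝓝 0) := by
        have : Continuous fun ε : ℝ => C * ε := by fun_prop
        simpa using (this.tendsto 0).mono_left (nhdsWithin_le_nhds (s := Set.Ioi 0))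
      exact ge_of_tendsto hcont (eventually_mem_nhdsWithin.mono fun ε hε => hle ε hε)
    simpa using abs_nonpos_iff.1 hle0
  have hfull : ∫ p, u p * φ p = ∫ p in Ω, u p * φ p :=
    (setIntegral_eq_integral_of_forall_compl_eq_zero fun p hp => by
      rw [hu.eq_zero p hp, zero_mul]).symm
  rw [hfull]
  exact (mul_eq_zero.1 hzero).resolve_left (sub_ne_zero.2 hne.symm)

/-! ### Dirichlet functions: restriction, union, translation -/

theorem indicator_eventuallyEq_of_isOpen {Ω : Set Plane} (hΩ : IsOpen Ω) (f : Plane → ℝ) {p : Plane}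
    (hp : p ∈ Ω) : Ω.indicator f =ᶠ[𝓝 p] f := by
  filter_upwards [hΩ.mem_nhds hp] with q hq
  exact Set.indicator_of_mem hq f

theorem laplacian_indicator {Ω : Set Plane} (hΩ : IsOpen Ω) (f : Plane → ℝ) {p : Plane}
    (hp : p ∈ Ω) : Δ (Ω.indicator f) p = Δ f p :=
  (InnerProductSpace.laplacian_congr_nhds (indicator_eventuallyEq_of_isOpen hΩ f hp)).eq_of_nhds

theorem isDirichletFunction_indicator {Ω : Set Plane} (hΩ : IsOpen Ω) {f : Plane → ℝ}
    (h1 : ContDiffOn ℝ 2 f Ω) (h2 : ContinuousOn f (closure Ω))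
    (h3 : ∀ p ∈ frontier Ω, f p = 0) : IsDirichletFunction Ω (Ω.indicator f) where
  contDiffOn := h1.congr fun _ hp => Set.indicator_of_mem hp f
  continuousOn := h2.congr fun p hp => by
    by_cases hm : p ∈ Ω
    · exact Set.indicator_of_mem hm f
    · rw [Set.indicator_of_notMem hm, h3 p (hΩ.frontier_eq ▸ ⟨hp, hm⟩)]
  eq_zero _ hp := Set.indicator_of_notMem hp f

theorem IsDirichletFunction.indicator_left {A B : Set Plane} (hA : IsOpen A)
    (hd : Disjoint (closure A) (closure B)) {u : Plane → ℝ} (hu : IsDirichletFunction (A ∪ B) u) :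
    IsDirichletFunction A (A.indicator u) := by
  refine isDirichletFunction_indicator hA (hu.contDiffOn.mono Set.subset_union_left)
    (hu.continuousOn.mono (closure_mono Set.subset_union_left)) fun p hp => ?_
  refine hu.eq_zero p ?_
  rintro (h | h)
  · exact (hA.frontier_eq ▸ hp).2 h
  · exact Set.disjoint_left.1 hd (frontier_subset_closure hp) (subset_closure h)

theorem IsDirichletFunction.eventuallyEq_zero {B : Set Plane} {v : Plane → ℝ}
    (hv : IsDirichletFunction B v) {p : Plane} (hp : p ∉ closure B) : v =ᶠ[𝓝 p] 0 := by
  filter_upwards [isClosed_closure.isOpen_compl.mem_nhds hp] with q hq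
  exact hv.eq_zero q fun h => hq (subset_closure h)

theorem IsDirichletFunction.add_eventuallyEq {A B : Set Plane}
    (hd : Disjoint (closure A) (closure B)) {u v : Plane → ℝ} (hv : IsDirichletFunction B v)
    {p : Plane} (hp : p ∈ A) : u + v =ᶠ[𝓝 p] u := by
  filter_upwards [hv.eventuallyEq_zero (Set.disjoint_left.1 hd (subset_closure hp))] with q hq
  simp [hq]

theorem IsDirichletFunction.laplacian_add_left {A B : Set Plane}
    (hd : Disjoint (closure A) (closure B)) {u v : Plane → ℝ} (hv : IsDirichletFunction B v)
    {p : Plane} (hp : p ∈ A) : Δ (u + v) p = Δ u p :=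
  (InnerProductSpace.laplacian_congr_nhds (hv.add_eventuallyEq hd hp)).eq_of_nhds

theorem IsDirichletFunction.union {A B : Set Plane} (hA : IsOpen A) (hB : IsOpen B)
    (hd : Disjoint (closure A) (closure B)) {u v : Plane → ℝ}
    (hu : IsDirichletFunction A u) (hv : IsDirichletFunction B v) :
    IsDirichletFunction (A ∪ B) (u + v) where
  contDiffOn := by
    rintro p (hp | hp)
    · exact ((hu.contDiffOn.contDiffAt (hA.mem_nhds hp)).congr_of_eventuallyEq
        (hv.add_eventuallyEq hd hp)).contDiffWithinAt
    · rw [add_comm]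
      exact ((hv.contDiffOn.contDiffAt (hB.mem_nhds hp)).congr_of_eventuallyEq
        (hu.add_eventuallyEq hd.symm hp)).contDiffWithinAt
  continuousOn := ((hu.continuous hA).add (hv.continuous hB)).continuousOn
  eq_zero p hp := by
    rw [Set.mem_union, not_or] at hp
    simp [hu.eq_zero p hp.1, hv.eq_zero p hp.2]

theorem laplacian_comp_add (u : Plane → ℝ) (a p : Plane) :
    Δ (fun p => u (p + a)) p = Δ u (p + a) := by
  simp only [laplacian_eq_sum_fderiv_fderiv]
  have h : fderiv ℝ (fun p => u (p + a)) = fun p => fderiv ℝ u (p + a) :=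
    funext fun q => fderiv_comp_add_right a
  rw [h]
  exact Finset.sum_congr rfl fun i _ => by rw [fderiv_comp_add_right a]

theorem IsDirichletFunction.comp_add {Ω : Set Plane} {u : Plane → ℝ}
    (hu : IsDirichletFunction Ω u) (a : Plane) :
    IsDirichletFunction ((· + a) ⁻¹' Ω) (fun p => u (p + a)) where
  contDiffOn := hu.contDiffOn.comp (by fun_prop) fun _ hp => hp
  continuousOn := hu.continuousOn.comp (by fun_prop) fun _ hp =>
    (continuous_add_const a).closure_preimage_subset _ hp
  eq_zero p hp := hu.eq_zero _ hp

/-! ### Eigenspaces -/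

theorem mem_dirichletEigenspace {Ω : TopologicalSpace.Opens Plane} {μ : ℝ} {u : Plane → ℝ} :
    u ∈ dirichletEigenspace Ω μ ↔
      IsDirichletFunction Ω u ∧ ∀ x ∈ Ω, Δ u x + μ * u x = 0 := Iff.rfl

/-- Eigenfunctions on a disjoint union are pairs of eigenfunctions. -/
noncomputable def dirichletEigenspaceUnionEquiv {A B Ω : TopologicalSpace.Opens Plane}
    (hΩ : (Ω : Set Plane) = (A : Set Plane) ∪ (B : Set Plane))
    (hd : Disjoint (closure (A : Set Plane)) (closure (B : Set Plane))) (μ : ℝ) :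
    dirichletEigenspace Ω μ ≃ₗ[ℝ] dirichletEigenspace A μ × dirichletEigenspace B μ where
  toFun u :=
    (⟨(A : Set Plane).indicator u, by
      have h := mem_dirichletEigenspace.1 u.2
      rw [hΩ] at h
      refine ⟨h.1.indicator_left A.isOpen hd, fun x hx => ?_⟩
      rw [laplacian_indicator A.isOpen _ hx, Set.indicator_of_mem hx]
      exact h.2 x (by rw [← SetLike.mem_coe, hΩ]; exact Or.inl hx)⟩,
     ⟨(B : Set Plane).indicator u, by
      have h := mem_dirichletEigenspace.1 u.2
      rw [hΩ, Set.union_comm] at h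
      refine ⟨h.1.indicator_left B.isOpen hd.symm, fun x hx => ?_⟩
      rw [laplacian_indicator B.isOpen _ hx, Set.indicator_of_mem hx]
      exact h.2 x (by rw [← SetLike.mem_coe, hΩ]; exact Or.inr hx)⟩)
  invFun w := ⟨(w.1 : Plane → ℝ) + w.2, by
    obtain ⟨⟨u, hu, hu'⟩, ⟨v, hv, hv'⟩⟩ := w
    refine ⟨hΩ ▸ hu.union A.isOpen B.isOpen hd hv, fun x hx => ?_⟩
    rw [← SetLike.mem_coe, hΩ] at hx
    rcases hx with hx | hx
    · dsimp only
      rw [hv.laplacian_add_left hd hx, Pi.add_apply,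
        hv.eq_zero x (fun h => Set.disjoint_left.1 hd (subset_closure hx) (subset_closure h)),
        add_zero]
      exact hu' x hx
    · dsimp only
      rw [add_comm u v, hu.laplacian_add_left hd.symm hx, Pi.add_apply,
        hu.eq_zero x (fun h => Set.disjoint_left.1 hd (subset_closure h) (subset_closure hx)),
        add_zero]
      exact hv' x hx⟩
  map_add' u v := by
    ext x <;> exact congrFun (Set.indicator_add _ _ _) x
  map_smul' c u := by
    ext x <;> exact congrFun (Set.indicator_const_smul _ c (u : Plane → ℝ)) x
  left_inv u := by
    ext x
    have hx := (mem_dirichletEigenspace.1 u.2).1.eq_zero x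
    have hdis : ¬ (x ∈ A ∧ x ∈ B) := fun h =>
      Set.disjoint_left.1 hd (subset_closure h.1) (subset_closure h.2)
    rw [hΩ] at hx
    by_cases h1 : x ∈ A <;> by_cases h2 : x ∈ B
    · exact absurd ⟨h1, h2⟩ hdis
    · simp [h1, h2]
    · simp [h1, h2]
    · simp [h1, h2, hx (by simp [h1, h2])]
  right_inv w := by
    obtain ⟨⟨u, hu, hu'⟩, ⟨v, hv, hv'⟩⟩ := w
    have e1 : (A : Set Plane).indicator (u + v) = u := by
      ext x
      by_cases h1 : x ∈ (A : Set Plane)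
      · rw [Set.indicator_of_mem h1, Pi.add_apply, hv.eq_zero x (fun h =>
          Set.disjoint_left.1 hd (subset_closure h1) (subset_closure h)), add_zero]
      · rw [Set.indicator_of_notMem h1, hu.eq_zero x h1]
    have e2 : (B : Set Plane).indicator (u + v) = v := by
      ext x
      by_cases h1 : x ∈ (B : Set Plane)
      · rw [Set.indicator_of_mem h1, Pi.add_apply, hu.eq_zero x (fun h =>
          Set.disjoint_left.1 hd (subset_closure h) (subset_closure h1)), zero_add]
      · rw [Set.indicator_of_notMem h1, hv.eq_zero x h1]
    exact Prod.ext (Subtype.ext e1) (Subtype.ext e2)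

theorem rank_dirichletEigenspace_union {A B Ω : TopologicalSpace.Opens Plane}
    (hΩ : (Ω : Set Plane) = (A : Set Plane) ∪ (B : Set Plane))
    (hd : Disjoint (closure (A : Set Plane)) (closure (B : Set Plane))) (μ : ℝ) :
    Module.rank ℝ (dirichletEigenspace Ω μ) =
      Module.rank ℝ (dirichletEigenspace A μ) + Module.rank ℝ (dirichletEigenspace B μ) := by
  rw [(dirichletEigenspaceUnionEquiv hΩ hd μ).rank_eq, rank_prod']

theorem comp_add_mem_dirichletEigenspace {A B : TopologicalSpace.Opens Plane} {a : Plane}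
    (h : (B : Set Plane) = (· + a) ⁻¹' A) {μ : ℝ} {u : Plane → ℝ}
    (hu : u ∈ dirichletEigenspace A μ) : (fun p => u (p + a)) ∈ dirichletEigenspace B μ := by
  refine ⟨h ▸ hu.1.comp_add a, fun x hx => ?_⟩
  rw [laplacian_comp_add]
  rw [← SetLike.mem_coe, h] at hx
  exact hu.2 _ hx

/-- Translating the domain translates the eigenfunctions. -/
noncomputable def dirichletEigenspaceTranslateEquiv {A B : TopologicalSpace.Opens Plane} {a : Plane}
    (h : (B : Set Plane) = (· + a) ⁻¹' A) (μ : ℝ) :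
    dirichletEigenspace A μ ≃ₗ[ℝ] dirichletEigenspace B μ where
  toFun u := ⟨_, comp_add_mem_dirichletEigenspace h u.2⟩
  invFun u := ⟨_, comp_add_mem_dirichletEigenspace (a := -a)
    (by ext p; simp [h]) u.2⟩
  map_add' _ _ := rfl
  map_smul' _ _ := rfl
  left_inv u := by ext p; simp
  right_inv u := by ext p; simp

/-! ### Complete orthogonal systems of eigenfunctions -/

/-- A complete orthogonal system of smooth Dirichlet eigenfunctions `φ i` with eigenvalues
`lam i`. -/
structure IsDirichletSystem {ι : Type} (Ω : Set Plane) (φ : ι → Plane → ℝ) (lam : ι → ℝ) :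
    Prop where
  contDiff : ∀ i, ContDiff ℝ 2 (φ i)
  eq_zero : ∀ i, ∀ p ∈ frontier Ω, φ i p = 0
  eigen : ∀ i, ∀ p ∈ Ω, Δ (φ i) p + lam i * φ i p = 0
  orthogonal : ∀ i j, i ≠ j → ∫ p in Ω, φ i p * φ j p = 0
  norm_ne : ∀ i, ∫ p in Ω, φ i p * φ i p ≠ 0
  complete : ∀ u : Plane → ℝ, Continuous u → (∀ p ∉ Ω, u p = 0) →
    (∀ i, ∫ p, u p * φ i p = 0) → u = 0

/-- Taking integrals against the φ i with `lam i = μ` is a linear isomorphism from the eigenspace.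
It is injective because the integrals against all other φ i vanish by orthogonality, so completeness
applies; completeness for continuous functions is enough, since eigenfunctions are continuous. It is
onto because the φ i, cut off outside Ω, are mutually orthogonal eigenfunctions. -/
theorem IsDirichletSystem.rank_eigenspace {ι : Type} {Ω : TopologicalSpace.Opens Plane}
    {φ : ι → Plane → ℝ} {lam : ι → ℝ} (h : IsDirichletSystem (Ω : Set Plane) φ lam)
    (hconv : Convex ℝ (Ω : Set Plane)) (hbdd : Bornology.IsBounded (Ω : Set Plane)) (μ : ℝ)
    (hfin : {i | lam i = μ}.Finite) :
    Module.rank ℝ (dirichletEigenspace Ω μ) = Cardinal.mk {i // lam i = μ} := by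
  classical
  have : Fintype {i // lam i = μ} := hfin.fintype
  have hInt (u : dirichletEigenspace Ω μ) (i : ι) : Integrable fun p => (u : Plane → ℝ) p * φ i p :=
    u.2.1.integrable_mul Ω.isOpen hbdd (h.contDiff i).continuous
  let coef : dirichletEigenspace Ω μ →ₗ[ℝ] ({i // lam i = μ} → ℝ) :=
    { toFun := fun u i => ∫ p, (u : Plane → ℝ) p * φ i p
      map_add' := fun u v => by
        ext i
        simp only [Submodule.coe_add, Pi.add_apply, add_mul]
        exact integral_add (hInt u i) (hInt v i)
      map_smul' := fun c u => by
        ext i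
        simp only [SetLike.val_smul, Pi.smul_apply, smul_eq_mul, RingHom.id_apply, mul_assoc]
        exact integral_const_mul _ _ }
  have hinj : Function.Injective coef := by
    rw [← LinearMap.ker_eq_bot, LinearMap.ker_eq_bot']
    intro u hu
    have hz : (u : Plane → ℝ) = 0 := by
      refine h.complete u (u.2.1.continuous Ω.isOpen) u.2.1.eq_zero fun i => ?_
      by_cases hi : lam i = μ
      · exact congrFun hu ⟨i, hi⟩
      · exact integral_mul_eq_zero_of_eigenvalue_ne Ω.isOpen hconv hbdd (h.contDiff i) (h.eq_zero i)
          (h.eigen i) u.2.1 u.2.2 hi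
    exact Subtype.ext hz
  have hmem (i : {i // lam i = μ}) :
      (Ω : Set Plane).indicator (φ i) ∈ dirichletEigenspace Ω μ := by
    refine ⟨isDirichletFunction_indicator Ω.isOpen (h.contDiff i).contDiffOn
      (h.contDiff i).continuous.continuousOn (h.eq_zero i), fun x hx => ?_⟩
    rw [laplacian_indicator Ω.isOpen _ hx, Set.indicator_of_mem hx]
    have := h.eigen i x hx
    rwa [i.2] at this
  have hcoef (i j : {i // lam i = μ}) :
      coef ⟨_, hmem i⟩ j = ∫ p in (Ω : Set Plane), φ i p * φ j p := by
    rw [← integral_indicator Ω.isOpen.measurableSet]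
    refine integral_congr_ae (Eventually.of_forall fun p => ?_)
    exact (Set.indicator_mul_left _ _ _).symm
  have hsurj : Function.Surjective coef := by
    intro d
    refine ⟨∑ i, (d i / ∫ p in (Ω : Set Plane), φ i p * φ i p) •
      (⟨_, hmem i⟩ : dirichletEigenspace Ω μ), ?_⟩
    ext j
    simp only [map_sum, map_smul, Finset.sum_apply, Pi.smul_apply, smul_eq_mul, hcoef]
    rw [Finset.sum_eq_single j]
    · exact div_mul_cancel₀ _ (h.norm_ne j)
    · intro i _ hij
      rw [h.orthogonal i j fun e => hij (Subtype.ext e), mul_zero]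
    · simp
  rw [(LinearEquiv.ofBijective coef ⟨hinj, hsurj⟩).rank_eq, rank_fun']
  simp

/-! ### Torsion functions -/

/-- Uniqueness of the torsion function thereby becomes a statement about the spectrum, namely that 0
is not an eigenvalue; no maximum principle is used. -/
theorem IsTorsionFunction.sub_mem {Ω : TopologicalSpace.Opens Plane} {u v : Plane → ℝ}
    (hu : IsTorsionFunction Ω u) (hv : IsTorsionFunction Ω v) :
    u - v ∈ dirichletEigenspace Ω 0 := by
  refine ⟨⟨hu.1.contDiffOn.sub hv.1.contDiffOn, hu.1.continuousOn.sub hv.1.continuousOn,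
    fun x hx => by simp [hu.1.eq_zero x hx, hv.1.eq_zero x hx]⟩, fun x hx => ?_⟩
  have hn := Ω.isOpen.mem_nhds hx
  rw [(hu.1.contDiffOn.contDiffAt hn).laplacian_sub (hv.1.contDiffOn.contDiffAt hn),
    hu.2 x hx, hv.2 x hx]
  simp

theorem IsTorsionFunction.unique {Ω : TopologicalSpace.Opens Plane}
    (h0 : Module.rank ℝ (dirichletEigenspace Ω 0) = 0) {u v : Plane → ℝ}
    (hu : IsTorsionFunction Ω u) (hv : IsTorsionFunction Ω v) : u = v := by
  have := rank_zero_iff.1 h0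
  have h := congrArg Subtype.val
    (Subsingleton.elim (⟨u - v, hu.sub_mem hv⟩ : dirichletEigenspace Ω 0) 0)
  exact sub_eq_zero.1 h

theorem torsionalRigidity_eq {Ω : TopologicalSpace.Opens Plane}
    (h0 : Module.rank ℝ (dirichletEigenspace Ω 0) = 0) {u : Plane → ℝ}
    (hu : IsTorsionFunction Ω u) : torsionalRigidity Ω = ∫ x in (Ω : Set Plane), u x := by
  have h : ∃ u, IsTorsionFunction Ω u := ⟨u, hu⟩
  rw [torsionalRigidity, dif_pos h, h.choose_spec.unique h0 hu]

theorem IsTorsionFunction.union {A B : Set Plane} (hA : IsOpen A) (hB : IsOpen B)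
    (hd : Disjoint (closure A) (closure B)) {u v : Plane → ℝ}
    (hu : IsTorsionFunction A u) (hv : IsTorsionFunction B v) :
    IsTorsionFunction (A ∪ B) (u + v) := by
  refine ⟨hu.1.union hA hB hd hv.1, ?_⟩
  rintro x (hx | hx)
  · rw [hv.1.laplacian_add_left hd hx, hu.2 x hx]
  · rw [add_comm u v, hu.1.laplacian_add_left hd.symm hx, hv.2 x hx]

theorem IsTorsionFunction.comp_add {Ω : Set Plane} {u : Plane → ℝ} (hu : IsTorsionFunction Ω u)
    (a : Plane) : IsTorsionFunction ((· + a) ⁻¹' Ω) (fun p => u (p + a)) :=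
  ⟨hu.1.comp_add a, fun x hx => by rw [laplacian_comp_add]; exact hu.2 _ hx⟩

theorem IsDirichletFunction.setIntegral_eq {Ω : Set Plane} {u : Plane → ℝ}
    (hu : IsDirichletFunction Ω u) : ∫ p in Ω, u p = ∫ p, u p :=
  setIntegral_eq_integral_of_forall_compl_eq_zero fun p hp => hu.eq_zero p hp

/-! ### Sine functions on an interval -/

/-- The `n`-th Dirichlet eigenfunction of the interval `(0, L)`. -/
noncomputable def sineMode (L : ℝ) (n : ℕ) (x : ℝ) : ℝ := Real.sin (n * (Real.pi / L) * x)

theorem contDiff_sineMode (L : ℝ) (n : ℕ) {k : WithTop ℕ∞} : ContDiff ℝ k (sineMode L n) := by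
  unfold sineMode; fun_prop

theorem continuous_sineMode (L : ℝ) (n : ℕ) : Continuous (sineMode L n) :=
  (contDiff_sineMode L n (k := 0)).continuous

theorem sineMode_zero_right (L : ℝ) (n : ℕ) : sineMode L n 0 = 0 := by simp [sineMode]

theorem sineMode_zero_left (L x : ℝ) : sineMode L 0 x = 0 := by simp [sineMode]

theorem sineMode_sub {L : ℝ} (hL : L ≠ 0) (n : ℕ) (x : ℝ) :
    sineMode L n (L - x) = -((-1) ^ n * sineMode L n x) := by
  unfold sineMode
  rw [← Real.sin_nat_mul_pi_sub]
  congr 1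
  field_simp

theorem sineMode_self {L : ℝ} (hL : L ≠ 0) (n : ℕ) : sineMode L n L = 0 := by
  have := sineMode_sub hL n 0
  simpa [sineMode_zero_right] using this

theorem hasDerivAt_sineMode (L : ℝ) (n : ℕ) (x : ℝ) :
    HasDerivAt (sineMode L n) (n * (Real.pi / L) * Real.cos (n * (Real.pi / L) * x)) x := by
  have h := ((hasDerivAt_id x).const_mul (n * (Real.pi / L))).sin
  refine h.congr_deriv ?_
  simp only [id]; ring

theorem hasDerivAt_deriv_sineMode (L : ℝ) (n : ℕ) (x : ℝ) :
    HasDerivAt (fun x => n * (Real.pi / L) * Real.cos (n * (Real.pi / L) * x))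
      (-((n * (Real.pi / L)) ^ 2 * sineMode L n x)) x := by
  have h := (((hasDerivAt_id x).const_mul (n * (Real.pi / L))).cos).const_mul (n * (Real.pi / L))
  refine h.congr_deriv ?_
  simp only [id, sineMode]; ring

/-- This recurrence lets any power of the cosine be absorbed into a combination of sine modes. -/
theorem sineMode_mul_cos (L : ℝ) (n : ℕ) (x : ℝ) :
    sineMode L (n + 1) x * Real.cos (Real.pi / L * x) =
      1 / 2 * sineMode L (n + 2) x + 1 / 2 * sineMode L n x := by
  unfold sineMode
  have e1 : ((n + 2 : ℕ) : ℝ) * (Real.pi / L) * x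
      = ((n + 1 : ℕ) : ℝ) * (Real.pi / L) * x + Real.pi / L * x := by push_cast; ring
  have e2 : (n : ℝ) * (Real.pi / L) * x
      = ((n + 1 : ℕ) : ℝ) * (Real.pi / L) * x - Real.pi / L * x := by push_cast; ring
  rw [e1, e2, Real.sin_add, Real.sin_sub]
  ring

/-- Completeness of the sine functions among continuous functions on an interval. -/
theorem eq_zero_of_integral_mul_sineMode_eq_zero {L : ℝ} (hL : 0 < L) {f : ℝ → ℝ}
    (hf : Continuous f) (h : ∀ n, 0 < n → ∫ x in 0..L, f x * sineMode L n x = 0) :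
    ∀ x ∈ Set.Ioo 0 L, f x = 0 := by
  have hii : ∀ {g : ℝ → ℝ}, Continuous g → IntervalIntegrable g volume 0 L := fun hg =>
    hg.intervalIntegrable _ _
  have hs := continuous_sineMode L
  have hcos : Continuous fun x => Real.cos (Real.pi / L * x) := by fun_prop
  -- All n are treated at once because multiplication by the cosine moves the index by one in either
  -- direction; index 0 does no harm since that mode is zero.
  have hpow : ∀ k n : ℕ,
      ∫ x in 0..L, f x * sineMode L n x * Real.cos (Real.pi / L * x) ^ k = 0 := by
    intro k
    induction k with
    | zero =>
      intro n
      rcases Nat.eq_zero_or_pos n with rfl | hn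
      · simp [sineMode_zero_left]
      · simpa using h n hn
    | succ k ih =>
      intro n
      cases n with
      | zero => simp [sineMode_zero_left]
      | succ n =>
        have e : ∀ x, f x * sineMode L (n + 1) x * Real.cos (Real.pi / L * x) ^ (k + 1)
            = 1 / 2 * (f x * sineMode L (n + 2) x * Real.cos (Real.pi / L * x) ^ k)
              + 1 / 2 * (f x * sineMode L n x * Real.cos (Real.pi / L * x) ^ k) := by
          intro x
          rw [pow_succ]
          linear_combination f x * Real.cos (Real.pi / L * x) ^ k * sineMode_mul_cos L n x
        simp only [e]
        have hc (j : ℕ) : Continuous fun x =>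
            1 / 2 * (f x * sineMode L j x * Real.cos (Real.pi / L * x) ^ k) :=
          continuous_const.mul ((hf.mul (hs _)).mul (hcos.pow _))
        rw [intervalIntegral.integral_add (hii (hc _)) (hii (hc _)),
          intervalIntegral.integral_const_mul, intervalIntegral.integral_const_mul, ih, ih]
        simp
  -- The product of f with the first mode is orthogonal to every polynomial in cos(πx/L). These are
  -- dense because the cosine is injective on [0, L], so g is orthogonal to itself.
  set g : ℝ → ℝ := fun x => f x * sineMode L 1 x with hg
  have hgc : Continuous g := hf.mul (hs 1)
  have hpoly : ∀ P : Polynomial ℝ,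
      ∫ x in 0..L, g x * P.eval (Real.cos (Real.pi / L * x)) = 0 := by
    intro P
    simp only [Polynomial.eval_eq_sum_range, Finset.mul_sum]
    rw [intervalIntegral.integral_finsetSum]
    · refine Finset.sum_eq_zero fun k _ => ?_
      have := hpow k 1
      calc _ = ∫ x in 0..L, P.coeff k * (f x * sineMode L 1 x * Real.cos (Real.pi / L * x) ^ k) := by
            refine intervalIntegral.integral_congr fun x _ => ?_
            simp only [hg]; ring
        _ = 0 := by rw [intervalIntegral.integral_const_mul, this, mul_zero]
    · intro k _
      exact hii (hgc.mul (continuous_const.mul (hcos.pow k)))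
  have hsq : ∫ x in 0..L, g x * g x = 0 := by
    have hnn : 0 ≤ ∫ x in 0..L, g x * g x :=
      intervalIntegral.integral_nonneg hL.le fun x _ => mul_self_nonneg _
    have hA : 0 ≤ ∫ x in 0..L, |g x| :=
      intervalIntegral.integral_nonneg hL.le fun x _ => abs_nonneg _
    have hle : ∀ ε > 0, ∫ x in 0..L, g x * g x ≤ ε * ∫ x in 0..L, |g x| := by
      intro ε hε
      -- Substituting the arccosine writes g as a continuous function of c = cos(πx/L) on [-1, 1],
      -- where the Weierstrass theorem applies.
      obtain ⟨P, hP⟩ := exists_polynomial_near_of_continuousOn (-1) 1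
        (fun c => g (L / Real.pi * Real.arccos c))
        (hgc.comp (continuous_const.mul Real.continuous_arccos)).continuousOn ε hε
      have hPc : Continuous fun x => P.eval (Real.cos (Real.pi / L * x)) :=
        P.continuous.comp hcos
      have e1 : ∫ x in 0..L, g x * g x
          = ∫ x in 0..L, g x * (g x - P.eval (Real.cos (Real.pi / L * x))) := by
        have hc1 : Continuous fun x => g x * g x := hgc.mul hgc
        have hc2 : Continuous fun x => g x * P.eval (Real.cos (Real.pi / L * x)) := hgc.mul hPc
        simp only [mul_sub]
        rw [intervalIntegral.integral_sub (hii hc1) (hii hc2), hpoly, sub_zero]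
      rw [e1, ← intervalIntegral.integral_const_mul]
      refine intervalIntegral.integral_mono_on hL.le (hii (hgc.mul (hgc.sub hPc)))
        (hii (continuous_const.mul hgc.abs)) fun x hx => ?_
      have h1 := hP (Real.cos (Real.pi / L * x)) ⟨Real.neg_one_le_cos _, Real.cos_le_one _⟩
      have h2 : L / Real.pi * Real.arccos (Real.cos (Real.pi / L * x)) = x := by
        rw [Real.arccos_cos]
        · field_simp
        · have := hx.1; have := Real.pi_pos; positivity
        · rw [div_mul_eq_mul_div, div_le_iff₀ hL]
          exact mul_le_mul_of_nonneg_left hx.2 Real.pi_pos.le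
      rw [h2, abs_sub_comm] at h1
      calc g x * (g x - P.eval (Real.cos (Real.pi / L * x)))
          ≤ |g x * (g x - P.eval (Real.cos (Real.pi / L * x)))| := le_abs_self _
        _ = |g x - P.eval (Real.cos (Real.pi / L * x))| * |g x| := by rw [abs_mul, mul_comm]
        _ ≤ ε * |g x| := by gcongr
    refine le_antisymm ?_ hnn
    have hcont : Tendsto (fun ε : ℝ => ε * ∫ x in 0..L, |g x|) (𝓝[>] 0) (𝓝 0) := by
      have : Continuous fun ε : ℝ => ε * ∫ x in 0..L, |g x| := by fun_prop
      simpa using (this.tendsto 0).mono_left (nhdsWithin_le_nhds (s := Set.Ioi 0))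
    exact ge_of_tendsto hcont (eventually_mem_nhdsWithin.mono fun ε hε => hle ε hε)
  intro x hx
  by_contra hne
  -- The first mode has no zero inside the interval, so f vanishes wherever g does.
  have hspos : 0 < sineMode L 1 x := by
    unfold sineMode
    have := Real.pi_pos
    have := hx.1
    refine Real.sin_pos_of_pos_of_lt_pi (by positivity) ?_
    rw [Nat.cast_one, one_mul, div_mul_eq_mul_div, div_lt_iff₀ hL]
    exact mul_lt_mul_of_pos_left hx.2 Real.pi_pos
  have hpos : 0 < ∫ x in 0..L, g x * g x := by
    refine intervalIntegral.integral_pos hL (hgc.mul hgc).continuousOn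
      (fun x _ => mul_self_nonneg _) ⟨x, ⟨hx.1.le, hx.2.le⟩, ?_⟩
    exact mul_self_pos.2 (mul_ne_zero hne hspos.ne')
  exact hpos.ne' hsq

/-- Green's identity with ε = 0: the boundary terms vanish, and the factor m² - n² does not. -/
theorem setIntegral_sineMode_mul_ne {L : ℝ} (hL : 0 < L) {m n : ℕ} (hmn : m ≠ n) :
    ∫ x in Set.Ioo 0 L, sineMode L m x * sineMode L n x = 0 := by
  have hfr : ∀ k, ∀ t ∈ frontier (Set.Ioo 0 L), sineMode L k t = 0 := by
    intro k t ht
    rw [frontier_Ioo hL] at ht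
    rcases ht with rfl | ht
    · exact sineMode_zero_right _ _
    · rw [Set.mem_singleton_iff.1 ht, sineMode_self hL.ne']
  have h := abs_setIntegral_green_le isOpen_Ioo Set.ordConnected_Ioo
    (Metric.isBounded_Ioo (0 : ℝ) L) (ε := 0)
    (fun t _ => hasDerivAt_sineMode L m t) (fun t _ => hasDerivAt_deriv_sineMode L m t)
    (continuous_const.mul (continuous_sineMode L m)).neg.continuousOn
    (fun t _ => hasDerivAt_sineMode L n t) (fun t _ => hasDerivAt_deriv_sineMode L n t)
    (continuous_const.mul (continuous_sineMode L n)).neg.continuousOn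
    (M := |n * (Real.pi / L)|) (abs_nonneg _) le_rfl (hfr n) (fun t ht => by rw [hfr m t ht]; simp)
    (fun t _ => by
      rw [abs_mul]
      exact mul_le_of_le_one_right (abs_nonneg _) (Real.abs_cos_le_one _))
  rw [zero_mul, mul_zero, abs_nonpos_iff] at h
  have e : ∀ t, sineMode L m t * -((n * (Real.pi / L)) ^ 2 * sineMode L n t) -
      sineMode L n t * -((m * (Real.pi / L)) ^ 2 * sineMode L m t)
      = (((m : ℝ) ^ 2 - (n : ℝ) ^ 2) * (Real.pi / L) ^ 2) * (sineMode L m t * sineMode L n t) := by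
    intro t; ring
  simp only [e] at h
  rw [integral_const_mul] at h
  refine (mul_eq_zero.1 h).resolve_left (mul_ne_zero ?_ ?_)
  · rw [sub_ne_zero]
    intro h
    exact hmn (by exact_mod_cast (pow_left_inj₀ (by positivity) (by positivity) two_ne_zero).1 h)
  · have := Real.pi_pos
    positivity

theorem setIntegral_sineMode_sq_pos {L : ℝ} (hL : 0 < L) {n : ℕ} (hn : 0 < n) :
    0 < ∫ x in Set.Ioo 0 L, sineMode L n x * sineMode L n x := by
  rw [← integral_Ioc_eq_integral_Ioo, ← intervalIntegral.integral_of_le hL.le]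
  have hn' : (1 : ℝ) ≤ n := by exact_mod_cast hn
  refine intervalIntegral.integral_pos hL
    ((continuous_sineMode L n).mul (continuous_sineMode L n)).continuousOn
    (fun x _ => mul_self_nonneg _) ⟨L / (2 * n), ⟨by positivity, ?_⟩, ?_⟩
  · exact div_le_self hL.le (by linarith)
  · have : sineMode L n (L / (2 * n)) = 1 := by
      unfold sineMode
      rw [← Real.sin_pi_div_two]
      congr 1
      field_simp
    rw [this]; norm_num

/-! ### Products of functions of one coordinate -/

theorem contDiff_mul_coord {f g : ℝ → ℝ} {k : WithTop ℕ∞} (hf : ContDiff ℝ k f)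
    (hg : ContDiff ℝ k g) : ContDiff ℝ k fun p : Plane => f (p 0) * g (p 1) :=
  (hf.comp (by fun_prop)).mul (hg.comp (by fun_prop))

theorem laplacian_mul_coord {f f' g g' : ℝ → ℝ} {a b : ℝ} (hf2 : ContDiff ℝ 2 f)
    (hg2 : ContDiff ℝ 2 g) (hf : ∀ x, HasDerivAt f (f' x) x)
    (hf' : ∀ x, HasDerivAt f' (-(a * f x)) x) (hg : ∀ x, HasDerivAt g (g' x) x)
    (hg' : ∀ x, HasDerivAt g' (-(b * g x)) x) (p : Plane) :
    Δ (fun p : Plane => f (p 0) * g (p 1)) p = -((a + b) * (f (p 0) * g (p 1))) := by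
  have hsh (x t : ℝ) : HasDerivAt (fun t : ℝ => x + t) 1 t := by
    simpa using (hasDerivAt_id t).const_add x
  have comp {F : ℝ → ℝ} {F' x t : ℝ} (h : HasDerivAt F F' (x + t)) :
      HasDerivAt (fun t => F (x + t)) F' t :=
    (h.comp t (hsh x t)).congr_deriv (mul_one _)
  rw [laplacian_eq_of_hasDerivAt (contDiff_mul_coord hf2 hg2).contDiffAt
    (f' := ![fun t => f' (p 0 + t) * g (p 1), fun t => f (p 0) * g' (p 1 + t)])
    (c := ![-(a * f (p 0)) * g (p 1), f (p 0) * -(b * g (p 1))])]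
  · simp; ring
  · rw [Fin.forall_fin_two]
    constructor
    · refine Eventually.of_forall fun t => ?_
      simpa using (comp (hf (p 0 + t))).mul_const (g (p 1))
    · refine Eventually.of_forall fun t => ?_
      simpa using (comp (hg (p 1 + t))).const_mul (f (p 0))
  · rw [Fin.forall_fin_two]
    constructor
    · have := (comp (x := p 0) (t := 0) (hf' (p 0 + 0))).mul_const (g (p 1))
      simpa using this
    · have := (comp (x := p 1) (t := 0) (hg' (p 1 + 0))).const_mul (f (p 0))
      simpa using this

theorem integral_mul_coord (f g : ℝ → ℝ) :
    ∫ p : Plane, f (p 0) * g (p 1) = (∫ x, f x) * ∫ y, g y := by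
  rw [integral_plane_eq_integral_prod]
  exact integral_prod_mul (μ := volume) (ν := volume) f g

theorem mem_openRectangle_zero {L H : ℝ} {p : Plane} :
    p ∈ openRectangle !₂[0, 0] L H ↔ p 0 ∈ Set.Ioo 0 L ∧ p 1 ∈ Set.Ioo 0 H := by
  simp [openRectangle, and_assoc]

theorem setIntegral_openRectangle_mul_coord (L H : ℝ) (f g : ℝ → ℝ) :
    ∫ p in openRectangle !₂[0, 0] L H, f (p 0) * g (p 1) =
      (∫ x in Set.Ioo 0 L, f x) * ∫ y in Set.Ioo 0 H, g y := by
  rw [← integral_indicator (isOpen_openRectangle _ _ _).measurableSet,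
    ← integral_indicator measurableSet_Ioo, ← integral_indicator measurableSet_Ioo,
    ← integral_mul_coord]
  refine integral_congr_ae (Eventually.of_forall fun p => ?_)
  dsimp only
  by_cases h0 : p 0 ∈ Set.Ioo 0 L <;> by_cases h1 : p 1 ∈ Set.Ioo 0 H
  · rw [Set.indicator_of_mem (mem_openRectangle_zero.2 ⟨h0, h1⟩), Set.indicator_of_mem h0,
      Set.indicator_of_mem h1]
  · rw [Set.indicator_of_notMem (fun h => h1 (mem_openRectangle_zero.1 h).2),
      Set.indicator_of_notMem h1, mul_zero]
  · rw [Set.indicator_of_notMem (fun h => h0 (mem_openRectangle_zero.1 h).1),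
      Set.indicator_of_notMem h0, zero_mul]
  · rw [Set.indicator_of_notMem (fun h => h0 (mem_openRectangle_zero.1 h).1),
      Set.indicator_of_notMem h0, zero_mul]

/-! ### Geometry of rectangles and triangles -/

/-- Every point of K is the limit, as s → 1, of its contractions towards c, and these lie in Ω. -/
theorem closure_eq_of_homothety {Ω K : Set Plane} (hK : IsClosed K) (hΩK : Ω ⊆ K) (c : Plane)
    (h : ∀ p ∈ K, ∀ s ∈ Set.Ioo (0 : ℝ) 1, (1 - s) • c + s • p ∈ Ω) : closure Ω = K := by
  refine (closure_minimal hΩK hK).antisymm fun p hp => ?_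
  have ht : Tendsto (fun s : ℝ => (1 - s) • c + s • p) (𝓝[<] 1) (𝓝 p) := by
    have hc : Continuous fun s : ℝ => (1 - s) • c + s • p := by fun_prop
    have := (hc.tendsto 1).mono_left (nhdsWithin_le_nhds (s := Set.Iio 1))
    simpa using this
  refine mem_closure_of_tendsto ht ?_
  have hio : ∀ᶠ s in 𝓝[<] (1 : ℝ), s ∈ Set.Ioo (0 : ℝ) 1 := Ioo_mem_nhdsLT (by norm_num)
  exact hio.mono fun s hs => h p hp s hs

theorem convex_openRectangle (a : Plane) (L H : ℝ) : Convex ℝ (openRectangle a L H) := by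
  rintro p ⟨h1, h2, h3, h4⟩ q ⟨k1, k2, k3, k4⟩ x y hx hy hxy
  obtain rfl : y = 1 - x := by linarith
  simp only [openRectangle, Set.mem_ofPred_eq, PiLp.add_apply, PiLp.smul_apply, smul_eq_mul]
  rcases hx.eq_or_lt with rfl | hx'
  · simp [*]
  · refine ⟨?_, ?_, ?_, ?_⟩ <;> nlinarith

theorem convex_openRightIsoscelesTriangle (a : Plane) (L : ℝ) :
    Convex ℝ (openRightIsoscelesTriangle a L) := by
  rintro p ⟨h1, h2, h3⟩ q ⟨k1, k2, k3⟩ x y hx hy hxy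
  obtain rfl : y = 1 - x := by linarith
  simp only [openRightIsoscelesTriangle, Set.mem_ofPred_eq, PiLp.add_apply, PiLp.smul_apply,
    smul_eq_mul]
  rcases hx.eq_or_lt with rfl | hx'
  · simp [*]
  · refine ⟨?_, ?_, ?_⟩ <;> nlinarith

theorem isBounded_of_abs_coord_le {S : Set Plane} (R : ℝ)
    (h : ∀ p ∈ S, |p 0| ≤ R ∧ |p 1| ≤ R) : Bornology.IsBounded S := by
  refine isBounded_iff_forall_norm_le.2 ⟨√(R ^ 2 + R ^ 2), fun p hp => ?_⟩
  rw [EuclideanSpace.norm_eq, Fin.sum_univ_two]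
  obtain ⟨h0, h1⟩ := h p hp
  exact Real.sqrt_le_sqrt (add_le_add (pow_le_pow_left₀ (abs_nonneg _) h0 2)
    (pow_le_pow_left₀ (abs_nonneg _) h1 2))

theorem isBounded_openRectangle (a : Plane) (L H : ℝ) :
    Bornology.IsBounded (openRectangle a L H) := by
  refine isBounded_of_abs_coord_le (|a 0| + |a 1| + |L| + |H|) fun p hp => ?_
  obtain ⟨h1, h2, h3, h4⟩ := hp
  have := neg_abs_le (a 0); have := neg_abs_le (a 1)
  have := le_abs_self (a 0); have := le_abs_self (a 1)
  have := le_abs_self L; have := le_abs_self H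
  have := abs_nonneg (a 0); have := abs_nonneg (a 1)
  have := abs_nonneg L; have := abs_nonneg H
  constructor <;> rw [abs_le] <;> constructor <;> linarith

theorem isBounded_openRightIsoscelesTriangle (a : Plane) (L : ℝ) :
    Bornology.IsBounded (openRightIsoscelesTriangle a L) := by
  refine isBounded_of_abs_coord_le (|a 0| + |a 1| + |L|) fun p hp => ?_
  obtain ⟨h1, h2, h3⟩ := hp
  have := neg_abs_le (a 0); have := neg_abs_le (a 1)
  have := le_abs_self (a 0); have := le_abs_self (a 1)
  have := le_abs_self L
  have := abs_nonneg (a 0); have := abs_nonneg (a 1)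
  have := abs_nonneg L
  constructor <;> rw [abs_le] <;> constructor <;> linarith

theorem closure_openRectangle (a : Plane) {L H : ℝ} (hL : 0 < L) (hH : 0 < H) :
    closure (openRectangle a L H) =
      {x | a 0 ≤ x 0 ∧ x 0 ≤ a 0 + L ∧ a 1 ≤ x 1 ∧ x 1 ≤ a 1 + H} := by
  have hc (i : Fin 2) : Continuous fun x : Plane => x i := by fun_prop
  refine closure_eq_of_homothety ?_ ?_ !₂[a 0 + L / 2, a 1 + H / 2] ?_
  · exact (isClosed_le continuous_const (hc 0)).inter ((isClosed_le (hc 0) continuous_const).inter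
      ((isClosed_le continuous_const (hc 1)).inter (isClosed_le (hc 1) continuous_const)))
  · exact fun x h => ⟨h.1.le, h.2.1.le, h.2.2.1.le, h.2.2.2.le⟩
  · rintro p ⟨h1, h2, h3, h4⟩ s ⟨hs0, hs1⟩
    simp only [openRectangle, Set.mem_ofPred_eq, PiLp.add_apply, PiLp.smul_apply, smul_eq_mul]
    simp only [Matrix.cons_val_zero, Matrix.cons_val_one]
    have hs1' := sub_pos.2 hs1
    have := mul_pos hs1' hL
    have := mul_pos hs1' hH
    refine ⟨?_, ?_, ?_, ?_⟩ <;> nlinarith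

theorem closure_openRightIsoscelesTriangle (a : Plane) {L : ℝ} (hL : 0 < L) :
    closure (openRightIsoscelesTriangle a L) =
      {x | a 0 ≤ x 0 ∧ a 1 ≤ x 1 ∧ (x 0 - a 0) + (x 1 - a 1) ≤ L} := by
  have hc (i : Fin 2) : Continuous fun x : Plane => x i := by fun_prop
  refine closure_eq_of_homothety ?_ ?_ !₂[a 0 + L / 4, a 1 + L / 4] ?_
  · exact (isClosed_le continuous_const (hc 0)).inter ((isClosed_le continuous_const (hc 1)).inter
      (isClosed_le (((hc 0).sub continuous_const).add ((hc 1).sub continuous_const))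
        continuous_const))
  · exact fun x h => ⟨h.1.le, h.2.1.le, h.2.2.le⟩
  · rintro p ⟨h1, h2, h3⟩ s ⟨hs0, hs1⟩
    simp only [openRightIsoscelesTriangle, Set.mem_ofPred_eq, PiLp.add_apply, PiLp.smul_apply,
      smul_eq_mul]
    simp only [Matrix.cons_val_zero, Matrix.cons_val_one]
    have := mul_pos (sub_pos.2 hs1) hL
    refine ⟨?_, ?_, ?_⟩ <;> nlinarith

theorem mem_frontier_openRectangle {a : Plane} {L H : ℝ} (hL : 0 < L) (hH : 0 < H) {p : Plane} :
    p ∈ frontier (openRectangle a L H) ↔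
      (a 0 ≤ p 0 ∧ p 0 ≤ a 0 + L ∧ a 1 ≤ p 1 ∧ p 1 ≤ a 1 + H) ∧
        (p 0 = a 0 ∨ p 0 = a 0 + L ∨ p 1 = a 1 ∨ p 1 = a 1 + H) := by
  rw [(isOpen_openRectangle _ _ _).frontier_eq, closure_openRectangle a hL hH, Set.mem_sdiff]
  simp only [openRectangle, Set.mem_ofPred_eq]
  refine and_congr_right fun ⟨h1, h2, h3, h4⟩ => ?_
  rw [h1.lt_iff_ne', h2.lt_iff_ne, h3.lt_iff_ne', h4.lt_iff_ne]
  tauto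

theorem mem_frontier_openRightIsoscelesTriangle {a : Plane} {L : ℝ} (hL : 0 < L) {p : Plane} :
    p ∈ frontier (openRightIsoscelesTriangle a L) ↔
      (a 0 ≤ p 0 ∧ a 1 ≤ p 1 ∧ (p 0 - a 0) + (p 1 - a 1) ≤ L) ∧
        (p 0 = a 0 ∨ p 1 = a 1 ∨ (p 0 - a 0) + (p 1 - a 1) = L) := by
  rw [(isOpen_openRightIsoscelesTriangle _ _).frontier_eq, closure_openRightIsoscelesTriangle a hL,
    Set.mem_sdiff]
  simp only [openRightIsoscelesTriangle, Set.mem_ofPred_eq]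
  refine and_congr_right fun ⟨h1, h2, h3⟩ => ?_
  rw [h1.lt_iff_ne', h2.lt_iff_ne', h3.lt_iff_ne]
  tauto

/-! ### The eigenfunctions of a rectangle -/

/-- The eigenfunction of the rectangle `(0, L) × (0, H)` with indices `m`, `n`. -/
noncomputable def rectangleMode (L H : ℝ) (m n : ℕ) (p : Plane) : ℝ :=
  sineMode L m (p 0) * sineMode H n (p 1)

theorem contDiff_rectangleMode (L H : ℝ) (m n : ℕ) {k : WithTop ℕ∞} :
    ContDiff ℝ k (rectangleMode L H m n) :=
  contDiff_mul_coord (contDiff_sineMode L m) (contDiff_sineMode H n)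

theorem continuous_rectangleMode (L H : ℝ) (m n : ℕ) : Continuous (rectangleMode L H m n) :=
  (contDiff_rectangleMode L H m n (k := 0)).continuous

theorem laplacian_rectangleMode (L H : ℝ) (m n : ℕ) (p : Plane) :
    Δ (rectangleMode L H m n) p =
      -(((m * (Real.pi / L)) ^ 2 + (n * (Real.pi / H)) ^ 2) * rectangleMode L H m n p) :=
  laplacian_mul_coord (contDiff_sineMode L m) (contDiff_sineMode H n) (hasDerivAt_sineMode L m)
    (hasDerivAt_deriv_sineMode L m) (hasDerivAt_sineMode H n) (hasDerivAt_deriv_sineMode H n) p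

theorem integral_eq_interval_of_support {f : ℝ → ℝ} {L : ℝ} (hL : 0 ≤ L)
    (h : ∀ x ∉ Set.Ioo 0 L, f x = 0) : ∫ x, f x = ∫ x in 0..L, f x := by
  rw [intervalIntegral.integral_of_le hL, integral_Ioc_eq_integral_Ioo,
    setIntegral_eq_integral_of_forall_compl_eq_zero h]

/-- One-dimensional completeness is used twice. For fixed n the n-th sine coefficient in y is a
continuous function of x orthogonal to all modes, hence zero on (0, L); then each vertical slice of
u has only zero coefficients. -/
theorem eq_zero_of_integral_mul_rectangleMode {L H : ℝ} (hL : 0 < L) (hH : 0 < H)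
    {u : Plane → ℝ} (hu : Continuous u) (hu0 : ∀ p ∉ openRectangle !₂[0, 0] L H, u p = 0)
    (h : ∀ m n, 0 < m → 0 < n → ∫ p, u p * rectangleMode L H m n p = 0) : u = 0 := by
  have hvec : Continuous fun z : ℝ × ℝ => (!₂[z.1, z.2] : Plane) := by fun_prop
  have hcs : HasCompactSupport u := HasCompactSupport.intro
    (isBounded_openRectangle !₂[0, 0] L H).isCompact_closure
    fun p hp => hu0 p fun hm => hp (subset_closure hm)
  have hF (n : ℕ) : Continuous fun x => ∫ y in 0..H, u !₂[x, y] * sineMode H n y := by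
    refine intervalIntegral.continuous_parametric_intervalIntegral_of_continuous'
      (f := fun x y => u !₂[x, y] * sineMode H n y) ?_ _ _
    exact (hu.comp hvec).mul ((continuous_sineMode H n).comp continuous_snd)
  have hslice : ∀ n, 0 < n → ∀ x ∈ Set.Ioo 0 L, ∫ y in 0..H, u !₂[x, y] * sineMode H n y = 0 := by
    intro n hn
    refine eq_zero_of_integral_mul_sineMode_eq_zero hL (hF n) fun m hm => ?_
    have hi : Integrable fun p => u p * rectangleMode L H m n p :=
      (hu.mul (continuous_rectangleMode L H m n)).integrable_of_hasCompactSupport hcs.mul_right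
    have h1 := h m n hm hn
    rw [integral_plane hi, integral_eq_interval_of_support hL.le] at h1
    · refine Eq.trans ?_ h1
      refine intervalIntegral.integral_congr fun x _ => ?_
      rw [integral_eq_interval_of_support hH.le, ← intervalIntegral.integral_mul_const]
      · refine intervalIntegral.integral_congr fun y _ => ?_
        simp only [rectangleMode, Matrix.cons_val_zero, Matrix.cons_val_one]
        ring
      · intro y hy
        rw [hu0 _ fun hm => hy (by simpa using (mem_openRectangle_zero.1 hm).2), zero_mul]
    · intro x hx
      have : ∀ y, u !₂[x, y] = 0 := fun y =>
        hu0 _ fun hm => hx (by simpa using (mem_openRectangle_zero.1 hm).1)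
      simp [this]
  ext p
  by_cases hp : p ∈ openRectangle !₂[0, 0] L H
  · rw [mem_openRectangle_zero] at hp
    have hc : Continuous fun y => u !₂[p 0, y] :=
      hu.comp (hvec.comp (continuous_const.prodMk continuous_id))
    have h2 := eq_zero_of_integral_mul_sineMode_eq_zero hH hc
      (fun n hn => hslice n hn (p 0) hp.1) (p 1) hp.2
    have e : (!₂[p 0, p 1] : Plane) = p := by ext i; fin_cases i <;> simp
    rwa [e] at h2
  · exact hu0 p hp

theorem setIntegral_rectangleMode_mul (L H : ℝ) (m n m' n' : ℕ) :
    ∫ p in openRectangle !₂[0, 0] L H, rectangleMode L H m n p * rectangleMode L H m' n' p =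
      (∫ x in Set.Ioo 0 L, sineMode L m x * sineMode L m' x) *
        ∫ y in Set.Ioo 0 H, sineMode H n y * sineMode H n' y := by
  rw [← setIntegral_openRectangle_mul_coord L H (fun x => sineMode L m x * sineMode L m' x)
    (fun y => sineMode H n y * sineMode H n' y)]
  refine setIntegral_congr_fun (isOpen_openRectangle _ _ _).measurableSet fun p _ => ?_
  simp only [rectangleMode]; ring

theorem isDirichletSystem_rectangle {L H : ℝ} (hL : 0 < L) (hH : 0 < H) :
    IsDirichletSystem (ι := {q : ℕ × ℕ // 0 < q.1 ∧ 0 < q.2}) (openRectangle !₂[0, 0] L H)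
      (fun q => rectangleMode L H q.1.1 q.1.2)
      (fun q => (q.1.1 * (Real.pi / L)) ^ 2 + (q.1.2 * (Real.pi / H)) ^ 2) where
  contDiff q := contDiff_rectangleMode _ _ _ _
  eq_zero q p hp := by
    rw [mem_frontier_openRectangle hL hH] at hp
    unfold rectangleMode
    rcases hp.2 with h | h | h | h <;>
      simp [h, sineMode_zero_right, sineMode_self hL.ne', sineMode_self hH.ne']
  eigen q p _ := by
    rw [laplacian_rectangleMode]; ring
  orthogonal q r hqr := by
    rw [setIntegral_rectangleMode_mul]
    by_cases h1 : q.1.1 = r.1.1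
    · have h2 : q.1.2 ≠ r.1.2 := fun h2 => hqr (Subtype.ext (Prod.ext h1 h2))
      rw [setIntegral_sineMode_mul_ne hH h2, mul_zero]
    · rw [setIntegral_sineMode_mul_ne hL h1, zero_mul]
  norm_ne q := by
    rw [setIntegral_rectangleMode_mul]
    exact (mul_pos (setIntegral_sineMode_sq_pos hL q.2.1)
      (setIntegral_sineMode_sq_pos hH q.2.2)).ne'
  complete u hu hu0 h :=
    eq_zero_of_integral_mul_rectangleMode hL hH hu hu0 fun m n hm hn => h ⟨(m, n), hm, hn⟩

/-! ### The eigenfunctions of a right isosceles triangle -/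

/-- The reflection of the square `(0, L) × (0, L)` in the diagonal `x + y = L`. -/
noncomputable def reflectDiagonal (L : ℝ) (p : Plane) : Plane := !₂[L - p 1, L - p 0]

theorem continuous_reflectDiagonal (L : ℝ) : Continuous (reflectDiagonal L) := by
  unfold reflectDiagonal; fun_prop

@[simp] theorem reflectDiagonal_zero (L : ℝ) (p : Plane) : reflectDiagonal L p 0 = L - p 1 := by
  simp [reflectDiagonal]

@[simp] theorem reflectDiagonal_one (L : ℝ) (p : Plane) : reflectDiagonal L p 1 = L - p 0 := by
  simp [reflectDiagonal]

@[simp] theorem reflectDiagonal_reflectDiagonal (L : ℝ) (p : Plane) :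
    reflectDiagonal L (reflectDiagonal L p) = p := by
  ext i; fin_cases i <;> simp

/-- The reflection is the coordinate swap combined with z ↦ (L, L) - z, and both preserve area. -/
theorem integral_comp_reflectDiagonal (L : ℝ) (f : Plane → ℝ) :
    ∫ p, f (reflectDiagonal L p) = ∫ p, f p := by
  rw [integral_plane_eq_integral_prod, integral_plane_eq_integral_prod]
  have h1 := integral_sub_left_eq_self (fun z : ℝ × ℝ => f !₂[z.2, z.1]) volume ((L, L) : ℝ × ℝ)
  have h2 := integral_prod_swap (μ := volume) (ν := volume) (fun z : ℝ × ℝ => f !₂[z.1, z.2])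
  refine Eq.trans ?_ (h1.trans h2)
  simp [reflectDiagonal]

/-- The eigenfunction of the triangle with legs of length `L` with indices `m`, `n`. -/
noncomputable def triangleMode (L : ℝ) (m n : ℕ) (p : Plane) : ℝ :=
  rectangleMode L L m n p - rectangleMode L L m n (reflectDiagonal L p)

theorem rectangleMode_reflectDiagonal {L : ℝ} (hL : L ≠ 0) (m n : ℕ) (p : Plane) :
    rectangleMode L L m n (reflectDiagonal L p) = (-1) ^ (m + n) * rectangleMode L L n m p := by
  simp only [rectangleMode, reflectDiagonal_zero, reflectDiagonal_one, sineMode_sub hL]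
  ring

theorem triangleMode_eq {L : ℝ} (hL : L ≠ 0) (m n : ℕ) (p : Plane) :
    triangleMode L m n p =
      rectangleMode L L m n p - (-1) ^ (m + n) * rectangleMode L L n m p := by
  rw [triangleMode, rectangleMode_reflectDiagonal hL]

theorem triangleMode_self {L : ℝ} (hL : L ≠ 0) (n : ℕ) (p : Plane) :
    triangleMode L n n p = 0 := by
  rw [triangleMode_eq hL, ← two_mul, pow_mul]; simp

/-- Together with the vanishing for equal indices, this shows that the pairs n < m exhaust the
triangle modes up to sign. -/
theorem triangleMode_swap {L : ℝ} (hL : L ≠ 0) (m n : ℕ) (p : Plane) :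
    triangleMode L m n p = -((-1) ^ (m + n) * triangleMode L n m p) := by
  rw [triangleMode_eq hL, triangleMode_eq hL, add_comm n m]
  have : ((-1 : ℝ) ^ (m + n)) * (-1) ^ (m + n) = 1 := by
    rw [← mul_pow]; simp
  linear_combination (-rectangleMode L L m n p) * this

theorem triangleMode_reflectDiagonal (L : ℝ) (m n : ℕ) (p : Plane) :
    triangleMode L m n (reflectDiagonal L p) = -triangleMode L m n p := by
  simp [triangleMode]

theorem contDiff_triangleMode {L : ℝ} (hL : L ≠ 0) (m n : ℕ) {k : WithTop ℕ∞} :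
    ContDiff ℝ k (triangleMode L m n) := by
  rw [funext (triangleMode_eq hL m n)]
  exact (contDiff_rectangleMode _ _ _ _).sub (contDiff_const.mul (contDiff_rectangleMode _ _ _ _))

theorem laplacian_triangleMode {L : ℝ} (hL : L ≠ 0) (m n : ℕ) (p : Plane) :
    Δ (triangleMode L m n) p =
      -(((m * (Real.pi / L)) ^ 2 + (n * (Real.pi / L)) ^ 2) * triangleMode L m n p) := by
  have e : triangleMode L m n =
      rectangleMode L L m n - ((-1 : ℝ) ^ (m + n)) • rectangleMode L L n m :=
    funext (triangleMode_eq hL m n)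
  have hc (m n : ℕ) : ContDiffAt ℝ 2 (rectangleMode L L m n) p :=
    (contDiff_rectangleMode _ _ _ _).contDiffAt
  have hs : ContDiffAt ℝ 2 (((-1 : ℝ) ^ (m + n)) • rectangleMode L L n m) p :=
    contDiffAt_const.smul (hc n m)
  rw [e, (hc m n).laplacian_sub hs,
    InnerProductSpace.laplacian_smul _ (hc n m), laplacian_rectangleMode, laplacian_rectangleMode]
  simp only [Pi.sub_apply, Pi.smul_apply, smul_eq_mul]
  ring

/-- Antisymmetrisation under the reflection is self-adjoint, because the reflection is an
area-preserving involution. -/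
theorem integral_mul_triangleMode {L : ℝ} {u : Plane → ℝ} (m n : ℕ)
    (hu : ∀ φ : Plane → ℝ, Continuous φ → Integrable fun p => u p * φ p)
    (hu' : ∀ φ : Plane → ℝ, Continuous φ → Integrable fun p => u (reflectDiagonal L p) * φ p) :
    ∫ p, (u p - u (reflectDiagonal L p)) * rectangleMode L L m n p =
      ∫ p, u p * triangleMode L m n p := by
  have hr := continuous_rectangleMode L L m n
  have h1 := integral_comp_reflectDiagonal L
    fun p => u p * rectangleMode L L m n (reflectDiagonal L p)
  simp only [reflectDiagonal_reflectDiagonal] at h1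
  simp only [sub_mul, triangleMode, mul_sub]
  rw [integral_sub (hu _ hr) (hu' _ hr),
    integral_sub (hu _ hr) (hu (fun p => rectangleMode L L m n (reflectDiagonal L p))
      (hr.comp (continuous_reflectDiagonal L))), h1]

theorem mem_openRightIsoscelesTriangle_zero {L : ℝ} {p : Plane} :
    p ∈ openRightIsoscelesTriangle !₂[0, 0] L ↔ 0 < p 0 ∧ 0 < p 1 ∧ p 0 + p 1 < L := by
  simp [openRightIsoscelesTriangle]

/-- The odd extension of u across the hypotenuse is orthogonal to every mode of the square, so it
vanishes; on the triangle itself the reflected term is zero and the extension is u. -/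
theorem eq_zero_of_integral_mul_triangleMode {L : ℝ} (hL : 0 < L) {u : Plane → ℝ}
    (hu : Continuous u) (hu0 : ∀ p ∉ openRightIsoscelesTriangle !₂[0, 0] L, u p = 0)
    (h : ∀ m n, 0 < n → n < m → ∫ p, u p * triangleMode L m n p = 0) : u = 0 := by
  have hρ := continuous_reflectDiagonal L
  have hrect : ∀ p ∈ openRightIsoscelesTriangle !₂[0, 0] L, p ∈ openRectangle !₂[0, 0] L L ∧
      reflectDiagonal L p ∉ openRightIsoscelesTriangle !₂[0, 0] L ∧
      reflectDiagonal L p ∈ openRectangle !₂[0, 0] L L := by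
    intro p hp
    rw [mem_openRightIsoscelesTriangle_zero] at hp
    obtain ⟨h1, h2, h3⟩ := hp
    rw [mem_openRectangle_zero, mem_openRectangle_zero, mem_openRightIsoscelesTriangle_zero]
    simp only [reflectDiagonal_zero, reflectDiagonal_one, Set.mem_Ioo]
    refine ⟨⟨⟨by linarith, by linarith⟩, by linarith, by linarith⟩, ?_,
      ⟨by linarith, by linarith⟩, by linarith, by linarith⟩
    rintro ⟨-, -, h4⟩
    linarith
  have hcs : HasCompactSupport u := HasCompactSupport.intro
    (isBounded_openRightIsoscelesTriangle !₂[0, 0] L).isCompact_closure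
    fun p hp => hu0 p fun hm => hp (subset_closure hm)
  have hout : ∀ p ∉ openRectangle !₂[0, 0] L L, u p = 0 ∧ u (reflectDiagonal L p) = 0 := by
    intro p hp
    refine ⟨hu0 p fun hm => hp (hrect p hm).1, hu0 _ fun hm => hp ?_⟩
    simpa using (hrect _ hm).2.2
  have hcs' : HasCompactSupport fun p => u (reflectDiagonal L p) := HasCompactSupport.intro
    (isBounded_openRectangle !₂[0, 0] L L).isCompact_closure
    fun p hp => (hout p fun hm => hp (subset_closure hm)).2
  have hdiff : (fun p => u p - u (reflectDiagonal L p)) = 0 := by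
    refine eq_zero_of_integral_mul_rectangleMode hL hL (hu.sub (hu.comp hρ)) ?_ ?_
    · intro p hp
      rw [(hout p hp).1, (hout p hp).2, sub_zero]
    · intro m n hm hn
      rw [integral_mul_triangleMode m n
        (fun φ hφ => (hu.mul hφ).integrable_of_hasCompactSupport hcs.mul_right)
        (fun φ hφ => ((hu.comp hρ).mul hφ).integrable_of_hasCompactSupport hcs'.mul_right)]
      rcases lt_trichotomy m n with hlt | rfl | hlt
      · have e : ∀ p, u p * triangleMode L m n p =
            -(-1) ^ (m + n) * (u p * triangleMode L n m p) := fun p => by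
          rw [triangleMode_swap hL.ne' m n]; ring
        simp only [e]
        rw [integral_const_mul, h n m hm hlt, mul_zero]
      · simp [triangleMode_self hL.ne']
      · exact h m n hn hlt
  ext p
  by_cases hp : p ∈ openRightIsoscelesTriangle !₂[0, 0] L
  · have := congrFun hdiff p
    simpa [hu0 _ (hrect p hp).2.1] using this
  · exact hu0 p hp

/-- Unfolds an integral over the triangle to the square: a triangle mode is odd under the
reflection, so cutting it off to the triangle and antisymmetrising restores it on the whole square.
-/
theorem setIntegral_triangleMode_mul {L : ℝ} (hL : 0 < L) (m n m' n' : ℕ) :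
    ∫ p in openRightIsoscelesTriangle !₂[0, 0] L, triangleMode L m n p * triangleMode L m' n' p =
      ∫ p in openRectangle !₂[0, 0] L L, triangleMode L m n p * rectangleMode L L m' n' p := by
  set T := openRightIsoscelesTriangle !₂[0, 0] L with hT
  have hTm : MeasurableSet T := (isOpen_openRightIsoscelesTriangle _ _).measurableSet
  have hρ := continuous_reflectDiagonal L
  have hφc : Continuous (triangleMode L m n) := (contDiff_triangleMode hL.ne' m n (k := 0)).continuous
  have hb := (isBounded_openRightIsoscelesTriangle !₂[0, 0] L).isCompact_closure
  have hInt (φ : Plane → ℝ) (hφ : Continuous φ) :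
      Integrable fun p => T.indicator (triangleMode L m n) p * φ p := by
    have : (fun p => T.indicator (triangleMode L m n) p * φ p)
        = T.indicator fun p => triangleMode L m n p * φ p := by
      ext p; exact (Set.indicator_mul_left _ _ _).symm
    rw [this, integrable_indicator_iff hTm]
    exact ((hφc.mul hφ).continuousOn.integrableOn_compact hb).mono_set subset_closure
  have hInt' (φ : Plane → ℝ) (hφ : Continuous φ) :
      Integrable fun p => T.indicator (triangleMode L m n) (reflectDiagonal L p) * φ p := by
    have e1 : (fun p => T.indicator (triangleMode L m n) (reflectDiagonal L p) * φ p)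
        = (reflectDiagonal L ⁻¹' T).indicator
          fun p => triangleMode L m n (reflectDiagonal L p) * φ p := by
      ext p
      by_cases hp : reflectDiagonal L p ∈ T
      · rw [Set.indicator_of_mem hp, Set.indicator_of_mem (Set.mem_preimage.2 hp)]
      · rw [Set.indicator_of_notMem hp, zero_mul,
          Set.indicator_of_notMem (s := reflectDiagonal L ⁻¹' T) (fun h => hp h)]
    rw [e1, integrable_indicator_iff (hρ.measurable hTm)]
    refine (((hφc.comp hρ).mul hφ).continuousOn.integrableOn_compact
      (hb.image hρ)).mono_set fun p hp => ⟨reflectDiagonal L p, subset_closure hp, by simp⟩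
  have key := integral_mul_triangleMode (L := L) m' n' hInt hInt'
  rw [← integral_indicator hTm, ← integral_indicator (isOpen_openRectangle _ _ _).measurableSet]
  refine Eq.trans (integral_congr_ae (Eventually.of_forall fun p => ?_))
    (key.symm.trans (integral_congr_ae (Eventually.of_forall fun p => ?_)))
  · exact Set.indicator_mul_left _ _ _
  · dsimp only
    by_cases h1 : p ∈ T <;> by_cases h2 : reflectDiagonal L p ∈ T
    · rw [hT, mem_openRightIsoscelesTriangle_zero] at h1 h2
      simp only [reflectDiagonal_zero, reflectDiagonal_one] at h2
      linarith [h1.2.2, h2.2.2]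
    · have h3 : p ∈ openRectangle !₂[0, 0] L L := by
        rw [hT, mem_openRightIsoscelesTriangle_zero] at h1
        rw [mem_openRectangle_zero]
        exact ⟨⟨h1.1, by linarith [h1.2.1, h1.2.2]⟩, h1.2.1, by linarith [h1.1, h1.2.2]⟩
      rw [Set.indicator_of_mem h1, Set.indicator_of_notMem h2, Set.indicator_of_mem h3, sub_zero]
    · have h3 : p ∈ openRectangle !₂[0, 0] L L := by
        rw [hT, mem_openRightIsoscelesTriangle_zero] at h2
        simp only [reflectDiagonal_zero, reflectDiagonal_one] at h2
        rw [mem_openRectangle_zero]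
        refine ⟨⟨?_, ?_⟩, ?_, ?_⟩ <;> linarith [h2.1, h2.2.1, h2.2.2]
      rw [Set.indicator_of_notMem h1, Set.indicator_of_mem h2, Set.indicator_of_mem h3,
        triangleMode_reflectDiagonal]
      ring
    · rw [Set.indicator_of_notMem h1, Set.indicator_of_notMem h2, sub_zero, zero_mul]
      by_cases h3 : p ∈ openRectangle !₂[0, 0] L L
      -- The remaining points of the square lie on the diagonal, which the reflection fixes, so the
      -- mode is zero there.
      · have h4 : p 0 + p 1 = L := by
          rw [mem_openRectangle_zero] at h3
          rw [hT, mem_openRightIsoscelesTriangle_zero] at h1 h2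
          simp only [reflectDiagonal_zero, reflectDiagonal_one] at h2
          by_contra hne
          rcases lt_or_gt_of_ne hne with hlt | hlt
          · exact h1 ⟨h3.1.1, h3.2.1, hlt⟩
          · exact h2 ⟨by linarith [h3.2.2], by linarith [h3.1.2], by linarith⟩
        have h5 : reflectDiagonal L p = p := by
          ext i; fin_cases i <;> simp <;> linarith
        rw [Set.indicator_of_mem h3, triangleMode, h5, sub_self, zero_mul]
      · rw [Set.indicator_of_notMem h3]

theorem isDirichletSystem_triangle {L : ℝ} (hL : 0 < L) :
    IsDirichletSystem (ι := {q : ℕ × ℕ // 0 < q.2 ∧ q.2 < q.1})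
      (openRightIsoscelesTriangle !₂[0, 0] L)
      (fun q => triangleMode L q.1.1 q.1.2)
      (fun q => (q.1.1 * (Real.pi / L)) ^ 2 + (q.1.2 * (Real.pi / L)) ^ 2) := by
  have hsys := isDirichletSystem_rectangle hL hL
  have hzero : ∀ m n m' n', 0 < m → 0 < n → 0 < m' → 0 < n' → (m, n) ≠ (m', n') →
      ∫ p in openRectangle !₂[0, 0] L L, rectangleMode L L m n p * rectangleMode L L m' n' p = 0 :=
    fun m n m' n' hm hn hm' hn' hne => hsys.orthogonal ⟨(m, n), hm, hn⟩ ⟨(m', n'), hm', hn'⟩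
      fun h => hne (congrArg Subtype.val h)
  have hInt : ∀ m n m' n', IntegrableOn
      (fun p => rectangleMode L L m n p * rectangleMode L L m' n' p)
      (openRectangle !₂[0, 0] L L) := fun m n m' n' =>
    (((continuous_rectangleMode L L m n).mul
      (continuous_rectangleMode L L m' n')).continuousOn.integrableOn_compact
      (isBounded_openRectangle _ _ _).isCompact_closure).mono_set subset_closure
  have hinner : ∀ q r : {q : ℕ × ℕ // 0 < q.2 ∧ q.2 < q.1},
      ∫ p in openRightIsoscelesTriangle !₂[0, 0] L,
        triangleMode L q.1.1 q.1.2 p * triangleMode L r.1.1 r.1.2 p =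
      ∫ p in openRectangle !₂[0, 0] L L,
        rectangleMode L L q.1.1 q.1.2 p * rectangleMode L L r.1.1 r.1.2 p := by
    intro q r
    rw [setIntegral_triangleMode_mul hL]
    simp only [triangleMode_eq hL.ne', sub_mul, mul_assoc]
    -- The cross term pairs a square mode with first index below the second with one ordered the
    -- other way, so it vanishes and the inner product is that of two square modes.
    rw [integral_sub (hInt _ _ _ _) ((hInt _ _ _ _).const_mul _), integral_const_mul,
      hzero q.1.2 q.1.1 r.1.1 r.1.2 q.2.1 (q.2.1.trans q.2.2) (r.2.1.trans r.2.2) r.2.1,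
      mul_zero, sub_zero]
    intro h
    have h1 := congrArg Prod.fst h
    have h2 := congrArg Prod.snd h
    have := q.2.2
    have := r.2.2
    simp only at h1 h2
    omega
  exact {
    contDiff := fun q => contDiff_triangleMode hL.ne' _ _
    eq_zero := fun q p hp => by
      rw [mem_frontier_openRightIsoscelesTriangle hL] at hp
      have h := hp.2
      simp only [Matrix.cons_val_zero, Matrix.cons_val_one, sub_zero] at h
      rcases h with h | h | h
      · simp [triangleMode, rectangleMode, h, sineMode_zero_right, sineMode_self hL.ne']
      · simp [triangleMode, rectangleMode, h, sineMode_zero_right, sineMode_self hL.ne']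
      · have h5 : reflectDiagonal L p = p := by
          ext i; fin_cases i <;> simp <;> linarith
        rw [triangleMode, h5, sub_self]
    eigen := fun q p _ => by rw [laplacian_triangleMode hL.ne']; ring
    orthogonal := fun q r hqr => by
      rw [hinner]
      exact hzero _ _ _ _ (q.2.1.trans q.2.2) q.2.1 (r.2.1.trans r.2.2) r.2.1
        fun h => hqr (Subtype.ext h)
    norm_ne := fun q => by
      rw [hinner]
      exact hsys.norm_ne ⟨q.1, q.2.1.trans q.2.2, q.2.1⟩
    complete := fun u hu hu0 h => eq_zero_of_integral_mul_triangleMode hL hu hu0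
      fun m n hn hmn => h ⟨(m, n), hn, hmn⟩ }

/-! ### Multiplicities -/

/-- Indices of the eigenfunctions of a rectangle. -/
abbrev RectangleIndex : Type := {q : ℕ × ℕ // 0 < q.1 ∧ 0 < q.2}

/-- Indices of the eigenfunctions of a right isosceles triangle. -/
abbrev TriangleIndex : Type := {q : ℕ × ℕ // 0 < q.2 ∧ q.2 < q.1}

theorem finite_setOf_sq_add_sq_eq {ι : Type} {f : ι → ℕ × ℕ} (hf : Function.Injective f)
    {a b : ℝ} (ha : 0 < a) (hb : 0 < b) (μ : ℝ) :
    {i | ((f i).1 * a) ^ 2 + ((f i).2 * b) ^ 2 = μ}.Finite := by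
  -- Since m ≤ m² for natural numbers, a bound without square roots is enough for finiteness.
  have key : ∀ (m : ℕ) (c : ℝ), 0 < c → (m * c) ^ 2 ≤ μ → m ≤ ⌊μ / c ^ 2⌋₊ := by
    intro m c hc h
    refine Nat.le_floor ?_
    rw [le_div_iff₀ (by positivity)]
    refine le_trans ?_ h
    rw [mul_pow]
    refine mul_le_mul_of_nonneg_right ?_ (by positivity)
    rcases Nat.eq_zero_or_pos m with rfl | hm
    · simp
    · have : (1 : ℝ) ≤ m := by exact_mod_cast hm
      nlinarith
  refine ((Set.finite_Iic (⌊μ / a ^ 2⌋₊, ⌊μ / b ^ 2⌋₊)).preimage hf.injOn).subset fun i hi => ?_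
  have hi' : ((f i).1 * a) ^ 2 + ((f i).2 * b) ^ 2 = μ := hi
  exact ⟨key _ a ha (by nlinarith [sq_nonneg ((f i).2 * b)]),
    key _ b hb (by nlinarith [sq_nonneg ((f i).1 * a)])⟩

theorem rank_dirichletEigenspace_rectangle {L H : ℝ} (hL : 0 < L) (hH : 0 < H) (μ : ℝ) :
    Module.rank ℝ (dirichletEigenspace
      ⟨openRectangle !₂[0, 0] L H, isOpen_openRectangle _ _ _⟩ μ) =
      Cardinal.mk {q : RectangleIndex //
        (q.1.1 * (Real.pi / L)) ^ 2 + (q.1.2 * (Real.pi / H)) ^ 2 = μ} :=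
  IsDirichletSystem.rank_eigenspace (isDirichletSystem_rectangle hL hH)
    (convex_openRectangle _ _ _) (isBounded_openRectangle _ _ _) μ
    (finite_setOf_sq_add_sq_eq Subtype.val_injective (div_pos Real.pi_pos hL)
      (div_pos Real.pi_pos hH) μ)

theorem openRightIsoscelesTriangle_eq_preimage (a : Plane) (L : ℝ) :
    openRightIsoscelesTriangle a L = (· + -a) ⁻¹' openRightIsoscelesTriangle !₂[0, 0] L := by
  ext p
  rw [Set.mem_preimage, mem_openRightIsoscelesTriangle_zero]
  simp [openRightIsoscelesTriangle, sub_eq_add_neg]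

theorem rank_dirichletEigenspace_triangle (a : Plane) {L : ℝ} (hL : 0 < L) (μ : ℝ) :
    Module.rank ℝ (dirichletEigenspace
      ⟨openRightIsoscelesTriangle a L, isOpen_openRightIsoscelesTriangle _ _⟩ μ) =
      Cardinal.mk {q : TriangleIndex //
        (q.1.1 * (Real.pi / L)) ^ 2 + (q.1.2 * (Real.pi / L)) ^ 2 = μ} := by
  rw [← (dirichletEigenspaceTranslateEquiv
    (A := ⟨openRightIsoscelesTriangle !₂[0, 0] L, isOpen_openRightIsoscelesTriangle _ _⟩)
    (openRightIsoscelesTriangle_eq_preimage a L) μ).rank_eq]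
  exact IsDirichletSystem.rank_eigenspace (isDirichletSystem_triangle hL)
    (convex_openRightIsoscelesTriangle _ _) (isBounded_openRightIsoscelesTriangle _ _) μ
    (finite_setOf_sq_add_sq_eq Subtype.val_injective (div_pos Real.pi_pos hL)
      (div_pos Real.pi_pos hL) μ)

/-- The matching of the eigenfunctions of the two domains, on the level of indices. -/
def chapmanIndexEquiv : RectangleIndex ⊕ TriangleIndex ≃ RectangleIndex ⊕ TriangleIndex where
  toFun
    -- The square modes fill the rectangle modes with even first index.
    | .inl ⟨(m, n), h⟩ => .inl ⟨(2 * m, n), by dsimp only at h ⊢; omega⟩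
    | .inr ⟨(m, n), h⟩ =>
      -- Equal parity: with a = (m + n)/2 and b = (m - n)/2 one has m² + n² = 2(a² + b²).
      if h1 : m % 2 = n % 2 then
        .inr ⟨((m + n) / 2, (m - n) / 2), by dsimp only at h ⊢; omega⟩
      -- Opposite parity: the odd entry becomes the first index, half of the even entry the second.
      else if h2 : n % 2 = 0 then .inl ⟨(m, n / 2), by dsimp only at h ⊢; omega⟩
      else .inl ⟨(n, m / 2), by dsimp only at h ⊢; omega⟩
  invFun
    | .inl ⟨(m, n), h⟩ =>
      if h1 : m % 2 = 0 then .inl ⟨(m / 2, n), by dsimp only at h ⊢; omega⟩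
      -- The triangle index lists the larger entry first; m is odd, so m and 2n never coincide.
      else if h2 : 2 * n < m then .inr ⟨(m, 2 * n), by dsimp only at h ⊢; omega⟩
      else .inr ⟨(2 * n, m), by dsimp only at h ⊢; omega⟩
    | .inr ⟨(m, n), h⟩ => .inr ⟨(m + n, m - n), by dsimp only at h ⊢; omega⟩
  left_inv := by
    rintro (⟨⟨m, n⟩, h⟩ | ⟨⟨m, n⟩, h⟩)
    · simp
    · dsimp only at h ⊢
      split_ifs with h1 h2
      · simp only [Sum.inr.injEq, Subtype.mk.injEq, Prod.mk.injEq]; omega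
      · dsimp only
        rw [dif_neg (by omega), dif_pos (by omega)]
        simp only [Sum.inr.injEq, Subtype.mk.injEq, Prod.mk.injEq, true_and]; omega
      · dsimp only
        rw [dif_neg (by omega), dif_neg (by omega)]
        simp only [Sum.inr.injEq, Subtype.mk.injEq, Prod.mk.injEq, and_true]; omega
  right_inv := by
    rintro (⟨⟨m, n⟩, h⟩ | ⟨⟨m, n⟩, h⟩)
    · dsimp only at h ⊢
      split_ifs with h1 h2
      · dsimp only
        simp only [Sum.inl.injEq, Subtype.mk.injEq, Prod.mk.injEq, and_true]; omega
      · dsimp only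
        rw [dif_neg (by omega), dif_pos (by omega)]
        simp only [Sum.inl.injEq, Subtype.mk.injEq, Prod.mk.injEq, true_and]; omega
      · dsimp only
        rw [dif_neg (by omega), dif_neg (by omega)]
        simp only [Sum.inl.injEq, Subtype.mk.injEq, Prod.mk.injEq, true_and]; omega
    · dsimp only at h ⊢
      rw [dif_pos (by omega)]
      simp only [Sum.inr.injEq, Subtype.mk.injEq, Prod.mk.injEq]; omega

/-- The four expressions are the eigenvalues of the four pieces in units of (π/2)². -/
theorem chapmanIndexEquiv_spec (x : RectangleIndex ⊕ TriangleIndex) :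
    Sum.elim (fun q : RectangleIndex => (q.1.1 : ℝ) ^ 2 + (2 * q.1.2) ^ 2)
      (fun q : TriangleIndex => 2 * ((q.1.1 : ℝ) ^ 2 + q.1.2 ^ 2)) (chapmanIndexEquiv x) =
    Sum.elim (fun q : RectangleIndex => (2 * q.1.1 : ℝ) ^ 2 + (2 * q.1.2) ^ 2)
      (fun q : TriangleIndex => (q.1.1 : ℝ) ^ 2 + q.1.2 ^ 2) x := by
  rcases x with ⟨⟨m, n⟩, h⟩ | ⟨⟨m, n⟩, h⟩
  · simp [chapmanIndexEquiv]
  · dsimp only at h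
    simp only [chapmanIndexEquiv, Equiv.coe_fn_mk]
    split_ifs with h1 h2
    · obtain ⟨k, rfl⟩ : ∃ k, m = n + 2 * k := ⟨(m - n) / 2, by omega⟩
      have e1 : (n + 2 * k + n) / 2 = n + k := by omega
      have e2 : (n + 2 * k - n) / 2 = k := by omega
      simp only [Sum.elim_inr, e1, e2]
      push_cast; ring
    · obtain ⟨k, rfl⟩ : ∃ k, n = 2 * k := ⟨n / 2, by omega⟩
      have e1 : 2 * k / 2 = k := by omega
      simp only [Sum.elim_inl, Sum.elim_inr, e1]
      push_cast; ring
    · obtain ⟨k, rfl⟩ : ∃ k, m = 2 * k := ⟨m / 2, by omega⟩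
      have e1 : 2 * k / 2 = k := by omega
      simp only [Sum.elim_inl, Sum.elim_inr, e1]
      push_cast; ring

theorem mk_add_mk_subtype {α β : Type} (f : α → ℝ) (g : β → ℝ) (c : ℝ) :
    Cardinal.mk {a // f a = c} + Cardinal.mk {b // g b = c} =
      Cardinal.mk {x : α ⊕ β // Sum.elim f g x = c} := by
  rw [Cardinal.add_def]
  exact Cardinal.mk_congr (Equiv.subtypeSum (p := fun x => Sum.elim f g x = c)).symm

theorem disjoint_closure_rectangle_triangle {W D L : ℝ} (hW : 0 < W) (hD : 0 < D) (hL : 0 < L)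
    (h3 : W < 3) : Disjoint (closure (openRectangle !₂[0, 0] W D))
      (closure (openRightIsoscelesTriangle !₂[3, 0] L)) := by
  rw [closure_openRectangle _ hW hD, closure_openRightIsoscelesTriangle _ hL, Set.disjoint_left]
  rintro p ⟨-, h1, -⟩ ⟨h2, -⟩
  simp only [Matrix.cons_val_zero] at h1 h2
  linarith

theorem rank_dirichletEigenspace_chapman₁ (μ : ℝ) :
    Module.rank ℝ (dirichletEigenspace chapman₁ μ) =
      Cardinal.mk {x : RectangleIndex ⊕ TriangleIndex //
        Sum.elim (fun q : RectangleIndex => (2 * q.1.1 : ℝ) ^ 2 + (2 * q.1.2) ^ 2)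
          (fun q : TriangleIndex => (q.1.1 : ℝ) ^ 2 + q.1.2 ^ 2) x = μ / (Real.pi / 2) ^ 2} := by
  have hpi := Real.pi_pos
  rw [← mk_add_mk_subtype, rank_dirichletEigenspace_union
    (A := ⟨_, isOpen_openRectangle !₂[0, 0] 1 1⟩)
    (B := ⟨_, isOpen_openRightIsoscelesTriangle !₂[3, 0] 2⟩) rfl
    (disjoint_closure_rectangle_triangle one_pos one_pos two_pos (by norm_num)),
    rank_dirichletEigenspace_rectangle one_pos one_pos,
    rank_dirichletEigenspace_triangle _ two_pos]
  congr 1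
  · refine Cardinal.mk_congr (Equiv.subtypeEquivRight fun q => ?_)
    rw [eq_div_iff (by positivity)]
    refine Eq.congr ?_ rfl
    ring
  · refine Cardinal.mk_congr (Equiv.subtypeEquivRight fun q => ?_)
    rw [eq_div_iff (by positivity)]
    refine Eq.congr ?_ rfl
    ring

theorem rank_dirichletEigenspace_chapman₂ (μ : ℝ) :
    Module.rank ℝ (dirichletEigenspace chapman₂ μ) =
      Cardinal.mk {x : RectangleIndex ⊕ TriangleIndex //
        Sum.elim (fun q : RectangleIndex => (q.1.1 : ℝ) ^ 2 + (2 * q.1.2) ^ 2)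
          (fun q : TriangleIndex => 2 * ((q.1.1 : ℝ) ^ 2 + q.1.2 ^ 2)) x =
            μ / (Real.pi / 2) ^ 2} := by
  have hpi := Real.pi_pos
  have h2 : (0 : ℝ) < √2 := by positivity
  rw [← mk_add_mk_subtype, rank_dirichletEigenspace_union
    (A := ⟨_, isOpen_openRectangle !₂[0, 0] 2 1⟩)
    (B := ⟨_, isOpen_openRightIsoscelesTriangle !₂[3, 0] (√2)⟩) rfl
    (disjoint_closure_rectangle_triangle two_pos one_pos h2 (by norm_num)),
    rank_dirichletEigenspace_rectangle two_pos one_pos,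
    rank_dirichletEigenspace_triangle _ h2]
  congr 1
  · refine Cardinal.mk_congr (Equiv.subtypeEquivRight fun q => ?_)
    rw [eq_div_iff (by positivity)]
    refine Eq.congr ?_ rfl
    ring
  · refine Cardinal.mk_congr (Equiv.subtypeEquivRight fun q => ?_)
    rw [eq_div_iff (by positivity)]
    refine Eq.congr ?_ rfl
    rw [mul_pow, mul_pow, div_pow, Real.sq_sqrt (by norm_num)]
    ring

theorem dirichletIsospectral_chapman : DirichletIsospectral chapman₁ chapman₂ := by
  intro μ
  rw [rank_dirichletEigenspace_chapman₁, rank_dirichletEigenspace_chapman₂]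
  exact Cardinal.mk_congr (chapmanIndexEquiv.subtypeEquiv fun x => by rw [chapmanIndexEquiv_spec])

theorem rank_dirichletEigenspace_chapman₁_zero :
    Module.rank ℝ (dirichletEigenspace chapman₁ 0) = 0 := by
  rw [rank_dirichletEigenspace_chapman₁, Cardinal.mk_eq_zero_iff, zero_div]
  refine ⟨fun ⟨x, hx⟩ => ?_⟩
  rcases x with ⟨⟨m, n⟩, h⟩ | ⟨⟨m, n⟩, h⟩
  · have : (0 : ℝ) < m := by exact_mod_cast h.1
    simp only [Sum.elim_inl] at hx
    exact absurd hx (by positivity)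
  · have : (0 : ℝ) < n := by exact_mod_cast h.1
    simp only [Sum.elim_inr] at hx
    exact absurd hx (by positivity)

theorem rank_dirichletEigenspace_chapman₂_zero :
    Module.rank ℝ (dirichletEigenspace chapman₂ 0) = 0 := by
  rw [← dirichletIsospectral_chapman, rank_dirichletEigenspace_chapman₁_zero]

/-! ### The boundaries -/

theorem contDiffOn_and_derivWithin_ne_zero_of_eqOn_line {γ : ℝ → Plane} {P V : Plane} {a b : ℝ}
    (hab : a < b) (hV : V ≠ 0) (h : Set.EqOn γ (fun s => P + s • V) (Set.Icc a b)) :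
    ContDiffOn ℝ ∞ γ (Set.Icc a b) ∧
      ∀ s ∈ Set.Icc a b, derivWithin γ (Set.Icc a b) s ≠ 0 := by
  constructor
  · have hc : ContDiff ℝ ∞ fun s : ℝ => P + s • V := by fun_prop
    exact hc.contDiffOn.congr h
  · intro s hs
    rw [derivWithin_congr h (h hs),
      (hasDerivAt_line P V s).hasDerivWithinAt.derivWithin (uniqueDiffOn_Icc hab s hs)]
    exact hV

theorem isPiecewiseSmoothClosedCurve_frontier_openRectangle (a : Plane) {L H : ℝ} (hL : 0 < L)
    (hH : 0 < H) : IsPiecewiseSmoothClosedCurve (frontier (openRectangle a L H)) := by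
  -- (X, Y) runs once counterclockwise round the unit square, one edge per unit of s. Clamping by
  -- maxima and minima makes continuity immediate and leaves four linear formulas to verify.
  set X : ℝ → ℝ := fun s => max 0 (min 1 (min s (3 - s))) with hX
  set Y : ℝ → ℝ := fun s => max 0 (min 1 (min (s - 1) (4 - s))) with hY
  have c1 : ∀ s, 0 ≤ s → s ≤ 1 → X s = s ∧ Y s = 0 := fun s _ _ => by
    simp only [hX, hY, max_def, min_def]
    constructor <;> split_ifs <;> linarith
  have c2 : ∀ s, 1 ≤ s → s ≤ 2 → X s = 1 ∧ Y s = s - 1 := fun s _ _ => by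
    simp only [hX, hY, max_def, min_def]
    constructor <;> split_ifs <;> linarith
  have c3 : ∀ s, 2 ≤ s → s ≤ 3 → X s = 3 - s ∧ Y s = 1 := fun s _ _ => by
    simp only [hX, hY, max_def, min_def]
    constructor <;> split_ifs <;> linarith
  have c4 : ∀ s, 3 ≤ s → s ≤ 4 → X s = 0 ∧ Y s = 4 - s := fun s _ _ => by
    simp only [hX, hY, max_def, min_def]
    constructor <;> split_ifs <;> linarith
  have cases : ∀ s, 0 ≤ s → s ≤ 4 →
      (0 ≤ s ∧ s ≤ 1 ∧ X s = s ∧ Y s = 0) ∨ (1 ≤ s ∧ s ≤ 2 ∧ X s = 1 ∧ Y s = s - 1) ∨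
      (2 ≤ s ∧ s ≤ 3 ∧ X s = 3 - s ∧ Y s = 1) ∨ (3 ≤ s ∧ s ≤ 4 ∧ X s = 0 ∧ Y s = 4 - s) := by
    intro s h0 h4
    rcases le_total s 1 with h | h
    · exact Or.inl ⟨h0, h, c1 s h0 h⟩
    rcases le_total s 2 with h' | h'
    · exact Or.inr (Or.inl ⟨h, h', c2 s h h'⟩)
    rcases le_total s 3 with h'' | h''
    · exact Or.inr (Or.inr (Or.inl ⟨h', h'', c3 s h' h''⟩))
    · exact Or.inr (Or.inr (Or.inr ⟨h'', h4, c4 s h'' h4⟩))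
  clear_value X Y
  have hXc : Continuous X := by rw [hX]; fun_prop
  have hYc : Continuous Y := by rw [hY]; fun_prop
  clear hX hY
  set γ : ℝ → Plane := fun s => !₂[a 0 + L * X s, a 1 + H * Y s] with hγ
  have hγ0 (s : ℝ) : γ s 0 = a 0 + L * X s := by simp [hγ]
  have hγ1 (s : ℝ) : γ s 1 = a 1 + H * Y s := by simp [hγ]
  refine ⟨4, γ, by norm_num, ?_, ?_, ?_, ?_, ?_⟩
  · have : Continuous γ := by fun_prop
    exact this.continuousOn
  · simp [hγ, c1 0 le_rfl zero_le_one, c4 4 (by norm_num) le_rfl]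
  · rintro s ⟨hs0, hs4⟩ t ⟨ht0, ht4⟩ hst
    push_cast at hs4 ht4
    have e0 : X s = X t := by
      have := congrArg (fun p : Plane => p 0) hst
      simp only [hγ0] at this
      exact mul_left_cancel₀ hL.ne' (add_left_cancel this)
    have e1 : Y s = Y t := by
      have := congrArg (fun p : Plane => p 1) hst
      simp only [hγ1] at this
      exact mul_left_cancel₀ hH.ne' (add_left_cancel this)
    -- Two different edges meet at most in a corner, which has one parameter only because 4 is
    -- excluded.
    rcases cases s hs0 hs4.le with ⟨_, _, x1, y1⟩ | ⟨_, _, x1, y1⟩ | ⟨_, _, x1, y1⟩ | ⟨_, _, x1, y1⟩ <;>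
    rcases cases t ht0 ht4.le with ⟨_, _, x2, y2⟩ | ⟨_, _, x2, y2⟩ | ⟨_, _, x2, y2⟩ | ⟨_, _, x2, y2⟩ <;>
    linarith
  · intro i hi
    have hlt : (i : ℝ) < i + 1 := by linarith
    have hne {v w : ℝ} (h : v ≠ 0 ∨ w ≠ 0) : (!₂[v, w] : Plane) ≠ 0 := by
      intro hz
      rcases h with h | h
      · exact h (by simpa using congrArg (fun p : Plane => p 0) hz)
      · exact h (by simpa using congrArg (fun p : Plane => p 1) hz)
    have line (P V : Plane) (hV : V ≠ 0) (h : ∀ s, (i : ℝ) ≤ s → s ≤ i + 1 →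
        a 0 + L * X s = P 0 + s * V 0 ∧ a 1 + H * Y s = P 1 + s * V 1) :=
      contDiffOn_and_derivWithin_ne_zero_of_eqOn_line (γ := γ) hlt hV (P := P) fun s hs => by
        ext j
        obtain ⟨h0, h1⟩ := h s hs.1 hs.2
        fin_cases j
        · simpa [hγ0] using h0
        · simpa [hγ1] using h1
    interval_cases i
    · refine line !₂[a 0, a 1] !₂[L, 0] (hne (Or.inl hL.ne')) fun s h1 h2 => ?_
      push_cast at h1 h2
      obtain ⟨e1, e2⟩ := c1 s (by linarith) (by linarith)
      rw [e1, e2]; simp; ring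
    -- Edges are parametrised by s itself, so the base point is the extrapolation of the edge to s =
    -- 0 and lies off the rectangle from here on.
    · refine line !₂[a 0 + L, a 1 - H] !₂[0, H] (hne (Or.inr hH.ne')) fun s h1 h2 => ?_
      push_cast at h1 h2
      obtain ⟨e1, e2⟩ := c2 s (by linarith) (by linarith)
      rw [e1, e2]; simp; ring
    · refine line !₂[a 0 + 3 * L, a 1 + H] !₂[-L, 0] (hne (Or.inl (neg_ne_zero.2 hL.ne')))
        fun s h1 h2 => ?_
      push_cast at h1 h2
      obtain ⟨e1, e2⟩ := c3 s (by linarith) (by linarith)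
      rw [e1, e2]; simp; ring
    · refine line !₂[a 0, a 1 + 4 * H] !₂[0, -H] (hne (Or.inr (neg_ne_zero.2 hH.ne')))
        fun s h1 h2 => ?_
      push_cast at h1 h2
      obtain ⟨e1, e2⟩ := c4 s (by linarith) (by linarith)
      rw [e1, e2]; simp; ring
  · ext p
    rw [mem_frontier_openRectangle hL hH]
    have hmem (s : ℝ) (h0 : 0 ≤ s) (h4 : s ≤ 4) (e0 : p 0 = a 0 + L * X s)
        (e1 : p 1 = a 1 + H * Y s) : p ∈ γ '' Set.Icc 0 ((4 : ℕ) : ℝ) := by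
      refine ⟨s, ⟨h0, by exact_mod_cast h4⟩, ?_⟩
      ext j
      fin_cases j
      · simpa [hγ0] using e0.symm
      · simpa [hγ1] using e1.symm
    constructor
    · rintro ⟨⟨h1, h2, h3, h4⟩, h⟩
      have x0 : 0 ≤ (p 0 - a 0) / L := div_nonneg (by linarith) hL.le
      have x1 : (p 0 - a 0) / L ≤ 1 := (div_le_one hL).2 (by linarith)
      have y0 : 0 ≤ (p 1 - a 1) / H := div_nonneg (by linarith) hH.le
      have y1 : (p 1 - a 1) / H ≤ 1 := (div_le_one hH).2 (by linarith)
      have ex : p 0 = a 0 + L * ((p 0 - a 0) / L) := by field_simp; ring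
      have ey : p 1 = a 1 + H * ((p 1 - a 1) / H) := by field_simp; ring
      rcases h with h | h | h | h
      · obtain ⟨e1, e2⟩ := c4 (4 - (p 1 - a 1) / H) (by linarith) (by linarith)
        refine hmem (4 - (p 1 - a 1) / H) (by linarith) (by linarith) ?_ ?_
        · rw [e1, h]; ring
        · rw [e2, sub_sub_cancel]; exact ey
      · obtain ⟨e1, e2⟩ := c2 (1 + (p 1 - a 1) / H) (by linarith) (by linarith)
        refine hmem (1 + (p 1 - a 1) / H) (by linarith) (by linarith) ?_ ?_
        · rw [e1, h]; ring
        · rw [e2, add_sub_cancel_left]; exact ey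
      · obtain ⟨e1, e2⟩ := c1 ((p 0 - a 0) / L) (by linarith) (by linarith)
        refine hmem ((p 0 - a 0) / L) (by linarith) (by linarith) ?_ ?_
        · rw [e1]; exact ex
        · rw [e2, h]; ring
      · obtain ⟨e1, e2⟩ := c3 (3 - (p 0 - a 0) / L) (by linarith) (by linarith)
        refine hmem (3 - (p 0 - a 0) / L) (by linarith) (by linarith) ?_ ?_
        · rw [e1, sub_sub_cancel]; exact ex
        · rw [e2, h]; ring
    · rintro ⟨s, ⟨h0, h4⟩, rfl⟩
      push_cast at h4
      rw [hγ0, hγ1]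
      rcases cases s h0 h4 with ⟨_, _, x1, y1⟩ | ⟨_, _, x1, y1⟩ | ⟨_, _, x1, y1⟩ | ⟨_, _, x1, y1⟩ <;>
        rw [x1, y1] <;>
        refine ⟨⟨by nlinarith, by nlinarith, by nlinarith, by nlinarith⟩, ?_⟩ <;> simp

theorem isPiecewiseSmoothClosedCurve_frontier_openRightIsoscelesTriangle (a : Plane) {L : ℝ}
    (hL : 0 < L) :
    IsPiecewiseSmoothClosedCurve (frontier (openRightIsoscelesTriangle a L)) := by
  -- (X, Y) follows the bottom leg, the hypotenuse and the left leg of the unit triangle in turn.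
  set X : ℝ → ℝ := fun s => max 0 (min s (2 - s)) with hX
  set Y : ℝ → ℝ := fun s => max 0 (min (s - 1) (3 - s)) with hY
  have c1 : ∀ s, 0 ≤ s → s ≤ 1 → X s = s ∧ Y s = 0 := fun s _ _ => by
    simp only [hX, hY, max_def, min_def]
    constructor <;> split_ifs <;> linarith
  have c2 : ∀ s, 1 ≤ s → s ≤ 2 → X s = 2 - s ∧ Y s = s - 1 := fun s _ _ => by
    simp only [hX, hY, max_def, min_def]
    constructor <;> split_ifs <;> linarith
  have c3 : ∀ s, 2 ≤ s → s ≤ 3 → X s = 0 ∧ Y s = 3 - s := fun s _ _ => by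
    simp only [hX, hY, max_def, min_def]
    constructor <;> split_ifs <;> linarith
  have cases : ∀ s, 0 ≤ s → s ≤ 3 →
      (0 ≤ s ∧ s ≤ 1 ∧ X s = s ∧ Y s = 0) ∨ (1 ≤ s ∧ s ≤ 2 ∧ X s = 2 - s ∧ Y s = s - 1) ∨
      (2 ≤ s ∧ s ≤ 3 ∧ X s = 0 ∧ Y s = 3 - s) := by
    intro s h0 h4
    rcases le_total s 1 with h | h
    · exact Or.inl ⟨h0, h, c1 s h0 h⟩
    rcases le_total s 2 with h' | h'
    · exact Or.inr (Or.inl ⟨h, h', c2 s h h'⟩)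
    · exact Or.inr (Or.inr ⟨h', h4, c3 s h' h4⟩)
  clear_value X Y
  have hXc : Continuous X := by rw [hX]; fun_prop
  have hYc : Continuous Y := by rw [hY]; fun_prop
  clear hX hY
  set γ : ℝ → Plane := fun s => !₂[a 0 + L * X s, a 1 + L * Y s] with hγ
  have hγ0 (s : ℝ) : γ s 0 = a 0 + L * X s := by simp [hγ]
  have hγ1 (s : ℝ) : γ s 1 = a 1 + L * Y s := by simp [hγ]
  refine ⟨3, γ, by norm_num, ?_, ?_, ?_, ?_, ?_⟩
  · have : Continuous γ := by fun_prop
    exact this.continuousOn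
  · simp [hγ, c1 0 le_rfl zero_le_one, c3 3 (by norm_num) le_rfl]
  · rintro s ⟨hs0, hs4⟩ t ⟨ht0, ht4⟩ hst
    push_cast at hs4 ht4
    have e0 : X s = X t := by
      have := congrArg (fun p : Plane => p 0) hst
      simp only [hγ0] at this
      exact mul_left_cancel₀ hL.ne' (add_left_cancel this)
    have e1 : Y s = Y t := by
      have := congrArg (fun p : Plane => p 1) hst
      simp only [hγ1] at this
      exact mul_left_cancel₀ hL.ne' (add_left_cancel this)
    rcases cases s hs0 hs4.le with ⟨_, _, x1, y1⟩ | ⟨_, _, x1, y1⟩ | ⟨_, _, x1, y1⟩ <;>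
    rcases cases t ht0 ht4.le with ⟨_, _, x2, y2⟩ | ⟨_, _, x2, y2⟩ | ⟨_, _, x2, y2⟩ <;>
    linarith
  · intro i hi
    have hlt : (i : ℝ) < i + 1 := by linarith
    have hne {v w : ℝ} (h : v ≠ 0 ∨ w ≠ 0) : (!₂[v, w] : Plane) ≠ 0 := by
      intro hz
      rcases h with h | h
      · exact h (by simpa using congrArg (fun p : Plane => p 0) hz)
      · exact h (by simpa using congrArg (fun p : Plane => p 1) hz)
    have line (P V : Plane) (hV : V ≠ 0) (h : ∀ s, (i : ℝ) ≤ s → s ≤ i + 1 →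
        a 0 + L * X s = P 0 + s * V 0 ∧ a 1 + L * Y s = P 1 + s * V 1) :=
      contDiffOn_and_derivWithin_ne_zero_of_eqOn_line (γ := γ) hlt hV (P := P) fun s hs => by
        ext j
        obtain ⟨h0, h1⟩ := h s hs.1 hs.2
        fin_cases j
        · simpa [hγ0] using h0
        · simpa [hγ1] using h1
    interval_cases i
    · refine line !₂[a 0, a 1] !₂[L, 0] (hne (Or.inl hL.ne')) fun s h1 h2 => ?_
      push_cast at h1 h2
      obtain ⟨e1, e2⟩ := c1 s (by linarith) (by linarith)
      rw [e1, e2]; simp; ring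
    · refine line !₂[a 0 + 2 * L, a 1 - L] !₂[-L, L] (hne (Or.inr hL.ne')) fun s h1 h2 => ?_
      push_cast at h1 h2
      obtain ⟨e1, e2⟩ := c2 s (by linarith) (by linarith)
      rw [e1, e2]; simp; constructor <;> ring
    · refine line !₂[a 0, a 1 + 3 * L] !₂[0, -L] (hne (Or.inr (neg_ne_zero.2 hL.ne')))
        fun s h1 h2 => ?_
      push_cast at h1 h2
      obtain ⟨e1, e2⟩ := c3 s (by linarith) (by linarith)
      rw [e1, e2]; simp; ring
  · ext p
    rw [mem_frontier_openRightIsoscelesTriangle hL]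
    have hmem (s : ℝ) (h0 : 0 ≤ s) (h4 : s ≤ 3) (e0 : p 0 = a 0 + L * X s)
        (e1 : p 1 = a 1 + L * Y s) : p ∈ γ '' Set.Icc 0 ((3 : ℕ) : ℝ) := by
      refine ⟨s, ⟨h0, by exact_mod_cast h4⟩, ?_⟩
      ext j
      fin_cases j
      · simpa [hγ0] using e0.symm
      · simpa [hγ1] using e1.symm
    constructor
    · rintro ⟨⟨h1, h2, h3⟩, h⟩
      have x0 : 0 ≤ (p 0 - a 0) / L := div_nonneg (by linarith) hL.le
      have x1 : (p 0 - a 0) / L ≤ 1 := (div_le_one hL).2 (by linarith)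
      have y0 : 0 ≤ (p 1 - a 1) / L := div_nonneg (by linarith) hL.le
      have y1 : (p 1 - a 1) / L ≤ 1 := (div_le_one hL).2 (by linarith)
      have ex : p 0 = a 0 + L * ((p 0 - a 0) / L) := by field_simp; ring
      have ey : p 1 = a 1 + L * ((p 1 - a 1) / L) := by field_simp; ring
      rcases h with h | h | h
      · obtain ⟨e1, e2⟩ := c3 (3 - (p 1 - a 1) / L) (by linarith) (by linarith)
        refine hmem (3 - (p 1 - a 1) / L) (by linarith) (by linarith) ?_ ?_
        · rw [e1, h]; ring
        · rw [e2, sub_sub_cancel]; exact ey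
      · obtain ⟨e1, e2⟩ := c1 ((p 0 - a 0) / L) (by linarith) (by linarith)
        refine hmem ((p 0 - a 0) / L) (by linarith) (by linarith) ?_ ?_
        · rw [e1]; exact ex
        · rw [e2, h]; ring
      · obtain ⟨e1, e2⟩ := c2 (1 + (p 1 - a 1) / L) (by linarith) (by linarith)
        refine hmem (1 + (p 1 - a 1) / L) (by linarith) (by linarith) ?_ ?_
        · rw [e1, mul_sub, mul_add, mul_div_cancel₀ _ hL.ne']; linarith
        · rw [e2, add_sub_cancel_left]; exact ey
    · rintro ⟨s, ⟨h0, h4⟩, rfl⟩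
      push_cast at h4
      rw [hγ0, hγ1]
      rcases cases s h0 h4 with ⟨_, _, x1, y1⟩ | ⟨_, _, x1, y1⟩ | ⟨_, _, x1, y1⟩ <;>
        rw [x1, y1]
      · exact ⟨⟨by nlinarith, by nlinarith, by nlinarith⟩, Or.inr (Or.inl (by ring))⟩
      · exact ⟨⟨by nlinarith, by nlinarith, by nlinarith⟩, Or.inr (Or.inr (by ring))⟩
      · exact ⟨⟨by nlinarith, by nlinarith, by nlinarith⟩, Or.inl (by ring)⟩

theorem frontier_union_of_disjoint_closure {A B : Set Plane} (hA : IsOpen A) (hB : IsOpen B)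
    (hd : Disjoint (closure A) (closure B)) :
    frontier (A ∪ B) = frontier A ∪ frontier B := by
  rw [(hA.union hB).frontier_eq, hA.frontier_eq, hB.frontier_eq, closure_union]
  ext p
  have h := @Set.disjoint_left _ (closure A) (closure B)
  have h1 : p ∈ A → p ∈ closure A := fun h => subset_closure h
  have h2 : p ∈ B → p ∈ closure B := fun h => subset_closure h
  have h3 : p ∈ closure A → p ∉ closure B := fun h' => h.1 hd h'
  simp only [Set.mem_sdiff, Set.mem_union]
  tauto

theorem isPiecewiseSmoothlyBounded_union {A B : Set Plane} (hA : IsOpen A) (hB : IsOpen B)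
    (hAc : Convex ℝ A) (hBc : Convex ℝ B) (hAn : A.Nonempty) (hBn : B.Nonempty)
    (hAb : Bornology.IsBounded A) (hBb : Bornology.IsBounded B)
    (hd : Disjoint (closure A) (closure B))
    (hfA : IsPiecewiseSmoothClosedCurve (frontier A))
    (hfB : IsPiecewiseSmoothClosedCurve (frontier B)) :
    IsPiecewiseSmoothlyBounded (A ∪ B) where
  isOpen := hA.union hB
  isCompact_closure := (hAb.union hBb).isCompact_closure
  interior_closure := by
    rw [closure_union, interior_union_of_disjoint_closure (by simpa using hd),
      hAc.interior_closure_eq_interior_of_nonempty_interior (by rwa [hA.interior_eq]),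
      hBc.interior_closure_eq_interior_of_nonempty_interior (by rwa [hB.interior_eq]),
      hA.interior_eq, hB.interior_eq]
  boundary := by
    have hdf : Disjoint (frontier A) (frontier B) :=
      hd.mono frontier_subset_closure frontier_subset_closure
    refine ⟨2, ![frontier A, frontier B], ?_, ?_, ?_⟩
    · rw [Fin.forall_fin_two]; exact ⟨hfA, hfB⟩
    · rw [Fin.forall_fin_two]
      constructor <;> rw [Fin.forall_fin_two]
      · exact ⟨fun h => absurd rfl h, fun _ => hdf⟩
      · exact ⟨fun _ => hdf.symm, fun h => absurd rfl h⟩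
    · rw [frontier_union_of_disjoint_closure hA hB hd]
      ext p
      simp [Fin.exists_fin_two]

theorem isPiecewiseSmoothlyBounded_rectangle_union_triangle {W D L : ℝ} (hW : 0 < W) (hD : 0 < D)
    (hL : 0 < L) (h3 : W < 3) : IsPiecewiseSmoothlyBounded
      (openRectangle !₂[0, 0] W D ∪ openRightIsoscelesTriangle !₂[3, 0] L) := by
  refine isPiecewiseSmoothlyBounded_union (isOpen_openRectangle _ _ _)
    (isOpen_openRightIsoscelesTriangle _ _) (convex_openRectangle _ _ _)
    (convex_openRightIsoscelesTriangle _ _) ⟨!₂[W / 2, D / 2], ?_⟩ ⟨!₂[3 + L / 4, L / 4], ?_⟩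
    (isBounded_openRectangle _ _ _) (isBounded_openRightIsoscelesTriangle _ _)
    (disjoint_closure_rectangle_triangle hW hD hL h3)
    (isPiecewiseSmoothClosedCurve_frontier_openRectangle _ hW hD)
    (isPiecewiseSmoothClosedCurve_frontier_openRightIsoscelesTriangle _ hL)
  · rw [mem_openRectangle_zero]
    simp only [Matrix.cons_val_zero, Matrix.cons_val_one, Set.mem_Ioo]
    refine ⟨⟨?_, ?_⟩, ?_, ?_⟩ <;> linarith
  · simp only [openRightIsoscelesTriangle, Set.mem_ofPred_eq, Matrix.cons_val_zero,
      Matrix.cons_val_one]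
    refine ⟨?_, ?_, ?_⟩ <;> linarith

/-! ### Harmonic functions in a strip -/

/-- `π / 8` times the sine coefficients of `2 x (π - x)`. -/
noncomputable def parabolaCoeff (n : ℕ) : ℝ := (1 - (-1) ^ n) / (n : ℝ) ^ 3

/-- The coefficients of `stripSeries`. -/
noncomputable def stripCoeff (k H : ℝ) (n : ℕ) : ℝ :=
  parabolaCoeff n / (1 - Real.exp (-(2 * n * k * H)))

/-- A series of exponentially decaying harmonic functions on the half plane `y > 0`. -/
noncomputable def stripSeries (k H x y : ℝ) : ℝ :=
  ∑' n : ℕ, stripCoeff k H n * (Real.sin (n * k * x) * Real.exp (-(n * k * y)))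

/-- The harmonic function on the strip `0 < y < H` with a parabola of period `π / k` as boundary
values on `y = 0` and zero on `y = H`. -/
noncomputable def stripHarmonic (k H x y : ℝ) : ℝ :=
  stripSeries k H x y - stripSeries k H x (2 * H - y)

theorem HasSum.congr_summand {f g : ℕ → ℝ} {a : ℝ} (h : HasSum f a) (hfg : ∀ n, g n = f n) :
    HasSum g a := by
  rwa [funext hfg]

theorem parabolaCoeff_nonneg (n : ℕ) : 0 ≤ parabolaCoeff n := by
  unfold parabolaCoeff
  rcases neg_one_pow_eq_or ℝ n with h | h <;> rw [h]
  · simp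
  · norm_num
    positivity

theorem parabolaCoeff_zero : parabolaCoeff 0 = 0 := by simp [parabolaCoeff]

theorem parabolaCoeff_le (n : ℕ) : parabolaCoeff n ≤ 2 * (1 / (n : ℝ) ^ 3) := by
  unfold parabolaCoeff
  rw [div_eq_mul_one_div]
  refine mul_le_mul_of_nonneg_right ?_ (by positivity)
  rcases neg_one_pow_eq_or ℝ n with h | h <;> rw [h] <;> norm_num

theorem summable_parabolaCoeff : Summable parabolaCoeff :=
  Summable.of_nonneg_of_le parabolaCoeff_nonneg parabolaCoeff_le
    ((Real.summable_one_div_nat_pow.2 (by norm_num)).mul_left 2)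

/-- Only odd n contribute, and the odd sines are symmetric about the midpoint of the interval. This
gives `stripSeries_reflect`, on which the boundary values at the far side rest. -/
theorem parabolaCoeff_mul_neg_one_pow (n : ℕ) :
    parabolaCoeff n * (-1) ^ n = -parabolaCoeff n := by
  unfold parabolaCoeff
  rcases neg_one_pow_eq_or ℝ n with h | h <;> rw [h] <;> simp

theorem one_sub_exp_pos {k H : ℝ} (hk : 0 < k) (hH : 0 < H) {n : ℕ} (hn : 0 < n) :
    0 < 1 - Real.exp (-(2 * n * k * H)) := by
  have : (0 : ℝ) < n := by exact_mod_cast hn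
  rw [sub_pos, Real.exp_lt_one_iff, neg_lt_zero]
  positivity

theorem stripCoeff_nonneg {k H : ℝ} (hk : 0 < k) (hH : 0 < H) (n : ℕ) : 0 ≤ stripCoeff k H n := by
  rcases Nat.eq_zero_or_pos n with rfl | hn
  · simp [stripCoeff]
  · exact div_nonneg (parabolaCoeff_nonneg n) (one_sub_exp_pos hk hH hn).le

theorem summable_stripCoeff {k H : ℝ} (hk : 0 < k) (hH : 0 < H) : Summable (stripCoeff k H) := by
  have h1 := one_sub_exp_pos hk hH one_pos
  refine Summable.of_nonneg_of_le (stripCoeff_nonneg hk hH) (fun n => ?_)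
    (summable_parabolaCoeff.div_const (1 - Real.exp (-(2 * (1 : ℕ) * k * H))))
  rcases Nat.eq_zero_or_pos n with rfl | hn
  · simp [stripCoeff, parabolaCoeff_zero]
  -- The denominators increase with n, so the one for n = 1 bounds them all from below.
  · refine div_le_div_of_nonneg_left (parabolaCoeff_nonneg n) h1 ?_
    have : (1 : ℝ) ≤ n := by exact_mod_cast hn
    refine sub_le_sub_left (Real.exp_le_exp.2 (neg_le_neg ?_)) _
    push_cast
    gcongr

theorem abs_stripTerm_le {k H : ℝ} (hk : 0 < k) (hH : 0 < H) (n : ℕ) (x : ℝ) {y : ℝ}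
    (hy : 0 ≤ y) :
    ‖stripCoeff k H n * (Real.sin (n * k * x) * Real.exp (-(n * k * y)))‖ ≤ stripCoeff k H n := by
  rw [norm_mul, norm_mul, Real.norm_of_nonneg (stripCoeff_nonneg hk hH n),
    Real.norm_of_nonneg (Real.exp_pos _).le]
  refine mul_le_of_le_one_right (stripCoeff_nonneg hk hH n) ?_
  refine mul_le_one₀ (Real.abs_sin_le_one _) (Real.exp_pos _).le ?_
  rw [Real.exp_le_one_iff, neg_nonpos]
  positivity

theorem hasSum_stripSeries {k H : ℝ} (hk : 0 < k) (hH : 0 < H) (x : ℝ) {y : ℝ} (hy : 0 ≤ y) :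
    HasSum (fun n : ℕ => stripCoeff k H n * (Real.sin (n * k * x) * Real.exp (-(n * k * y))))
      (stripSeries k H x y) :=
  ((summable_stripCoeff hk hH).of_norm_bounded fun n => abs_stripTerm_le hk hH n x hy).hasSum

theorem continuousOn_stripSeries {k H : ℝ} (hk : 0 < k) (hH : 0 < H) :
    ContinuousOn (fun z : ℝ × ℝ => stripSeries k H z.1 z.2) {z | 0 ≤ z.2} := by
  unfold stripSeries
  refine continuousOn_tsum (fun n => ?_) (summable_stripCoeff hk hH)
    fun n z hz => abs_stripTerm_le hk hH n z.1 hz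
  fun_prop

theorem stripSeries_zero_left (k H y : ℝ) : stripSeries k H 0 y = 0 := by
  simp [stripSeries]

theorem sin_nat_mul_reflect {k : ℝ} (hk : k ≠ 0) (n : ℕ) (x : ℝ) :
    Real.sin (n * k * (Real.pi / k - x)) = -((-1) ^ n * Real.sin (n * k * x)) := by
  rw [← Real.sin_nat_mul_pi_sub]
  congr 1
  field_simp

theorem stripSeries_reflect {k : ℝ} (hk : k ≠ 0) (H x y : ℝ) :
    stripSeries k H (Real.pi / k - x) y = stripSeries k H x y := by
  unfold stripSeries
  refine tsum_congr fun n => ?_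
  rw [sin_nat_mul_reflect hk]
  have := parabolaCoeff_mul_neg_one_pow n
  unfold stripCoeff
  linear_combination (-(Real.sin (n * k * x) * Real.exp (-(n * k * y))) /
    (1 - Real.exp (-(2 * n * k * H)))) * this

/-! ### Harmonicity -/

/-- Along the affine map the Laplacian of Φ is Φ'' times β² + γ². The condition β² + γ² = 0 means γ
= ±iβ, so holomorphic and antiholomorphic substitutions, and with them all orientations of a strip,
are covered at once. -/
theorem harmonicAt_im_comp {Φ : ℂ → ℂ} {U : Set ℂ} (hU : IsOpen U) (hΦ : DifferentiableOn ℂ Φ U)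
    {α β γ : ℂ} (hβγ : β ^ 2 + γ ^ 2 = 0) {p : Plane} (hp : α + p 0 * β + p 1 * γ ∈ U) :
    InnerProductSpace.HarmonicAt (fun p : Plane => (Φ (α + p 0 * β + p 1 * γ)).im) p := by
  set w : Plane → ℂ := fun p => α + p 0 * β + p 1 * γ with hw
  have hwc : ContDiff ℝ 2 w := by
    have h (i : Fin 2) : ContDiff ℝ 2 fun p : Plane => ((p i : ℝ) : ℂ) :=
      Complex.ofRealCLM.contDiff.comp (by fun_prop)
    exact (contDiff_const.add ((h 0).mul contDiff_const)).add ((h 1).mul contDiff_const)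
  have hcd : ∀ q, w q ∈ U → ContDiffAt ℝ 2 (fun q : Plane => (Φ (w q)).im) q := by
    intro q hq
    have h1 : ContDiffAt ℂ 2 Φ (w q) := (hΦ.analyticAt (hU.mem_nhds hq)).contDiffAt
    exact Complex.imCLM.contDiff.contDiffAt.comp q ((h1.restrict_scalars ℝ).comp q hwc.contDiffAt)
  have hlap : ∀ q, w q ∈ U → Δ (fun q : Plane => (Φ (w q)).im) q = 0 := by
    intro q hq
    have hline (i : Fin 2) (t : ℝ) : w (q + t • coordVec i) = w q + t * ![β, γ] i := by
      fin_cases i <;> simp [hw] <;> ring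
    have hder (i : Fin 2) (t : ℝ) :
        HasDerivAt (fun t : ℝ => w q + t * ![β, γ] i) (![β, γ] i) t := by
      simpa using ((hasDerivAt_id t).ofReal_comp.mul_const (![β, γ] i)).const_add (w q)
    have hmem (i : Fin 2) : ∀ᶠ t : ℝ in 𝓝 0, w q + t * ![β, γ] i ∈ U := by
      have : ContinuousAt (fun t : ℝ => w q + t * ![β, γ] i) 0 := (hder i 0).continuousAt
      exact this.eventually_mem (hU.mem_nhds (by simpa using hq))
    rw [laplacian_eq_of_hasDerivAt (hcd q hq)
      (f' := fun i t => (deriv Φ (w q + t * ![β, γ] i) * ![β, γ] i).im)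
      (c := fun i => (deriv (deriv Φ) (w q) * ![β, γ] i * ![β, γ] i).im)]
    · rw [← Complex.add_im]
      have : deriv (deriv Φ) (w q) * ![β, γ] 0 * ![β, γ] 0
          + deriv (deriv Φ) (w q) * ![β, γ] 1 * ![β, γ] 1 = 0 := by
        simp only [Matrix.cons_val_zero, Matrix.cons_val_one]
        linear_combination deriv (deriv Φ) (w q) * hβγ
      rw [this, Complex.zero_im]
    · intro i
      filter_upwards [hmem i] with t ht
      simp only [hline]
      have h1 := ((hΦ.differentiableAt (hU.mem_nhds ht)).hasDerivAt).comp t (hder i t)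
      exact Complex.imCLM.hasFDerivAt.comp_hasDerivAt t h1
    · intro i
      have hd : DifferentiableAt ℂ (deriv Φ) (w q + (0 : ℝ) * ![β, γ] i) := by
        have := ((hΦ.analyticAt (hU.mem_nhds hq)).deriv).differentiableAt
        simpa using this
      have h1 := (hd.hasDerivAt.comp (0 : ℝ) (hder i 0)).mul_const (![β, γ] i)
      have h2 := Complex.imCLM.hasFDerivAt.comp_hasDerivAt (0 : ℝ) h1
      rwa [Complex.ofReal_zero, zero_mul, add_zero] at h2
  refine ⟨hcd p hp, ?_⟩
  filter_upwards [hwc.continuous.continuousAt.eventually_mem (hU.mem_nhds hp)] with q hq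
  exact hlap q hq

/-- The series is the imaginary part of Σ c_n exp(inkw) at w = x + iy, which is holomorphic in the
upper half plane by the Weierstrass M-test. The hypotheses `h1` and `h2` say that x and y have
orthogonal gradients of equal length. -/
theorem harmonicAt_stripSeries {k H : ℝ} (hk : 0 < k) (hH : 0 < H) {x y : Plane → ℝ}
    {α₁ β₁ γ₁ α₂ β₂ γ₂ : ℝ} (hx : ∀ p, x p = α₁ + p 0 * β₁ + p 1 * γ₁)
    (hy : ∀ p, y p = α₂ + p 0 * β₂ + p 1 * γ₂) (h1 : β₁ ^ 2 + γ₁ ^ 2 = β₂ ^ 2 + γ₂ ^ 2)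
    (h2 : β₁ * β₂ + γ₁ * γ₂ = 0) {p : Plane} (hp : 0 < y p) :
    InnerProductSpace.HarmonicAt (fun p => stripSeries k H (x p) (y p)) p := by
  set U : Set ℂ := {w | 0 < w.im} with hU
  have hUo : IsOpen U := isOpen_lt continuous_const Complex.continuous_im
  set Φ : ℂ → ℂ := fun w => ∑' n : ℕ, (stripCoeff k H n : ℂ) * Complex.exp (n * k * w * Complex.I)
    with hΦ
  have hnorm : ∀ (n : ℕ) (w : ℂ), w ∈ U →
      ‖(stripCoeff k H n : ℂ) * Complex.exp (n * k * w * Complex.I)‖ ≤ stripCoeff k H n := by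
    intro n w hw
    rw [norm_mul, Complex.norm_real, Real.norm_of_nonneg (stripCoeff_nonneg hk hH n),
      Complex.norm_exp]
    refine mul_le_of_le_one_right (stripCoeff_nonneg hk hH n) ?_
    rw [Real.exp_le_one_iff]
    have hw' : 0 < w.im := hw
    have : (n * k * w * Complex.I).re = -(n * k * w.im) := by simp
    rw [this, neg_nonpos]
    positivity
  have hd : DifferentiableOn ℂ Φ U :=
    Complex.differentiableOn_tsum_of_summable_norm (summable_stripCoeff hk hH)
      (fun n => by fun_prop) hUo hnorm
  have him : ∀ w ∈ U, stripSeries k H w.re w.im = (Φ w).im := by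
    intro w hw
    have hs : Summable fun n : ℕ =>
        (stripCoeff k H n : ℂ) * Complex.exp (n * k * w * Complex.I) :=
      (summable_stripCoeff hk hH).of_norm_bounded fun n => hnorm n w hw
    rw [hΦ]
    dsimp only
    rw [Complex.im_tsum hs, stripSeries]
    refine tsum_congr fun n => ?_
    rw [Complex.im_ofReal_mul, Complex.exp_im]
    have e1 : (n * k * w * Complex.I).re = -(n * k * w.im) := by simp
    have e2 : (n * k * w * Complex.I).im = n * k * w.re := by simp
    rw [e1, e2]
    ring
  set α : ℂ := ⟨α₁, α₂⟩
  set β : ℂ := ⟨β₁, β₂⟩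
  set γ : ℂ := ⟨γ₁, γ₂⟩
  have hre (q : Plane) : (α + q 0 * β + q 1 * γ).re = x q := by simp [hx, α, β, γ]
  have hi (q : Plane) : (α + q 0 * β + q 1 * γ).im = y q := by simp [hy, α, β, γ]
  have hβγ : β ^ 2 + γ ^ 2 = 0 := by
    apply Complex.ext
    · simp only [sq, Complex.add_re, Complex.mul_re, Complex.zero_re, β, γ]
      linear_combination h1
    · simp only [sq, Complex.add_im, Complex.mul_im, Complex.zero_im, β, γ]
      linear_combination 2 * h2
  have hh := harmonicAt_im_comp hUo hd hβγ (α := α) (p := p) (by simpa only [hU, Set.mem_ofPred_eq, hi])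
  refine (InnerProductSpace.harmonicAt_congr_nhds ?_).2 hh
  have hyc : Continuous y := by
    rw [funext hy]; fun_prop
  filter_upwards [hyc.continuousAt.eventually_mem (isOpen_Ioi.mem_nhds hp)] with q hq
  have hq' : α + q 0 * β + q 1 * γ ∈ U := by
    simpa only [hU, Set.mem_ofPred_eq, hi, Set.mem_Ioi] using hq
  rw [← him _ hq', hre, hi]

theorem harmonicAt_stripHarmonic {k H : ℝ} (hk : 0 < k) (hH : 0 < H) {x y : Plane → ℝ}
    {α₁ β₁ γ₁ α₂ β₂ γ₂ : ℝ} (hx : ∀ p, x p = α₁ + p 0 * β₁ + p 1 * γ₁)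
    (hy : ∀ p, y p = α₂ + p 0 * β₂ + p 1 * γ₂) (h1 : β₁ ^ 2 + γ₁ ^ 2 = β₂ ^ 2 + γ₂ ^ 2)
    (h2 : β₁ * β₂ + γ₁ * γ₂ = 0) {p : Plane} (hp : 0 < y p) (hp' : y p < 2 * H) :
    InnerProductSpace.HarmonicAt (fun p => stripHarmonic k H (x p) (y p)) p := by
  refine (harmonicAt_stripSeries hk hH hx hy h1 h2 hp).sub
    (harmonicAt_stripSeries hk hH (x := x) (y := fun p => 2 * H - y p) (α₂ := 2 * H - α₂)
      (β₂ := -β₂) (γ₂ := -γ₂) hx (fun q => ?_) ?_ ?_ ?_)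
  · rw [hy]; ring
  · rw [h1]; ring
  · linear_combination -h2
  · linarith

theorem continuousOn_stripHarmonic {k H : ℝ} (hk : 0 < k) (hH : 0 < H) {x y : Plane → ℝ}
    (hx : Continuous x) (hy : Continuous y) {S : Set Plane} (hS : ∀ p ∈ S, 0 ≤ y p ∧ y p ≤ 2 * H) :
    ContinuousOn (fun p => stripHarmonic k H (x p) (y p)) S := by
  have h := continuousOn_stripSeries hk hH
  have h1 : ContinuousOn (fun p => stripSeries k H (x p) (y p)) S :=
    h.comp (f := fun p => (x p, y p)) (hx.prodMk hy).continuousOn fun p hp => (hS p hp).1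
  have h2 : ContinuousOn (fun p => stripSeries k H (x p) (2 * H - y p)) S :=
    h.comp (f := fun p => (x p, 2 * H - y p))
      (hx.prodMk (continuous_const.sub hy)).continuousOn fun p hp => sub_nonneg.2 (hS p hp).2
  exact h1.sub h2

/-! ### Boundary values -/

theorem stripHarmonic_zero_left (k H y : ℝ) : stripHarmonic k H 0 y = 0 := by
  simp [stripHarmonic, stripSeries_zero_left]

theorem stripHarmonic_reflect {k : ℝ} (hk : k ≠ 0) (H x y : ℝ) :
    stripHarmonic k H (Real.pi / k - x) y = stripHarmonic k H x y := by
  simp [stripHarmonic, stripSeries_reflect hk]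

theorem stripHarmonic_top (k H x : ℝ) : stripHarmonic k H x H = 0 := by
  simp [stripHarmonic, two_mul]

/-- This is where the denominator in `stripCoeff` comes from: multiplying numerator and denominator
by exp(nkH) turns both differences of exponentials into hyperbolic sines. -/
theorem stripCoeff_mul_exp_sub {k H : ℝ} (hk : 0 < k) (hH : 0 < H) (n : ℕ) (y : ℝ) :
    stripCoeff k H n * (Real.exp (-(n * k * y)) - Real.exp (-(n * k * (2 * H - y)))) =
      parabolaCoeff n * (Real.sinh (n * k * (H - y)) / Real.sinh (n * k * H)) := by
  rcases Nat.eq_zero_or_pos n with rfl | hn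
  · simp
  have h1 := one_sub_exp_pos hk hH hn
  have hn' : (0 : ℝ) < n := by exact_mod_cast hn
  have hs : 0 < Real.sinh (n * k * H) := Real.sinh_pos_iff.2 (by positivity)
  unfold stripCoeff
  rw [div_mul_eq_mul_div, mul_div_assoc]
  congr 1
  rw [div_eq_div_iff h1.ne' hs.ne', Real.sinh_eq, Real.sinh_eq]
  have e1 : Real.exp (-(2 * n * k * H)) = Real.exp (-(n * k * H)) * Real.exp (-(n * k * H)) := by
    rw [← Real.exp_add]; ring_nf
  have e2 : Real.exp (-(n * k * (2 * H - y)))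
      = Real.exp (-(n * k * H)) * Real.exp (-(n * k * H)) * Real.exp (n * k * y) := by
    rw [← Real.exp_add, ← Real.exp_add]; ring_nf
  have e3 : Real.exp (n * k * (H - y)) = Real.exp (n * k * H) * Real.exp (-(n * k * y)) := by
    rw [← Real.exp_add]; ring_nf
  have e4 : Real.exp (-(n * k * (H - y))) = Real.exp (-(n * k * H)) * Real.exp (n * k * y) := by
    rw [← Real.exp_add]; ring_nf
  have e5 : Real.exp (n * k * H) * Real.exp (-(n * k * H)) = 1 := by
    rw [← Real.exp_add]; simp
  rw [e1, e2, e3, e4]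
  linear_combination (Real.exp (-(n * k * H)) * Real.exp (-(n * k * y)) / 2
    - Real.exp (-(n * k * H)) * Real.exp (n * k * y) / 2) * e5

theorem hasSum_stripHarmonic {k H : ℝ} (hk : 0 < k) (hH : 0 < H) (x : ℝ) {y : ℝ} (hy : 0 ≤ y)
    (hy' : y ≤ 2 * H) :
    HasSum (fun n : ℕ => parabolaCoeff n * (Real.sin (n * k * x) *
      (Real.sinh (n * k * (H - y)) / Real.sinh (n * k * H)))) (stripHarmonic k H x y) := by
  have h := (hasSum_stripSeries hk hH x hy).sub
    (hasSum_stripSeries hk hH x (y := 2 * H - y) (by linarith))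
  refine h.congr_summand fun n => ?_
  rw [mul_left_comm, ← stripCoeff_mul_exp_sub hk hH]
  ring

theorem eval_bernoulli_three (x : ℝ) :
    ((Polynomial.bernoulli 3).map (algebraMap ℚ ℝ)).eval x = x ^ 3 - 3 / 2 * x ^ 2 + 1 / 2 * x := by
  simp_rw [Polynomial.bernoulli, Finset.sum_range_succ, Finset.sum_range_zero]
  rw [bernoulli_eq_bernoulli'_of_ne_one (by decide : 3 ≠ 1),
    bernoulli_eq_bernoulli'_of_ne_one (by decide : 2 ≠ 1)]
  simp [bernoulli_one]
  ring

/-- The Fourier series of the third Bernoulli polynomial sums sin(nt)/n³ to a cubic. Adding its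
values at θ and π - θ removes the even n from the series and the cubic term from the sum. -/
theorem hasSum_parabola {θ : ℝ} (h0 : 0 ≤ θ) (h1 : θ ≤ Real.pi) :
    HasSum (fun n : ℕ => parabolaCoeff n * Real.sin (n * θ))
      (Real.pi / 4 * (θ * (Real.pi - θ))) := by
  have hpi := Real.pi_pos
  have key : ∀ t, 0 ≤ t → t ≤ Real.pi → HasSum (fun n : ℕ => 1 / (n : ℝ) ^ 3 * Real.sin (n * t))
      ((t ^ 3 - 3 * Real.pi * t ^ 2 + 2 * Real.pi ^ 2 * t) / 12) := by
    intro t ht0 ht1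
    have h := hasSum_one_div_nat_pow_mul_sin one_ne_zero (x := t / (2 * Real.pi))
      ⟨by positivity, by rw [div_le_one (by positivity)]; linarith⟩
    rw [show 2 * 1 + 1 = 3 from rfl, eval_bernoulli_three] at h
    have e : (-1 : ℝ) ^ (1 + 1) * (2 * Real.pi) ^ 3 / 2 / (Nat.factorial 3 : ℝ) *
        ((t / (2 * Real.pi)) ^ 3 - 3 / 2 * (t / (2 * Real.pi)) ^ 2 + 1 / 2 * (t / (2 * Real.pi)))
        = (t ^ 3 - 3 * Real.pi * t ^ 2 + 2 * Real.pi ^ 2 * t) / 12 := by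
      simp only [Nat.factorial]
      field_simp
      push_cast
      ring
    rw [e] at h
    refine h.congr_summand fun n => ?_
    congr 2
    field_simp
  have h := (key θ h0 h1).add (key (Real.pi - θ) (by linarith) (by linarith))
  have e : (θ ^ 3 - 3 * Real.pi * θ ^ 2 + 2 * Real.pi ^ 2 * θ) / 12 + ((Real.pi - θ) ^ 3
      - 3 * Real.pi * (Real.pi - θ) ^ 2 + 2 * Real.pi ^ 2 * (Real.pi - θ)) / 12
      = Real.pi / 4 * (θ * (Real.pi - θ)) := by ring
  rw [e] at h
  refine h.congr_summand fun n => ?_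
  rw [mul_sub, Real.sin_nat_mul_pi_sub, parabolaCoeff]
  ring

theorem stripHarmonic_bottom {k H : ℝ} (hk : 0 < k) (hH : 0 < H) {x : ℝ} (hx : 0 ≤ x)
    (hx' : x ≤ Real.pi / k) :
    stripHarmonic k H x 0 = Real.pi / 4 * (k * x * (Real.pi - k * x)) := by
  have h1 := hasSum_stripHarmonic hk hH x le_rfl (by linarith : (0 : ℝ) ≤ 2 * H)
  have h2 := hasSum_parabola (θ := k * x) (by positivity)
    (by rwa [le_div_iff₀ hk, mul_comm] at hx')
  refine h1.unique (h2.congr_summand fun n => ?_)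
  rcases Nat.eq_zero_or_pos n with rfl | hn
  · simp
  · have hn' : (0 : ℝ) < n := by exact_mod_cast hn
    have hs : 0 < Real.sinh (n * k * H) := Real.sinh_pos_iff.2 (by positivity)
    rw [sub_zero, div_self hs.ne', mul_one, mul_assoc]

/-! ### Torsion functions of rectangles and triangles -/

theorem contDiff_parabola (a b c D : ℝ) :
    ContDiff ℝ 2 fun p : Plane => c * ((p 0 * a + p 1 * b) * (D - (p 0 * a + p 1 * b))) := by
  fun_prop

theorem laplacian_parabola (a b c D : ℝ) (p : Plane) :
    Δ (fun p : Plane => c * ((p 0 * a + p 1 * b) * (D - (p 0 * a + p 1 * b)))) p =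
      -(2 * c * (a ^ 2 + b ^ 2)) := by
  have key (ℓ v t : ℝ) : HasDerivAt (fun t : ℝ => c * ((ℓ + t * v) * (D - (ℓ + t * v))))
      (c * (v * (D - 2 * (ℓ + t * v)))) t := by
    have h := ((hasDerivAt_id t).mul_const v).const_add ℓ
    refine ((h.mul (h.const_sub D)).const_mul c).congr_deriv ?_
    simp only [id]; ring
  have key2 (ℓ v t : ℝ) : HasDerivAt (fun t : ℝ => c * (v * (D - 2 * (ℓ + t * v))))
      (-(2 * c * v ^ 2)) t := by
    have h := ((hasDerivAt_id t).mul_const v).const_add ℓ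
    refine ((((h.const_mul 2).const_sub D).const_mul v).const_mul c).congr_deriv ?_
    ring
  rw [laplacian_eq_of_hasDerivAt (contDiff_parabola a b c D).contDiffAt
    (f' := fun i t => c * (![a, b] i * (D - 2 * ((p 0 * a + p 1 * b) + t * ![a, b] i))))
    (c := fun i => -(2 * c * (![a, b] i) ^ 2))]
  · simp only [Matrix.cons_val_zero, Matrix.cons_val_one]; ring
  · intro i
    refine Eventually.of_forall fun t => ?_
    refine (key (p 0 * a + p 1 * b) (![a, b] i) t).congr_of_eventuallyEq
      (Eventually.of_forall fun s => ?_)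
    fin_cases i <;> simp <;> left <;> ring
  · exact fun i => key2 _ _ _

/-- A particular solution q corrected by a harmonic function with the same boundary values. -/
theorem isTorsionFunction_indicator {Ω : Set Plane} (hΩ : IsOpen Ω) {q h : Plane → ℝ} (c : ℝ)
    (hq : ContDiff ℝ 2 q) (hqΔ : ∀ p, Δ q p = -1)
    (hh : ∀ p ∈ Ω, InnerProductSpace.HarmonicAt h p) (hc : ContinuousOn h (closure Ω))
    (h0 : ∀ p ∈ frontier Ω, q p = c * h p) :
    IsTorsionFunction Ω (Ω.indicator fun p => q p - c * h p) := by
  have hch (p) (hp : p ∈ Ω) : ContDiffAt ℝ 2 (c • h) p := contDiffAt_const.smul (hh p hp).1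
  have e : (fun p => q p - c * h p) = q - c • h := rfl
  refine ⟨isDirichletFunction_indicator hΩ ?_ ?_ ?_, fun p hp => ?_⟩
  · intro p hp
    exact (hq.contDiffAt.sub (hch p hp)).contDiffWithinAt
  · exact hq.continuous.continuousOn.sub (continuousOn_const.mul hc)
  · intro p hp
    rw [h0 p hp, sub_self]
  · rw [laplacian_indicator hΩ _ hp, e, hq.contDiffAt.laplacian_sub (hch p hp),
      InnerProductSpace.laplacian_smul c (hh p hp).1, hqΔ, (hh p hp).2.eq_of_nhds]
    simp

/-- Correction of the parabola in the torsion function of the rectangle `(0, W) × (0, D)`. -/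
noncomputable def rectangleCorrection (W D : ℝ) (p : Plane) : ℝ :=
  stripHarmonic (Real.pi / D) W (p 1) (p 0) + stripHarmonic (Real.pi / D) W (p 1) (W - p 0)

/-- The torsion function of the rectangle `(0, W) × (0, D)`. -/
noncomputable def rectangleTorsion (W D : ℝ) : Plane → ℝ :=
  (openRectangle !₂[0, 0] W D).indicator fun p =>
    1 / 2 * ((p 0 * 0 + p 1 * 1) * (D - (p 0 * 0 + p 1 * 1)))
      - 2 * D ^ 2 / Real.pi ^ 3 * rectangleCorrection W D p

theorem continuousOn_rectangleCorrection {W D : ℝ} (hW : 0 < W) (hD : 0 < D) :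
    ContinuousOn (rectangleCorrection W D) (closure (openRectangle !₂[0, 0] W D)) := by
  have hk : 0 < Real.pi / D := div_pos Real.pi_pos hD
  rw [closure_openRectangle _ hW hD]
  refine (continuousOn_stripHarmonic hk hW (by fun_prop) (by fun_prop) ?_).add
    (continuousOn_stripHarmonic hk hW (by fun_prop) (by fun_prop) ?_)
  all_goals
    rintro p ⟨h1, h2, h3, h4⟩
    simp only [Matrix.cons_val_zero] at h1 h2
    constructor <;> linarith

theorem isTorsionFunction_rectangleTorsion {W D : ℝ} (hW : 0 < W) (hD : 0 < D) :
    IsTorsionFunction (openRectangle !₂[0, 0] W D) (rectangleTorsion W D) := by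
  have hpi := Real.pi_pos
  have hk : 0 < Real.pi / D := div_pos hpi hD
  have hkD : Real.pi / (Real.pi / D) = D := by field_simp
  refine isTorsionFunction_indicator (isOpen_openRectangle _ _ _) _ (contDiff_parabola 0 1 (1 / 2) D)
    (fun p => by rw [laplacian_parabola]; norm_num) (fun p hp => ?_)
    (continuousOn_rectangleCorrection hW hD) (fun p hp => ?_)
  · obtain ⟨⟨h1, h2⟩, -⟩ := mem_openRectangle_zero.1 hp
    refine InnerProductSpace.HarmonicAt.add
      (harmonicAt_stripHarmonic hk hW (α₁ := 0) (β₁ := 0) (γ₁ := 1) (α₂ := 0) (β₂ := 1) (γ₂ := 0)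
        (fun p => by ring) (fun p => by ring) (by ring) (by ring) h1 (by linarith))
      (harmonicAt_stripHarmonic hk hW (α₁ := 0) (β₁ := 0) (γ₁ := 1) (α₂ := W) (β₂ := -1) (γ₂ := 0)
        (fun p => by ring) (fun p => by ring) (by ring) (by ring) (by linarith) (by linarith))
  · rw [mem_frontier_openRectangle hW hD] at hp
    simp only [Matrix.cons_val_zero, Matrix.cons_val_one, zero_add] at hp
    obtain ⟨⟨h1, h2, h3, h4⟩, h⟩ := hp
    unfold rectangleCorrection
    have hbot := stripHarmonic_bottom hk hW h3 (by rwa [hkD])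
    have e : 2 * D ^ 2 / Real.pi ^ 3 * (Real.pi / 4 *
        (Real.pi / D * p 1 * (Real.pi - Real.pi / D * p 1))) = 1 / 2 * (p 1 * (D - p 1)) := by
      field_simp
      ring
    -- On each vertical side one strip function equals the parabola and the other vanishes; on the
    -- horizontal sides the parabola and both strip functions vanish.
    rcases h with h | h | h | h
    · rw [h, sub_zero, stripHarmonic_top, add_zero, hbot, e]; ring
    · rw [h, sub_self, stripHarmonic_top, zero_add, hbot, e]; ring
    · rw [h, stripHarmonic_zero_left, stripHarmonic_zero_left]; ring
    · have := stripHarmonic_reflect hk.ne' W (0 : ℝ)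
      simp only [hkD, sub_zero, stripHarmonic_zero_left] at this
      rw [h, this, this]; ring

/-- Correction of the parabola in the torsion function of the triangle with legs of length `L`. -/
noncomputable def triangleCorrection (L : ℝ) (p : Plane) : ℝ :=
  stripHarmonic (Real.pi / L) L (p 0) (p 1) + stripHarmonic (Real.pi / L) L (p 1) (p 0)
    - (stripHarmonic (Real.pi / L) L (p 0) (L - p 1) + stripHarmonic (Real.pi / L) L (p 1) (L - p 0))

/-- The torsion function of the triangle with legs of length `L` on the coordinate axes. -/
noncomputable def triangleTorsion (L : ℝ) : Plane → ℝ :=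
  (openRightIsoscelesTriangle !₂[0, 0] L).indicator fun p =>
    1 / 4 * ((p 0 * 1 + p 1 * 1) * (L - (p 0 * 1 + p 1 * 1)))
      - L ^ 2 / Real.pi ^ 3 * triangleCorrection L p

theorem continuousOn_triangleCorrection {L : ℝ} (hL : 0 < L) :
    ContinuousOn (triangleCorrection L) (closure (openRightIsoscelesTriangle !₂[0, 0] L)) := by
  have hk : 0 < Real.pi / L := div_pos Real.pi_pos hL
  rw [closure_openRightIsoscelesTriangle _ hL]
  refine ((continuousOn_stripHarmonic hk hL (by fun_prop) (by fun_prop) ?_).add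
    (continuousOn_stripHarmonic hk hL (by fun_prop) (by fun_prop) ?_)).sub
    ((continuousOn_stripHarmonic hk hL (by fun_prop) (by fun_prop) ?_).add
    (continuousOn_stripHarmonic hk hL (by fun_prop) (by fun_prop) ?_))
  all_goals
    rintro p ⟨h1, h2, h3⟩
    simp only [Matrix.cons_val_zero, Matrix.cons_val_one] at h1 h2 h3
    constructor <;> linarith

/-- The parabola in x + y vanishes on the hypotenuse and equals x(L - x)/4 or y(L - y)/4 on the
legs. On each leg a single term of the correction survives. Reflection in the hypotenuse exchanges
the two groups of terms in the correction, so it vanishes there too. -/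
theorem isTorsionFunction_triangleTorsion {L : ℝ} (hL : 0 < L) :
    IsTorsionFunction (openRightIsoscelesTriangle !₂[0, 0] L) (triangleTorsion L) := by
  have hpi := Real.pi_pos
  have hk : 0 < Real.pi / L := div_pos hpi hL
  have hkL : Real.pi / (Real.pi / L) = L := by field_simp
  refine isTorsionFunction_indicator (isOpen_openRightIsoscelesTriangle _ _) _
    (contDiff_parabola 1 1 (1 / 4) L)
    (fun p => by rw [laplacian_parabola]; norm_num) (fun p hp => ?_)
    (continuousOn_triangleCorrection hL) (fun p hp => ?_)
  · obtain ⟨h1, h2, h3⟩ := mem_openRightIsoscelesTriangle_zero.1 hp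
    refine (InnerProductSpace.HarmonicAt.add
      (harmonicAt_stripHarmonic hk hL (α₁ := 0) (β₁ := 1) (γ₁ := 0) (α₂ := 0) (β₂ := 0) (γ₂ := 1)
        (fun p => by ring) (fun p => by ring) (by ring) (by ring) h2 (by linarith))
      (harmonicAt_stripHarmonic hk hL (α₁ := 0) (β₁ := 0) (γ₁ := 1) (α₂ := 0) (β₂ := 1) (γ₂ := 0)
        (fun p => by ring) (fun p => by ring) (by ring) (by ring) h1 (by linarith))).sub
      (InnerProductSpace.HarmonicAt.add
      (harmonicAt_stripHarmonic hk hL (α₁ := 0) (β₁ := 1) (γ₁ := 0) (α₂ := L) (β₂ := 0) (γ₂ := -1)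
        (fun p => by ring) (fun p => by ring) (by ring) (by ring) (by linarith) (by linarith))
      (harmonicAt_stripHarmonic hk hL (α₁ := 0) (β₁ := 0) (γ₁ := 1) (α₂ := L) (β₂ := -1) (γ₂ := 0)
        (fun p => by ring) (fun p => by ring) (by ring) (by ring) (by linarith) (by linarith)))
  · rw [mem_frontier_openRightIsoscelesTriangle hL] at hp
    simp only [Matrix.cons_val_zero, Matrix.cons_val_one, sub_zero] at hp
    obtain ⟨⟨h1, h2, h3⟩, h⟩ := hp
    unfold triangleCorrection
    have e (x : ℝ) : L ^ 2 / Real.pi ^ 3 * (Real.pi / 4 *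
        (Real.pi / L * x * (Real.pi - Real.pi / L * x))) = 1 / 4 * (x * (L - x)) := by
      field_simp
    rcases h with h | h | h
    · rw [h, stripHarmonic_zero_left, stripHarmonic_zero_left, sub_zero, stripHarmonic_top,
        stripHarmonic_bottom hk hL h2 (by rw [hkL]; linarith), zero_add, add_zero, sub_zero, e]
      ring
    · rw [h, stripHarmonic_zero_left, stripHarmonic_zero_left, sub_zero, stripHarmonic_top,
        stripHarmonic_bottom hk hL h1 (by rw [hkL]; linarith), zero_add, add_zero, sub_zero, e]
      ring
    -- On the hypotenuse the terms with plus and minus signs cancel in pairs by this symmetry.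
    · have hr (x y : ℝ) := stripHarmonic_reflect hk.ne' L x y
      simp only [hkL] at hr
      have e0 : p 0 = L - p 1 := by linarith
      have e1 : L - p 0 = p 1 := by linarith
      rw [e1, ← hr (p 0) (p 1), e1, e0, hr]
      ring

/-! ### Torsional rigidities as series -/

/-- The terms of the series `stripHarmonic`. -/
noncomputable def stripTerm (k H : ℝ) (n : ℕ) (x y : ℝ) : ℝ :=
  parabolaCoeff n * (Real.sin (n * k * x) * (Real.sinh (n * k * (H - y)) / Real.sinh (n * k * H)))

theorem abs_stripTerm_le_parabolaCoeff {k H : ℝ} (hk : 0 < k) (n : ℕ) (x : ℝ)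
    {y : ℝ} (hy : 0 ≤ y) (hy' : y ≤ H) : ‖stripTerm k H n x y‖ ≤ parabolaCoeff n := by
  have h1 : 0 ≤ Real.sinh (n * k * (H - y)) :=
    Real.sinh_nonneg_iff.2 (mul_nonneg (by positivity) (by linarith))
  have h2 : Real.sinh (n * k * (H - y)) ≤ Real.sinh (n * k * H) :=
    Real.sinh_le_sinh.2 (mul_le_mul_of_nonneg_left (by linarith) (by positivity))
  unfold stripTerm
  rw [norm_mul, norm_mul, Real.norm_of_nonneg (parabolaCoeff_nonneg n),
    Real.norm_of_nonneg (div_nonneg h1 (h1.trans h2))]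
  refine mul_le_of_le_one_right (parabolaCoeff_nonneg n) ?_
  exact mul_le_one₀ (Real.abs_sin_le_one _) (div_nonneg h1 (h1.trans h2))
    (div_le_one_of_le₀ h2 (h1.trans h2))

theorem continuous_stripTerm (k H : ℝ) (n : ℕ) {X : Type*} [TopologicalSpace X] {x y : X → ℝ}
    (hx : Continuous x) (hy : Continuous y) : Continuous fun p => stripTerm k H n (x p) (y p) := by
  have hs := Real.continuous_sinh
  unfold stripTerm
  fun_prop

/-- Termwise integration, dominated by the summable `parabolaCoeff` times the area; the sinh
quotients are at most 1 because 0 ≤ y ≤ H. -/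
theorem hasSum_setIntegral_stripHarmonic {k H : ℝ} (hk : 0 < k) (hH : 0 < H) {S : Set Plane}
    (hS : IsOpen S) (hb : Bornology.IsBounded S) {x y : Plane → ℝ} (hx : Continuous x)
    (hy : Continuous y) (hSy : ∀ p ∈ S, 0 ≤ y p ∧ y p ≤ H) :
    HasSum (fun n : ℕ => ∫ p in S, stripTerm k H n (x p) (y p))
      (∫ p in S, stripHarmonic k H (x p) (y p)) := by
  have hfin : volume S ≠ ⊤ := hb.measure_lt_top.ne
  have hfin' : IsFiniteMeasure (volume.restrict S) := ⟨by simpa using hb.measure_lt_top⟩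
  have hi (n : ℕ) : Integrable (fun p => stripTerm k H n (x p) (y p)) (volume.restrict S) :=
    ((continuous_stripTerm k H n hx hy).continuousOn.integrableOn_compact
      hb.isCompact_closure).mono_set subset_closure
  have hle (n : ℕ) : ∀ p ∈ S, ‖stripTerm k H n (x p) (y p)‖ ≤ parabolaCoeff n := fun p hp =>
    abs_stripTerm_le_parabolaCoeff hk n _ (hSy p hp).1 (hSy p hp).2
  have hsum : Summable fun n => ∫ p in S, ‖stripTerm k H n (x p) (y p)‖ := by
    refine Summable.of_nonneg_of_le (fun n => integral_nonneg fun p => norm_nonneg _) (fun n => ?_)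
      (summable_parabolaCoeff.mul_right (volume.real S))
    have := setIntegral_mono_on (hi n).norm (integrableOn_const hfin) hS.measurableSet (hle n)
    simpa [mul_comm] using this
  have h := hasSum_integral_of_summable_integral_norm (μ := volume.restrict S) hi hsum
  have e : ∫ p in S, ∑' n, stripTerm k H n (x p) (y p) = ∫ p in S, stripHarmonic k H (x p) (y p) :=
    setIntegral_congr_fun hS.measurableSet fun p hp =>
      (hasSum_stripHarmonic hk hH (x p) (hSy p hp).1 (by linarith [(hSy p hp).2])).tsum_eq
  rwa [e] at h

/-- The coefficients in the series for the torsional rigidities. -/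
noncomputable def rigidityCoeff (n : ℕ) : ℝ := (1 - (-1) ^ n) / (n : ℝ) ^ 5

theorem integral_sin_nat_mul {D : ℝ} (hD : 0 < D) (n : ℕ) :
    ∫ x in Set.Ioo 0 D, Real.sin (n * (Real.pi / D) * x) =
      (1 - (-1) ^ n) / (n * (Real.pi / D)) := by
  rcases Nat.eq_zero_or_pos n with rfl | hn
  · simp
  have hn' : (0 : ℝ) < n := by exact_mod_cast hn
  have hκ : 0 < n * (Real.pi / D) := mul_pos hn' (div_pos Real.pi_pos hD)
  rw [← integral_Ioc_eq_integral_Ioo, ← intervalIntegral.integral_of_le hD.le,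
    intervalIntegral.integral_eq_sub_of_hasDerivAt
      (f := fun x => -(Real.cos (n * (Real.pi / D) * x) / (n * (Real.pi / D))))]
  · have e : n * (Real.pi / D) * D = n * Real.pi := by field_simp
    simp only [e, Real.cos_nat_mul_pi, mul_zero, Real.cos_zero]
    ring
  · intro x _
    refine ((((hasDerivAt_id x).const_mul (n * (Real.pi / D))).cos).div_const
      (n * (Real.pi / D))).neg.congr_deriv ?_
    simp only [id]
    field_simp
  · exact (Continuous.intervalIntegrable (by fun_prop) _ _)

theorem hasDerivAt_cosh_mul_sub (κ H y : ℝ) :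
    HasDerivAt (fun y => Real.cosh (κ * (H - y))) (-(κ * Real.sinh (κ * (H - y)))) y := by
  refine ((((hasDerivAt_id y).const_sub H).const_mul κ).cosh).congr_deriv ?_
  simp only [id]; ring

theorem hasDerivAt_sinh_mul_sub (κ H y : ℝ) :
    HasDerivAt (fun y => Real.sinh (κ * (H - y))) (-(κ * Real.cosh (κ * (H - y)))) y := by
  refine ((((hasDerivAt_id y).const_sub H).const_mul κ).sinh).congr_deriv ?_
  simp only [id]; ring

theorem integral_sinh_mul_sub {κ : ℝ} (hκ : κ ≠ 0) (H b : ℝ) :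
    ∫ y in 0..b, Real.sinh (κ * (H - y)) =
      (Real.cosh (κ * H) - Real.cosh (κ * (H - b))) / κ := by
  have hs := Real.continuous_sinh
  rw [intervalIntegral.integral_eq_sub_of_hasDerivAt
    (f := fun y => -(Real.cosh (κ * (H - y)) / κ))]
  · simp only [sub_zero]; ring
  · intro y _
    refine ((hasDerivAt_cosh_mul_sub κ H y).div_const κ).neg.congr_deriv ?_
    field_simp
  · exact (Continuous.intervalIntegrable (by fun_prop) _ _)

/-- The integrals of the sine and of the hyperbolic sine each contribute a factor D/(nπ), which
turns n⁻³ into n⁻⁵. -/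
theorem setIntegral_stripTerm_rectangle {W D : ℝ} (hW : 0 < W) (hD : 0 < D) (n : ℕ) :
    ∫ p in openRectangle !₂[0, 0] W D, stripTerm (Real.pi / D) W n (p 1) (p 0) =
      2 * D ^ 2 / Real.pi ^ 2 * (rigidityCoeff n *
        ((Real.cosh (n * (Real.pi / D) * W) - 1) / Real.sinh (n * (Real.pi / D) * W))) := by
  set κ := n * (Real.pi / D) with hκ
  have e : ∀ p : Plane, stripTerm (Real.pi / D) W n (p 1) (p 0) =
      (fun x => parabolaCoeff n * (Real.sinh (κ * (W - x)) / Real.sinh (κ * W))) (p 0) *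
        (fun y => Real.sin (κ * y)) (p 1) := fun p => by
    simp only [stripTerm, hκ]; ring
  rw [setIntegral_congr_fun (isOpen_openRectangle _ _ _).measurableSet fun p _ => e p,
    setIntegral_openRectangle_mul_coord W D
      (fun x => parabolaCoeff n * (Real.sinh (κ * (W - x)) / Real.sinh (κ * W)))
      (fun y => Real.sin (κ * y)), integral_sin_nat_mul hD, integral_const_mul, integral_div]
  rcases Nat.eq_zero_or_pos n with rfl | hn
  · simp [parabolaCoeff, rigidityCoeff]
  have hn' : (0 : ℝ) < n := by exact_mod_cast hn
  have hκ0 : 0 < κ := mul_pos hn' (div_pos Real.pi_pos hD)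
  rw [← integral_Ioc_eq_integral_Ioo, ← intervalIntegral.integral_of_le hW.le,
    integral_sinh_mul_sub hκ0.ne', sub_self, mul_zero, Real.cosh_zero, ← hκ]
  -- The factor 1 - (-1)^n is 0 or 2; it occurs once in the coefficient and once in the integral of
  -- the sine.
  have hsq : ((1 : ℝ) - (-1) ^ n) * (1 - (-1) ^ n) = 2 * (1 - (-1) ^ n) := by
    rcases neg_one_pow_eq_or ℝ n with h | h <;> rw [h] <;> norm_num
  have e2 : parabolaCoeff n * ((Real.cosh (κ * W) - 1) / κ / Real.sinh (κ * W)) *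
      ((1 - (-1) ^ n) / κ) = ((1 - (-1) ^ n) * (1 - (-1) ^ n)) / (n ^ 3 * κ ^ 2) *
        ((Real.cosh (κ * W) - 1) / Real.sinh (κ * W)) := by
    unfold parabolaCoeff
    field_simp
  rw [e2, hsq, rigidityCoeff, ← mul_assoc]
  congr 1
  rw [hκ]
  field_simp

theorem setIntegral_stripTerm_rectangle_reflect {W : ℝ} (hW : 0 < W) (D k : ℝ) (n : ℕ) :
    ∫ p in openRectangle !₂[0, 0] W D, stripTerm k W n (p 1) (W - p 0) =
      ∫ p in openRectangle !₂[0, 0] W D, stripTerm k W n (p 1) (p 0) := by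
  have hm := (isOpen_openRectangle !₂[0, 0] W D).measurableSet
  set f : ℝ → ℝ := fun x =>
    parabolaCoeff n * (Real.sinh (n * k * (W - x)) / Real.sinh (n * k * W)) with hf
  have e (g : ℝ → ℝ) : ∀ p : Plane, stripTerm k W n (p 1) (g (p 0)) =
      (fun x => f (g x)) (p 0) * (fun y => Real.sin (n * k * y)) (p 1) := fun p => by
    simp only [stripTerm, hf]; ring
  rw [setIntegral_congr_fun hm fun p _ => e (fun x => W - x) p,
    setIntegral_congr_fun hm fun p _ => e (fun x => x) p,
    setIntegral_openRectangle_mul_coord W D (fun x => f (W - x)) fun y => Real.sin (n * k * y),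
    setIntegral_openRectangle_mul_coord W D (fun x => f x) fun y => Real.sin (n * k * y)]
  congr 1
  rw [← integral_Ioc_eq_integral_Ioo, ← integral_Ioc_eq_integral_Ioo,
    ← intervalIntegral.integral_of_le hW.le, ← intervalIntegral.integral_of_le hW.le,
    intervalIntegral.integral_comp_sub_left f, sub_self, sub_zero]

/-- The series for the torsional rigidity of a rectangle. -/
theorem hasSum_integral_rectangleTorsion {W D : ℝ} (hW : 0 < W) (hD : 0 < D) :
    HasSum (fun n : ℕ => rigidityCoeff n *
      ((Real.cosh (n * (Real.pi / D) * W) - 1) / Real.sinh (n * (Real.pi / D) * W)))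
      (Real.pi ^ 5 / (8 * D ^ 4) * (W * D ^ 3 / 12 - ∫ p, rectangleTorsion W D p)) := by
  have hpi := Real.pi_pos
  have hk : 0 < Real.pi / D := div_pos hpi hD
  have ho := isOpen_openRectangle !₂[0, 0] W D
  have hb := isBounded_openRectangle !₂[0, 0] W D
  have h1 := hasSum_setIntegral_stripHarmonic hk hW ho hb (x := fun p => p 1) (y := fun p => p 0)
    (by fun_prop) (by fun_prop) fun p hp => by
      have := (mem_openRectangle_zero.1 hp).1
      exact ⟨this.1.le, this.2.le⟩
  have h2 := hasSum_setIntegral_stripHarmonic hk hW ho hb (x := fun p => p 1)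
    (y := fun p => W - p 0) (by fun_prop) (by fun_prop) fun p hp => by
      have := (mem_openRectangle_zero.1 hp).1
      constructor <;> linarith [this.1, this.2]
  have hi {f : Plane → ℝ} (hf : ContinuousOn f (closure (openRectangle !₂[0, 0] W D))) :
      IntegrableOn f (openRectangle !₂[0, 0] W D) :=
    (hf.integrableOn_compact hb.isCompact_closure).mono_set subset_closure
  have hcl : ∀ p ∈ closure (openRectangle !₂[0, 0] W D), 0 ≤ p 0 ∧ p 0 ≤ W := by
    rw [closure_openRectangle _ hW hD]
    rintro p ⟨h1, h2, -⟩
    simpa using And.intro h1 h2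
  have hadd : ∫ p in openRectangle !₂[0, 0] W D, rectangleCorrection W D p =
      (∫ p in openRectangle !₂[0, 0] W D, stripHarmonic (Real.pi / D) W (p 1) (p 0)) +
      ∫ p in openRectangle !₂[0, 0] W D, stripHarmonic (Real.pi / D) W (p 1) (W - p 0) := by
    refine integral_add (hi (continuousOn_stripHarmonic hk hW (by fun_prop) (by fun_prop) ?_))
      (hi (continuousOn_stripHarmonic hk hW (by fun_prop) (by fun_prop) ?_))
    · exact fun p hp => ⟨(hcl p hp).1, by linarith [(hcl p hp).2]⟩
    · exact fun p hp => ⟨by linarith [(hcl p hp).2], by linarith [(hcl p hp).1]⟩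
  have h3 := h1.add h2
  rw [← hadd] at h3
  have hpar : ∫ p in openRectangle !₂[0, 0] W D,
      1 / 2 * ((p 0 * 0 + p 1 * 1) * (D - (p 0 * 0 + p 1 * 1))) = W * D ^ 3 / 12 := by
    have e : ∀ p : Plane, 1 / 2 * ((p 0 * 0 + p 1 * 1) * (D - (p 0 * 0 + p 1 * 1))) =
        (fun _ => (1 : ℝ)) (p 0) * (fun y => 1 / 2 * (D * y - y ^ 2)) (p 1) := fun p => by ring
    rw [setIntegral_congr_fun ho.measurableSet fun p _ => e p,
      setIntegral_openRectangle_mul_coord W D (fun _ => (1 : ℝ)) fun y => 1 / 2 * (D * y - y ^ 2),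
      ← integral_Ioc_eq_integral_Ioo, ← integral_Ioc_eq_integral_Ioo,
      ← intervalIntegral.integral_of_le hW.le, ← intervalIntegral.integral_of_le hD.le,
      intervalIntegral.integral_const_mul, intervalIntegral.integral_sub
        (Continuous.intervalIntegrable (by fun_prop) _ _)
        (Continuous.intervalIntegrable (by fun_prop) _ _), intervalIntegral.integral_const_mul,
      integral_id, integral_pow, intervalIntegral.integral_const]
    norm_num
    ring
  have hT : ∫ p, rectangleTorsion W D p = W * D ^ 3 / 12 - 2 * D ^ 2 / Real.pi ^ 3 *
      ∫ p in openRectangle !₂[0, 0] W D, rectangleCorrection W D p := by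
    unfold rectangleTorsion
    rw [integral_indicator ho.measurableSet, integral_sub
      (hi (contDiff_parabola 0 1 (1 / 2) D).continuous.continuousOn)
      ((hi (continuousOn_rectangleCorrection hW hD)).const_mul _), hpar, integral_const_mul]
  rw [hT]
  -- The two strip functions have equal integrals, each with the factor 2D²/π²; this normalises
  -- their sum.
  have h4 := h3.mul_left (Real.pi ^ 2 / (4 * D ^ 2))
  have e5 : Real.pi ^ 5 / (8 * D ^ 4) * (W * D ^ 3 / 12 - (W * D ^ 3 / 12 - 2 * D ^ 2 / Real.pi ^ 3 *
      ∫ p in openRectangle !₂[0, 0] W D, rectangleCorrection W D p)) =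
      Real.pi ^ 2 / (4 * D ^ 2) * ∫ p in openRectangle !₂[0, 0] W D, rectangleCorrection W D p := by
    field_simp
    ring
  rw [e5]
  refine h4.congr_summand fun n => ?_
  rw [setIntegral_stripTerm_rectangle_reflect hW, setIntegral_stripTerm_rectangle hW hD]
  field_simp
  ring

/-! ### The triangle -/

theorem setIntegral_triangle {L : ℝ} (hL : 0 < L) {f : Plane → ℝ} (hf : Continuous f) :
    ∫ p in openRightIsoscelesTriangle !₂[0, 0] L, f p =
      ∫ x in 0..L, ∫ y in 0..(L - x), f !₂[x, y] := by
  have ho := isOpen_openRightIsoscelesTriangle !₂[0, 0] L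
  have hb := isBounded_openRightIsoscelesTriangle !₂[0, 0] L
  have hi : Integrable ((openRightIsoscelesTriangle !₂[0, 0] L).indicator f) :=
    (integrable_indicator_iff ho.measurableSet).2
      ((hf.continuousOn.integrableOn_compact hb.isCompact_closure).mono_set subset_closure)
  have hmem (x y : ℝ) : (!₂[x, y] : Plane) ∈ openRightIsoscelesTriangle !₂[0, 0] L ↔
      0 < x ∧ 0 < y ∧ x + y < L := by
    rw [mem_openRightIsoscelesTriangle_zero]; simp
  rw [← integral_indicator ho.measurableSet, integral_plane hi,
    integral_eq_interval_of_support hL.le]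
  · refine intervalIntegral.integral_congr_ae ?_
    refine Eventually.of_forall fun x hx => ?_
    rw [Set.uIoc_of_le hL.le] at hx
    rw [integral_eq_interval_of_support (sub_nonneg.2 hx.2)]
    · rw [intervalIntegral.integral_of_le (sub_nonneg.2 hx.2),
        intervalIntegral.integral_of_le (sub_nonneg.2 hx.2), integral_Ioc_eq_integral_Ioo,
        integral_Ioc_eq_integral_Ioo]
      refine setIntegral_congr_fun measurableSet_Ioo fun y hy => ?_
      exact Set.indicator_of_mem ((hmem x y).2 ⟨hx.1, hy.1, by linarith [hy.2]⟩) f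
    · intro y hy
      refine Set.indicator_of_notMem (fun h => hy ?_) f
      have := (hmem x y).1 h
      exact ⟨this.2.1, by linarith [this.2.2]⟩
  · intro x hx
    have : ∀ y, (openRightIsoscelesTriangle !₂[0, 0] L).indicator f !₂[x, y] = 0 := fun y => by
      refine Set.indicator_of_notMem (fun h => hx ?_) f
      have := (hmem x y).1 h
      exact ⟨this.1, by linarith [this.2.1, this.2.2]⟩
    simp [this]

theorem setIntegral_triangle_swap (L : ℝ) (F : ℝ → ℝ → ℝ) :
    ∫ p in openRightIsoscelesTriangle !₂[0, 0] L, F (p 1) (p 0) =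
      ∫ p in openRightIsoscelesTriangle !₂[0, 0] L, F (p 0) (p 1) := by
  have hm := (isOpen_openRightIsoscelesTriangle !₂[0, 0] L).measurableSet
  rw [← integral_indicator hm, ← integral_indicator hm, integral_plane_eq_integral_prod,
    integral_plane_eq_integral_prod]
  refine Eq.trans ?_ (integral_prod_swap (μ := volume) (ν := volume) (fun z : ℝ × ℝ =>
    (openRightIsoscelesTriangle !₂[0, 0] L).indicator (fun p => F (p 0) (p 1)) !₂[z.1, z.2]))
  refine integral_congr_ae (Eventually.of_forall fun z => ?_)
  have hiff : (!₂[z.1, z.2] : Plane) ∈ openRightIsoscelesTriangle !₂[0, 0] L ↔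
      (!₂[z.2, z.1] : Plane) ∈ openRightIsoscelesTriangle !₂[0, 0] L := by
    rw [mem_openRightIsoscelesTriangle_zero, mem_openRightIsoscelesTriangle_zero]
    simp only [Matrix.cons_val_zero, Matrix.cons_val_one, add_comm]
    tauto
  by_cases h : (!₂[z.1, z.2] : Plane) ∈ openRightIsoscelesTriangle !₂[0, 0] L
  · simp only [Prod.fst_swap, Prod.snd_swap]
    rw [Set.indicator_of_mem h, Set.indicator_of_mem (hiff.1 h)]
    simp
  · simp only [Prod.fst_swap, Prod.snd_swap]
    rw [Set.indicator_of_notMem h, Set.indicator_of_notMem (fun h' => h (hiff.2 h'))]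

theorem integral_sinh_mul {κ : ℝ} (hκ : κ ≠ 0) (b : ℝ) :
    ∫ y in 0..b, Real.sinh (κ * y) = (Real.cosh (κ * b) - 1) / κ := by
  have h := integral_sinh_mul_sub (neg_ne_zero.2 hκ) 0 b
  simp only [zero_sub, neg_mul_neg, mul_zero, Real.cosh_zero] at h
  rw [h]
  field_simp
  ring

/-- The bracket is the result of integrating a strip term minus its mirror image over 0 < y < L - x.
The hypotheses on κL hold for odd n. -/
theorem integral_sin_mul_cosh {κ L : ℝ} (hκ : κ ≠ 0) (hc : Real.cos (κ * L) = -1)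
    (hs : Real.sin (κ * L) = 0) :
    ∫ x in 0..L, Real.sin (κ * x) *
      ((Real.cosh (κ * L) - Real.cosh (κ * x)) / κ - (Real.cosh (κ * (L - x)) - 1) / κ) =
      (Real.cosh (κ * L) + 1) / κ ^ 2 := by
  have hsinh := Real.continuous_sinh
  have hcosh := Real.continuous_cosh
  rw [intervalIntegral.integral_eq_sub_of_hasDerivAt
    -- In the derivative of sin·sinh - cos·cosh the products cos·sinh cancel, leaving 2κ sin·cosh;
    -- the analogous combination is used for L - x.
    (f := fun x => (-((Real.cosh (κ * L) + 1) * Real.cos (κ * x))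
      - (Real.sin (κ * x) * Real.sinh (κ * x) - Real.cos (κ * x) * Real.cosh (κ * x)) / 2
      + (Real.sin (κ * x) * Real.sinh (κ * (L - x))
        + Real.cos (κ * x) * Real.cosh (κ * (L - x))) / 2) / κ ^ 2)]
  · simp only [hc, hs, sub_self, mul_zero, sub_zero, Real.cosh_zero, Real.sinh_zero, Real.cos_zero,
      Real.sin_zero]
    ring
  · intro x _
    have h1 := ((hasDerivAt_id x).const_mul κ)
    have d1 := h1.sin
    have d2 := h1.cos
    have d3 := h1.sinh
    have d4 := h1.cosh
    have d5 := hasDerivAt_sinh_mul_sub κ L x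
    have d6 := hasDerivAt_cosh_mul_sub κ L x
    simp only [id] at d1 d2 d3 d4
    refine ((((d2.const_mul (Real.cosh (κ * L) + 1)).neg.sub
      (((d1.mul d3).sub (d2.mul d4)).div_const 2)).add
      (((d1.mul d5).add (d2.mul d6)).div_const 2)).div_const (κ ^ 2)).congr_deriv ?_
    field_simp
    ring
  · exact (Continuous.intervalIntegrable (by fun_prop) _ _)

theorem setIntegral_stripTerm_triangle {L : ℝ} (hL : 0 < L) (n : ℕ) :
    (∫ p in openRightIsoscelesTriangle !₂[0, 0] L, stripTerm (Real.pi / L) L n (p 0) (p 1)) -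
      ∫ p in openRightIsoscelesTriangle !₂[0, 0] L, stripTerm (Real.pi / L) L n (p 0) (L - p 1) =
    L ^ 2 / Real.pi ^ 2 * (rigidityCoeff n *
      ((Real.cosh (n * Real.pi) + 1) / Real.sinh (n * Real.pi))) := by
  have hpi := Real.pi_pos
  -- For even n both coefficients are zero, so only odd n needs the integral.
  rcases neg_one_pow_eq_or ℝ n with hev | hodd
  · simp [stripTerm, parabolaCoeff, rigidityCoeff, hev]
  have hn : 0 < n := Nat.pos_of_ne_zero fun h => by
    rw [h] at hodd; norm_num at hodd
  have hn' : (0 : ℝ) < n := by exact_mod_cast hn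
  set κ := n * (Real.pi / L) with hκ
  have hκ0 : 0 < κ := mul_pos hn' (div_pos hpi hL)
  have hκL : κ * L = n * Real.pi := by rw [hκ]; field_simp
  have hb := isBounded_openRightIsoscelesTriangle !₂[0, 0] L
  have hi {f : Plane → ℝ} (hf : Continuous f) :
      IntegrableOn f (openRightIsoscelesTriangle !₂[0, 0] L) :=
    (hf.continuousOn.integrableOn_compact hb.isCompact_closure).mono_set subset_closure
  have hc1 : Continuous fun p : Plane => stripTerm (Real.pi / L) L n (p 0) (p 1) :=
    continuous_stripTerm _ _ _ (by fun_prop) (by fun_prop)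
  have hc2 : Continuous fun p : Plane => stripTerm (Real.pi / L) L n (p 0) (L - p 1) :=
    continuous_stripTerm _ _ _ (by fun_prop) (by fun_prop)
  have hc3 : Continuous fun p : Plane => stripTerm (Real.pi / L) L n (p 0) (p 1)
      - stripTerm (Real.pi / L) L n (p 0) (L - p 1) := hc1.sub hc2
  rw [← integral_sub (hi hc1) (hi hc2), setIntegral_triangle hL hc3]
  have hsinh := Real.continuous_sinh
  have inner (x : ℝ) : ∫ y in 0..(L - x), (stripTerm (Real.pi / L) L n x y
      - stripTerm (Real.pi / L) L n x (L - y)) =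
      parabolaCoeff n / Real.sinh (κ * L) * (Real.sin (κ * x) *
        ((Real.cosh (κ * L) - Real.cosh (κ * x)) / κ - (Real.cosh (κ * (L - x)) - 1) / κ)) := by
    have e : ∀ y, stripTerm (Real.pi / L) L n x y - stripTerm (Real.pi / L) L n x (L - y) =
        parabolaCoeff n / Real.sinh (κ * L) * Real.sin (κ * x) *
          (Real.sinh (κ * (L - y)) - Real.sinh (κ * y)) := fun y => by
      simp only [stripTerm, sub_sub_cancel, ← hκ]; ring
    simp only [e]
    rw [intervalIntegral.integral_const_mul, intervalIntegral.integral_sub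
      (Continuous.intervalIntegrable (by fun_prop) _ _)
      (Continuous.intervalIntegrable (by fun_prop) _ _), integral_sinh_mul_sub hκ0.ne',
      integral_sinh_mul hκ0.ne', sub_sub_cancel]
    ring
  simp only [Matrix.cons_val_zero, Matrix.cons_val_one, inner]
  rw [intervalIntegral.integral_const_mul, integral_sin_mul_cosh hκ0.ne'
    (by rw [hκL, Real.cos_nat_mul_pi, hodd]) (by rw [hκL, Real.sin_nat_mul_pi]), hκL, hκ,
    rigidityCoeff, parabolaCoeff]
  field_simp

/-- The series for the torsional rigidity of a right isosceles triangle. -/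
theorem hasSum_integral_triangleTorsion {L : ℝ} (hL : 0 < L) :
    HasSum (fun n : ℕ => rigidityCoeff n *
      ((Real.cosh (n * Real.pi) + 1) / Real.sinh (n * Real.pi)))
      (Real.pi ^ 5 / (2 * L ^ 4) * (L ^ 4 / 48 - ∫ p, triangleTorsion L p)) := by
  have hpi := Real.pi_pos
  have hk : 0 < Real.pi / L := div_pos hpi hL
  have ho := isOpen_openRightIsoscelesTriangle !₂[0, 0] L
  have hb := isBounded_openRightIsoscelesTriangle !₂[0, 0] L
  have hi {f : Plane → ℝ} (hf : ContinuousOn f (closure (openRightIsoscelesTriangle !₂[0, 0] L))) :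
      IntegrableOn f (openRightIsoscelesTriangle !₂[0, 0] L) :=
    (hf.integrableOn_compact hb.isCompact_closure).mono_set subset_closure
  have hcl : ∀ p ∈ closure (openRightIsoscelesTriangle !₂[0, 0] L),
      0 ≤ p 0 ∧ 0 ≤ p 1 ∧ p 0 + p 1 ≤ L := by
    rw [closure_openRightIsoscelesTriangle _ hL]
    rintro p ⟨h1, h2, h3⟩
    simp only [Matrix.cons_val_zero, Matrix.cons_val_one, sub_zero] at h1 h2 h3
    exact ⟨h1, h2, h3⟩
  have h1 := hasSum_setIntegral_stripHarmonic hk hL ho hb (x := fun p => p 0) (y := fun p => p 1)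
    (by fun_prop) (by fun_prop) fun p hp => by
      have := mem_openRightIsoscelesTriangle_zero.1 hp
      constructor <;> linarith [this.1, this.2.1, this.2.2]
  have h2 := hasSum_setIntegral_stripHarmonic hk hL ho hb (x := fun p => p 0)
    (y := fun p => L - p 1) (by fun_prop) (by fun_prop) fun p hp => by
      have := mem_openRightIsoscelesTriangle_zero.1 hp
      constructor <;> linarith [this.1, this.2.1, this.2.2]
  have i1 : IntegrableOn (fun p => stripHarmonic (Real.pi / L) L (p 0) (p 1))
      (openRightIsoscelesTriangle !₂[0, 0] L) :=
    hi (continuousOn_stripHarmonic hk hL (by fun_prop) (by fun_prop) fun p hp => by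
      obtain ⟨_, _, _⟩ := hcl p hp
      constructor <;> linarith)
  have i2 : IntegrableOn (fun p => stripHarmonic (Real.pi / L) L (p 1) (p 0))
      (openRightIsoscelesTriangle !₂[0, 0] L) :=
    hi (continuousOn_stripHarmonic hk hL (by fun_prop) (by fun_prop) fun p hp => by
      obtain ⟨_, _, _⟩ := hcl p hp
      constructor <;> linarith)
  have i3 : IntegrableOn (fun p => stripHarmonic (Real.pi / L) L (p 0) (L - p 1))
      (openRightIsoscelesTriangle !₂[0, 0] L) :=
    hi (continuousOn_stripHarmonic hk hL (by fun_prop) (by fun_prop) fun p hp => by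
      obtain ⟨_, _, _⟩ := hcl p hp
      constructor <;> linarith)
  have i4 : IntegrableOn (fun p => stripHarmonic (Real.pi / L) L (p 1) (L - p 0))
      (openRightIsoscelesTriangle !₂[0, 0] L) :=
    hi (continuousOn_stripHarmonic hk hL (by fun_prop) (by fun_prop) fun p hp => by
      obtain ⟨_, _, _⟩ := hcl p hp
      constructor <;> linarith)
  -- The correction is symmetric in the two coordinates, so its four integrals reduce to two, each
  -- doubled.
  have hadd : ∫ p in openRightIsoscelesTriangle !₂[0, 0] L, triangleCorrection L p =
      2 * ((∫ p in openRightIsoscelesTriangle !₂[0, 0] L,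
          stripHarmonic (Real.pi / L) L (p 0) (p 1)) -
        ∫ p in openRightIsoscelesTriangle !₂[0, 0] L,
          stripHarmonic (Real.pi / L) L (p 0) (L - p 1)) := by
    unfold triangleCorrection
    have i12 : IntegrableOn (fun p => stripHarmonic (Real.pi / L) L (p 0) (p 1)
        + stripHarmonic (Real.pi / L) L (p 1) (p 0)) (openRightIsoscelesTriangle !₂[0, 0] L) :=
      i1.add i2
    have i34 : IntegrableOn (fun p => stripHarmonic (Real.pi / L) L (p 0) (L - p 1)
        + stripHarmonic (Real.pi / L) L (p 1) (L - p 0)) (openRightIsoscelesTriangle !₂[0, 0] L) :=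
      i3.add i4
    rw [integral_sub i12 i34, integral_add i1 i2, integral_add i3 i4,
      setIntegral_triangle_swap L (stripHarmonic (Real.pi / L) L),
      setIntegral_triangle_swap L (fun x y => stripHarmonic (Real.pi / L) L x (L - y))]
    ring
  have hpar : ∫ p in openRightIsoscelesTriangle !₂[0, 0] L,
      1 / 4 * ((p 0 * 1 + p 1 * 1) * (L - (p 0 * 1 + p 1 * 1))) = L ^ 4 / 48 := by
    rw [setIntegral_triangle hL (contDiff_parabola 1 1 (1 / 4) L).continuous]
    have inner (x : ℝ) : ∫ y in 0..(L - x), 1 / 4 * ((x * 1 + y * 1) * (L - (x * 1 + y * 1))) =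
        1 / 4 * (L ^ 3 / 6 - L * x ^ 2 / 2 + x ^ 3 / 3) := by
      rw [intervalIntegral.integral_eq_sub_of_hasDerivAt
        (f := fun y => 1 / 4 * (L * (x + y) ^ 2 / 2 - (x + y) ^ 3 / 3))]
      · ring
      · intro y _
        have h := (hasDerivAt_id y).const_add x
        refine (((((h.pow 2).const_mul L).div_const 2).sub ((h.pow 3).div_const 3)).const_mul
          (1 / 4)).congr_deriv ?_
        simp only [id]
        norm_num
        ring
      · exact (Continuous.intervalIntegrable (by fun_prop) _ _)
    simp only [Matrix.cons_val_zero, Matrix.cons_val_one, inner]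
    rw [intervalIntegral.integral_eq_sub_of_hasDerivAt
      (f := fun x => 1 / 4 * (L ^ 3 / 6 * x - L * x ^ 3 / 6 + x ^ 4 / 12))]
    · ring
    · intro x _
      have h := hasDerivAt_id x
      refine (((h.const_mul (L ^ 3 / 6)).sub (((h.pow 3).const_mul L).div_const 6)).add
        ((h.pow 4).div_const 12)).const_mul (1 / 4) |>.congr_deriv ?_
      simp only [id]
      norm_num
      ring
    · exact (Continuous.intervalIntegrable (by fun_prop) _ _)
  have hT : ∫ p, triangleTorsion L p = L ^ 4 / 48 - L ^ 2 / Real.pi ^ 3 *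
      ∫ p in openRightIsoscelesTriangle !₂[0, 0] L, triangleCorrection L p := by
    unfold triangleTorsion
    rw [integral_indicator ho.measurableSet, integral_sub
      (hi (contDiff_parabola 1 1 (1 / 4) L).continuous.continuousOn)
      ((hi (continuousOn_triangleCorrection hL)).const_mul _), hpar, integral_const_mul]
  have h4 := (h1.sub h2).mul_left (Real.pi ^ 2 / L ^ 2)
  rw [hT, hadd]
  have e5 (I : ℝ) : Real.pi ^ 5 / (2 * L ^ 4) * (L ^ 4 / 48 - (L ^ 4 / 48 - L ^ 2 / Real.pi ^ 3 *
      (2 * I))) = Real.pi ^ 2 / L ^ 2 * I := by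
    field_simp
    ring
  rw [e5]
  refine h4.congr_summand fun n => ?_
  rw [setIntegral_stripTerm_triangle hL]
  field_simp

/-! ### Assembling the two domains -/

/-- The torsion function of a rectangle and a disjoint right isosceles triangle. -/
theorem isTorsionFunction_rectangle_union_triangle {W D L : ℝ} (hW : 0 < W) (hD : 0 < D)
    (hL : 0 < L) (h3 : W < 3) :
    IsTorsionFunction (openRectangle !₂[0, 0] W D ∪ openRightIsoscelesTriangle !₂[3, 0] L)
      (rectangleTorsion W D + fun p => triangleTorsion L (p + -!₂[3, 0])) := by
  refine IsTorsionFunction.union (isOpen_openRectangle _ _ _)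
    (isOpen_openRightIsoscelesTriangle _ _) (disjoint_closure_rectangle_triangle hW hD hL h3)
    (isTorsionFunction_rectangleTorsion hW hD) ?_
  rw [openRightIsoscelesTriangle_eq_preimage]
  exact (isTorsionFunction_triangleTorsion hL).comp_add _

theorem setIntegral_rectangle_union_triangle {W D L : ℝ} (hW : 0 < W) (hD : 0 < D)
    (hL : 0 < L) (h3 : W < 3) :
    ∫ p in openRectangle !₂[0, 0] W D ∪ openRightIsoscelesTriangle !₂[3, 0] L,
      (rectangleTorsion W D + fun p => triangleTorsion L (p + -!₂[3, 0]) : Plane → ℝ) p =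
    (∫ p, rectangleTorsion W D p) + ∫ p, triangleTorsion L p := by
  have hu := isTorsionFunction_rectangleTorsion hW hD
  have hv := isTorsionFunction_triangleTorsion hL
  have iu : Integrable (rectangleTorsion W D) := (hu.1.continuous (isOpen_openRectangle _ _ _)).integrable_of_hasCompactSupport
    (hu.1.hasCompactSupport (isBounded_openRectangle _ _ _))
  have iv : Integrable (triangleTorsion L) := (hv.1.continuous (isOpen_openRightIsoscelesTriangle _ _)).integrable_of_hasCompactSupport
    (hv.1.hasCompactSupport (isBounded_openRightIsoscelesTriangle _ _))
  rw [(isTorsionFunction_rectangle_union_triangle hW hD hL h3).1.setIntegral_eq]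
  simp only [Pi.add_apply]
  rw [integral_add iu (iv.comp_add_right _),
    integral_add_right_eq_self (fun p => triangleTorsion L p)]

theorem existsUnique_isTorsionFunction {Ω : TopologicalSpace.Opens Plane} {u : Plane → ℝ}
    (h0 : Module.rank ℝ (dirichletEigenspace Ω 0) = 0) (hu : IsTorsionFunction (Ω : Set Plane) u) :
    ∃! u, IsTorsionFunction (Ω : Set Plane) u :=
  ⟨u, hu, fun _ hv => IsTorsionFunction.unique h0 hv hu⟩

/-! ### Numerical comparison of the rigidities -/

/-- Both sides are tanh(t/2); in the companion below they are coth(t/2). Writing them as rational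
functions of q = exp(-t) allows estimates by powers of q. -/
theorem cosh_sub_one_div_sinh {t : ℝ} (ht : 0 < t) :
    (Real.cosh t - 1) / Real.sinh t = (1 - Real.exp (-t)) / (1 + Real.exp (-t)) := by
  have h1 : 0 < Real.exp (-t) := Real.exp_pos _
  have h2 : Real.exp (-t) < 1 := Real.exp_zero ▸ Real.exp_lt_exp.2 (neg_lt_zero.2 ht)
  have h3 : Real.sinh t ≠ 0 := (Real.sinh_pos_iff.2 ht).ne'
  rw [div_eq_div_iff h3 (by positivity), Real.cosh_eq, Real.sinh_eq]
  have h4 : Real.exp t * Real.exp (-t) = 1 := by rw [← Real.exp_add]; simp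
  linear_combination h4

theorem cosh_add_one_div_sinh {t : ℝ} (ht : 0 < t) :
    (Real.cosh t + 1) / Real.sinh t = (1 + Real.exp (-t)) / (1 - Real.exp (-t)) := by
  have h2 : Real.exp (-t) < 1 := Real.exp_zero ▸ Real.exp_lt_exp.2 (neg_lt_zero.2 ht)
  have h3 : Real.sinh t ≠ 0 := (Real.sinh_pos_iff.2 ht).ne'
  rw [div_eq_div_iff h3 (by linarith), Real.cosh_eq, Real.sinh_eq]
  have h4 : Real.exp t * Real.exp (-t) = 1 := by rw [← Real.exp_add]; simp
  linear_combination -h4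

/-- A lower bound for the terms of the series of differences of torsional rigidities. -/
theorem le_cosh_sub_one_div_sinh_combination {t : ℝ} (ht : 0 < t) :
    3 + 4 * Real.exp (-t) + 6 * Real.exp (-t) ^ 2 ≤
      (Real.cosh t - 1) / Real.sinh t - (Real.cosh (2 * t) - 1) / Real.sinh (2 * t)
        + 3 * ((Real.cosh t + 1) / Real.sinh t) := by
  rw [cosh_sub_one_div_sinh ht, cosh_sub_one_div_sinh (mul_pos two_pos ht),
    cosh_add_one_div_sinh ht, show -(2 * t) = (2 : ℕ) * -t by push_cast; ring, Real.exp_nat_mul]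
  have h1 : 0 < Real.exp (-t) := Real.exp_pos _
  have h2 : Real.exp (-t) < 1 := Real.exp_zero ▸ Real.exp_lt_exp.2 (neg_lt_zero.2 ht)
  set q := Real.exp (-t)
  have h3 : 0 < 1 - q := by linarith
  -- The difference of the hyperbolic tangents is at least -2q, and the cotangent term is at least 3
  -- + 6q + 6q² by its geometric series; the sum is the claimed bound.
  have e1 : (1 - q) / (1 + q) - (1 - q ^ 2) / (1 + q ^ 2) =
      -(2 * q * ((1 - q) / ((1 + q) * (1 + q ^ 2)))) := by
    field_simp
    ring
  have e2 : 3 * ((1 + q) / (1 - q)) = 3 + 6 * q + 6 * q ^ 2 + 6 * q ^ 3 / (1 - q) := by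
    field_simp
    ring
  have h4 : (1 - q) / ((1 + q) * (1 + q ^ 2)) ≤ 1 := by
    rw [div_le_one (by positivity)]
    nlinarith [pow_pos h1 2, pow_pos h1 3]
  have h5 : 0 ≤ 6 * q ^ 3 / (1 - q) := by positivity
  rw [e1, e2]
  nlinarith [mul_le_mul_of_nonneg_left h4 h1.le]

/-- From π < 3.15 and exp(-3.15) = exp(-1)³ exp(-0.15), with 1 + x ≤ exp x for the last factor. -/
theorem lt_exp_neg_pi : 0.0423 < Real.exp (-Real.pi) := by
  have h1 : (0.36787944 : ℝ) ^ 3 ≤ Real.exp (-1) ^ 3 := by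
    gcongr
    exact (lt_trans (by norm_num) Real.exp_neg_one_gt_d9).le
  have h2 : (0.85 : ℝ) ≤ Real.exp (-0.15) := by
    have := Real.add_one_le_exp (-0.15 : ℝ)
    norm_num at this ⊢
    linarith
  have h3 : Real.exp (-1) ^ 3 * Real.exp (-0.15) = Real.exp (-3.15) := by
    rw [← Real.exp_nat_mul, ← Real.exp_add]
    norm_num
  have h4 : Real.exp (-3.15) ≤ Real.exp (-Real.pi) :=
    Real.exp_le_exp.2 (by linarith [Real.pi_lt_d2])
  have h5 : (0.36787944 : ℝ) ^ 3 * 0.85 ≤ Real.exp (-1) ^ 3 * Real.exp (-0.15) := by gcongr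
  norm_num at h5 ⊢
  linarith

theorem pi_pow_five_lt : Real.pi ^ 5 < 306.1 := by
  have h : Real.pi ^ 5 ≤ 3.1416 ^ 5 := by
    gcongr
    exact Real.pi_lt_d4.le
  exact h.trans_lt (by norm_num)

theorem rigidityCoeff_nonneg (n : ℕ) : 0 ≤ rigidityCoeff n := by
  unfold rigidityCoeff
  rcases neg_one_pow_eq_or ℝ n with h | h <;> rw [h] <;> [simp; positivity]

/-- Comparison of the torsional rigidities of the two pairs of polygons. -/
theorem integral_torsion_lt :
    (∫ p, rectangleTorsion 1 1 p) + ∫ p, triangleTorsion 2 p <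
      (∫ p, rectangleTorsion 2 1 p) + ∫ p, triangleTorsion (Real.sqrt 2) p := by
  have hpi : 0 < Real.pi ^ 5 := pow_pos Real.pi_pos 5
  have s1 := hasSum_integral_rectangleTorsion one_pos one_pos
  have s2 := hasSum_integral_rectangleTorsion two_pos one_pos
  have s3 := hasSum_integral_triangleTorsion two_pos
  have s4 := hasSum_integral_triangleTorsion (Real.sqrt_pos.2 two_pos)
  have hs : Real.sqrt 2 ^ 4 = 4 := by
    rw [show (4 : ℕ) = 2 * 2 from rfl, pow_mul, Real.sq_sqrt zero_le_two]; norm_num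
  rw [hs] at s4
  -- The triangle series does not depend on L, so the rigidity scales with L⁴ and the large triangle
  -- has four times that of the small one.
  have e34 := s3.unique s4
  -- The weight 3 comes from eliminating the small triangle: the difference of the two triangle
  -- rigidities is three quarters of the larger.
  have key := (s1.sub s2).add (s3.mul_left 3)
  set f : ℕ → ℝ := fun n => (Real.cosh (n * Real.pi) - 1) / Real.sinh (n * Real.pi)
    - (Real.cosh (2 * (n * Real.pi)) - 1) / Real.sinh (2 * (n * Real.pi))
    + 3 * ((Real.cosh (n * Real.pi) + 1) / Real.sinh (n * Real.pi)) with hf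
  have key' : HasSum (fun n => rigidityCoeff n * f n) _ := key.congr_summand fun n => by
    simp only [hf, div_one, mul_one]
    rw [show (n : ℝ) * Real.pi * 2 = 2 * (n * Real.pi) by ring]
    ring
  have hfn {n : ℕ} (hn : 0 < n) :
      3 + 4 * Real.exp (-(n * Real.pi)) + 6 * Real.exp (-(n * Real.pi)) ^ 2 ≤ f n :=
    le_cosh_sub_one_div_sinh_combination (mul_pos (by exact_mod_cast hn) Real.pi_pos)
  have hnn (n : ℕ) : 0 ≤ rigidityCoeff n * f n := by
    rcases n.eq_zero_or_pos with rfl | hn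
    · simp [rigidityCoeff]
    · exact mul_nonneg (rigidityCoeff_nonneg n) (le_trans (by positivity) (hfn hn))
  -- All terms are nonnegative. The term n = 1 alone is bounded below only by about 6.360, short of
  -- π⁵/48 ≈ 6.375, so n = 3 is kept as well.
  have hle := sum_le_hasSum {1, 3} (fun n _ => hnn n) key'
  rw [Finset.sum_pair (by norm_num)] at hle
  have f1 := hfn one_pos
  have f3 := hfn three_pos
  have hq := lt_exp_neg_pi
  simp only [Nat.cast_one, one_mul] at f1
  have hq2 : (0.0423 : ℝ) ^ 2 < Real.exp (-Real.pi) ^ 2 := by gcongr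
  have q3 := Real.exp_pos (-((3 : ℕ) * Real.pi))
  have f3' : 3 ≤ f 3 := by linarith [pow_pos q3 2]
  have c1 : rigidityCoeff 1 = 2 := by norm_num [rigidityCoeff]
  have c3 : rigidityCoeff 3 = 2 / 243 := by norm_num [rigidityCoeff]
  rw [c1, c3] at hle
  have hp := pi_pow_five_lt
  set A := ∫ p, rectangleTorsion 1 1 p
  set B := ∫ p, rectangleTorsion 2 1 p
  set C := ∫ p, triangleTorsion 2 p
  set E := ∫ p, triangleTorsion (Real.sqrt 2) p
  have hCE : C = 4 * E := by
    have := mul_left_cancel₀ hpi.ne' (a := Real.pi ^ 5) (b := (1 / 32) * (1 / 3 - C))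
      (c := 1 / 8 * (1 / 12 - E)) (by linear_combination e34)
    linarith
  -- The parabolas contribute 1/6 - 1/12 - (3/4)(1/3) = -1/6 to the difference of rigidities, which
  -- is -π⁵/48 after scaling by π⁵/8.
  have hid : Real.pi ^ 5 / 8 * ((B + E) - (A + C)) + Real.pi ^ 5 / 48 =
      Real.pi ^ 5 / (8 * 1 ^ 4) * (1 * 1 ^ 3 / 12 - A) - Real.pi ^ 5 / (8 * 1 ^ 4) *
        (2 * 1 ^ 3 / 12 - B) + 3 * (Real.pi ^ 5 / (2 * 2 ^ 4) * (2 ^ 4 / 48 - C)) := by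
    rw [hCE]
    ring
  -- Numerically, 2(3 + 4·0.0423 + 6·0.0423²) + 6/243 > 6.384, while 306.1/48 < 6.378.
  have hpos : 0 < Real.pi ^ 5 / 8 * ((B + E) - (A + C)) := by
    rw [← hid] at hle
    norm_num at hq2 hq hp
    linarith
  have := pos_of_mul_pos_right hpos (by positivity)
  linarith

theorem theorem1 :
    IsPiecewiseSmoothlyBounded (chapman₁ : Set Plane) ∧
    IsPiecewiseSmoothlyBounded (chapman₂ : Set Plane) ∧
    DirichletIsospectral chapman₁ chapman₂ ∧
    (∃! u, IsTorsionFunction (chapman₁ : Set Plane) u) ∧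
    (∃! u, IsTorsionFunction (chapman₂ : Set Plane) u) ∧
    torsionalRigidity (chapman₁ : Set Plane) < torsionalRigidity (chapman₂ : Set Plane) := by
  have h2 : 0 < Real.sqrt 2 := Real.sqrt_pos.2 two_pos
  have t1 : IsTorsionFunction (chapman₁ : Set Plane) _ :=
    isTorsionFunction_rectangle_union_triangle one_pos one_pos two_pos (by norm_num)
  have t2 : IsTorsionFunction (chapman₂ : Set Plane) _ :=
    isTorsionFunction_rectangle_union_triangle two_pos one_pos h2 (by norm_num)
  refine ⟨isPiecewiseSmoothlyBounded_rectangle_union_triangle one_pos one_pos two_pos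
      (by norm_num),
    isPiecewiseSmoothlyBounded_rectangle_union_triangle two_pos one_pos h2 (by norm_num),
    dirichletIsospectral_chapman,
    existsUnique_isTorsionFunction rank_dirichletEigenspace_chapman₁_zero t1,
    existsUnique_isTorsionFunction rank_dirichletEigenspace_chapman₂_zero t2, ?_⟩
  have e1 := setIntegral_rectangle_union_triangle one_pos one_pos two_pos (by norm_num)
  have e2 := setIntegral_rectangle_union_triangle two_pos one_pos h2 (by norm_num)
  rw [torsionalRigidity_eq rank_dirichletEigenspace_chapman₁_zero t1,
    torsionalRigidity_eq rank_dirichletEigenspace_chapman₂_zero t2]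
  exact (e1.trans_lt integral_torsion_lt).trans_eq e2.symm
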